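/- Let $k$ be a field of characteristic $0$, let $n\ge 0$, let $D=k[x_1,\dots,x_n]\langle\partial_1,\dots,\partial_n\rangle$ be the $n$-th Weyl algebra, and let $D^{(h)}=k[h,x_1,\dots,x_n]\langle\partial_1,\dots,\partial_n\rangle$ be the homogenized Weyl algebra, in which $h$ is central, the $x_i$ commute with each other, the $\partial_i$ commute with each other, and $\partial_ix_j-x_j\partial_i=\delta_{ij}h^2$. Grade $D^{(h)}$ by total degree. Let $L$ be the $(\mathbf 1,\mathbf 1)$-filtration: $L_jD$ is spanned by the monomials $x^\alpha\partial^\beta$ with $|\alpha|+|\beta|\le j$, and $L_jD^{(h)}$ by the monomials $h^lx^\alpha\partial^\beta$ with $|\alpha|+|\beta|\le j$. The associated graded rings are the polynomial rings $S=\operatorname{gr}D=k[x,\partial]$ and $S[h]=\operatorname{gr}D^{(h)}=k[h,x,\partial]$, with their standard gradings. For $\mathbf m\in\mathbb Z^r$ put $L_j[\mathbf m]D^r=\{P : P_l\in L_{j-m_l}D \text{ for all } l\}$, and similarly for $D^{(h)}$; in $(D^{(h)})^r[\mathbf m]$ the $l$-th basis vector has degree $m_l$. All modules are left modules. Let $M$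 be a finitely generated $D$-module. Then there is a free resolution by modules of finite rank $$\mathbf F:\ \cdots\xrightarrow{\varphi_2}D^{r_1}\xrightarrow{\varphi_1}D^{r_0}\xrightarrow{\varphi_0}M\to0$$ with shifts $\mathbf n_i\in\mathbb Z^{r_i}$ such that $\varphi_i(L_j[\mathbf n_i]D^{r_i})\subseteq L_j[\mathbf n_{i-1}]D^{r_{i-1}}$ for all $i\ge1$ and $j\in\mathbb Z$, and such that the induced complex $\operatorname{gr}\mathbf F$ is a graded minimal free resolution over $S$ of $\operatorname{gr}M$, the associated graded module of $M$ for the filtration $\varphi_0(L_j[\mathbf n_0]D^{r_0})$. For every such $\mathbf F$, there are unique $D^{(h)}$-linear maps $\psi_i:(D^{(h)})^{r_i}\to(D^{(h)})^{r_{i-1}}$ ($i\ge1$) that homogenize the $\varphi_i$, i.e. the $(a,b)$ entry of the matrix of $\psi_i$ is homogeneous of degree $n_{i,a}-n_{i-1,b}$ and becomes the $(a,b)$ entry of the matrix of $\varphi_i$ for $h=1$. Let $M^{(h)}=\operatorname{coker}\psi_1$, graded as a quotient of $(D^{(h)})^{r_0}[\mathbf n_0]$ and filtered by the images of the $L_j[\mathbf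 n_0](D^{(h)})^{r_0}$. Let $\mathbf F^{(h)}$ be the complex formed by the $\psi_i$ and the projection $\psi_0$ onto $M^{(h)}$, and grade $\operatorname{gr}M^{(h)}$ by total degree. Then: 1. $M^{(h)}/(h-1)M^{(h)}\cong M$, by the map induced by $h\mapsto1$ and $\varphi_0$. 2. $\mathbf F^{(h)}$ is a graded minimal free resolution of $M^{(h)}$ over $D^{(h)}$. 3. The $\psi_i$ respect the filtrations $L_j[\mathbf n_i](D^{(h)})^{r_i}$, the induced complex $\operatorname{gr}\mathbf F^{(h)}$ is a graded minimal free resolution of $\operatorname{gr}M^{(h)}$ over $S[h]$, and there is an isomorphism of augmented complexes $\operatorname{gr}\mathbf F^{(h)}\cong S[h]\otimes_S\operatorname{gr}\mathbf F=k[h]\otimes_k\operatorname{gr}\mathbf F$ that matches the standard bases. 4. The graded Betti numbers of $M^{(h)}$ over $D^{(h)}$, of $\operatorname{gr}M$ over $S$, and of $\operatorname{gr}M^{(h)}$ over $S[h]$ are well defined and coincide. (The graded Betti number $\beta_{i,j}$ is the number of basis elements of degree $j$ in the $i$-th term of any graded minimal free resolution by modules of finite rank.) 5. $M^{(h)}$,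 $\operatorname{gr}M$ and $\operatorname{gr}M^{(h)}$ have the same projective dimension, over $D^{(h)}$, $S$ and $S[h]$ respectively. -/

import Mathlib

universe u

namespace GradedBetti

/-! ## The Weyl algebra and the homogenized Weyl algebra -/

section Algebras

variable (k : Type u) [Field k] (n : ℕ)

/-- Defining relations of the Weyl algebra; `inl i` stands for `x_i` and `inr i` for `∂_i`. -/
inductive WeylRel : FreeAlgebra k (Fin n ⊕ Fin n) → FreeAlgebra k (Fin n ⊕ Fin n) → Prop
  | xx (i j : Fin n) : WeylRel
      (FreeAlgebra.ι k (Sum.inl i) * FreeAlgebra.ι k (Sum.inl j))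
      (FreeAlgebra.ι k (Sum.inl j) * FreeAlgebra.ι k (Sum.inl i))
  | dd (i j : Fin n) : WeylRel
      (FreeAlgebra.ι k (Sum.inr i) * FreeAlgebra.ι k (Sum.inr j))
      (FreeAlgebra.ι k (Sum.inr j) * FreeAlgebra.ι k (Sum.inr i))
  | dx (i j : Fin n) : WeylRel
      (FreeAlgebra.ι k (Sum.inr i) * FreeAlgebra.ι k (Sum.inl j)
        - FreeAlgebra.ι k (Sum.inl j) * FreeAlgebra.ι k (Sum.inr i))
      (if i = j then 1 else 0)

/-- The `n`-th Weyl algebra `D = k[x₁,…,xₙ]⟨∂₁,…,∂ₙ⟩`. -/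
def Weyl : Type u := RingQuot (WeylRel k n)

noncomputable instance : Ring (Weyl k n) := inferInstanceAs (Ring (RingQuot (WeylRel k n)))

noncomputable instance : Algebra k (Weyl k n) :=
  inferInstanceAs (Algebra k (RingQuot (WeylRel k n)))

/-- The generators `x_i` and `∂_i` of the Weyl algebra. -/
noncomputable def Weyl.gen (a : Fin n ⊕ Fin n) : Weyl k n :=
  RingQuot.mkAlgHom k (WeylRel k n) (FreeAlgebra.ι k a)

/-- Defining relations of the homogenized Weyl algebra; `none` stands for `h`, `some (inl i)` for
`x_i` and `some (inr i)` for `∂_i`. -/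
inductive HWeylRel : FreeAlgebra k (Option (Fin n ⊕ Fin n)) →
    FreeAlgebra k (Option (Fin n ⊕ Fin n)) → Prop
  | xx (i j : Fin n) : HWeylRel
      (FreeAlgebra.ι k (some (Sum.inl i)) * FreeAlgebra.ι k (some (Sum.inl j)))
      (FreeAlgebra.ι k (some (Sum.inl j)) * FreeAlgebra.ι k (some (Sum.inl i)))
  | dd (i j : Fin n) : HWeylRel
      (FreeAlgebra.ι k (some (Sum.inr i)) * FreeAlgebra.ι k (some (Sum.inr j)))
      (FreeAlgebra.ι k (some (Sum.inr j)) * FreeAlgebra.ι k (some (Sum.inr i)))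
  | dx (i j : Fin n) : HWeylRel
      (FreeAlgebra.ι k (some (Sum.inr i)) * FreeAlgebra.ι k (some (Sum.inl j))
        - FreeAlgebra.ι k (some (Sum.inl j)) * FreeAlgebra.ι k (some (Sum.inr i)))
      (if i = j then FreeAlgebra.ι k none ^ 2 else 0)
  | h (a : Fin n ⊕ Fin n) : HWeylRel
      (FreeAlgebra.ι k none * FreeAlgebra.ι k (some a))
      (FreeAlgebra.ι k (some a) * FreeAlgebra.ι k none)

/-- The homogenized Weyl algebra `D^(h) = k[h,x₁,…,xₙ]⟨∂₁,…,∂ₙ⟩`. -/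
def HWeyl : Type u := RingQuot (HWeylRel k n)

noncomputable instance : Ring (HWeyl k n) := inferInstanceAs (Ring (RingQuot (HWeylRel k n)))

noncomputable instance : Algebra k (HWeyl k n) :=
  inferInstanceAs (Algebra k (RingQuot (HWeylRel k n)))

/-- The generators `h`, `x_i` and `∂_i` of the homogenized Weyl algebra. -/
noncomputable def HWeyl.gen (a : Option (Fin n ⊕ Fin n)) : HWeyl k n :=
  RingQuot.mkAlgHom k (HWeylRel k n) (FreeAlgebra.ι k a)

variable {k n}

theorem Weyl.gen_xx (i j : Fin n) : Weyl.gen k n (Sum.inl i) * Weyl.gen k n (Sum.inl j) =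
    Weyl.gen k n (Sum.inl j) * Weyl.gen k n (Sum.inl i) := by
  have := RingQuot.mkAlgHom_rel k (WeylRel.xx (k := k) i j)
  rw [map_mul, map_mul] at this
  exact this

theorem Weyl.gen_dd (i j : Fin n) : Weyl.gen k n (Sum.inr i) * Weyl.gen k n (Sum.inr j) =
    Weyl.gen k n (Sum.inr j) * Weyl.gen k n (Sum.inr i) := by
  have := RingQuot.mkAlgHom_rel k (WeylRel.dd (k := k) i j)
  rw [map_mul, map_mul] at this
  exact this

theorem Weyl.gen_dx (i j : Fin n) : Weyl.gen k n (Sum.inr i) * Weyl.gen k n (Sum.inl j) =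
    Weyl.gen k n (Sum.inl j) * Weyl.gen k n (Sum.inr i) + if i = j then 1 else 0 := by
  have := RingQuot.mkAlgHom_rel k (WeylRel.dx (k := k) i j)
  rw [map_sub, map_mul, map_mul, apply_ite (RingQuot.mkAlgHom k (WeylRel k n)), map_one, map_zero,
    sub_eq_iff_eq_add'] at this
  exact this

theorem HWeyl.gen_xx (i j : Fin n) :
    HWeyl.gen k n (some (Sum.inl i)) * HWeyl.gen k n (some (Sum.inl j)) =
    HWeyl.gen k n (some (Sum.inl j)) * HWeyl.gen k n (some (Sum.inl i)) := by
  have := RingQuot.mkAlgHom_rel k (HWeylRel.xx (k := k) i j)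
  rw [map_mul, map_mul] at this
  exact this

theorem HWeyl.gen_dd (i j : Fin n) :
    HWeyl.gen k n (some (Sum.inr i)) * HWeyl.gen k n (some (Sum.inr j)) =
    HWeyl.gen k n (some (Sum.inr j)) * HWeyl.gen k n (some (Sum.inr i)) := by
  have := RingQuot.mkAlgHom_rel k (HWeylRel.dd (k := k) i j)
  rw [map_mul, map_mul] at this
  exact this

theorem HWeyl.gen_dx (i j : Fin n) :
    HWeyl.gen k n (some (Sum.inr i)) * HWeyl.gen k n (some (Sum.inl j)) =
    HWeyl.gen k n (some (Sum.inl j)) * HWeyl.gen k n (some (Sum.inr i))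
      + if i = j then HWeyl.gen k n none ^ 2 else 0 := by
  have := RingQuot.mkAlgHom_rel k (HWeylRel.dx (k := k) i j)
  rw [map_sub, map_mul, map_mul, apply_ite (RingQuot.mkAlgHom k (HWeylRel k n)), map_pow, map_zero,
    sub_eq_iff_eq_add'] at this
  exact this

theorem HWeyl.gen_h (a : Option (Fin n ⊕ Fin n)) :
    HWeyl.gen k n none * HWeyl.gen k n a = HWeyl.gen k n a * HWeyl.gen k n none := by
  cases a with
  | none => rfl
  | some a =>
    have := RingQuot.mkAlgHom_rel k (HWeylRel.h (k := k) a)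
    rw [map_mul, map_mul] at this
    exact this

variable (k n)

/-- The dehomogenization `D^(h) → D`, `h ↦ 1`. -/
noncomputable def dehom : HWeyl k n →ₐ[k] Weyl k n :=
  RingQuot.liftAlgHom k ⟨FreeAlgebra.lift k fun a => a.elim 1 (Weyl.gen k n), by
    rintro _ _ (⟨i, j⟩ | ⟨i, j⟩ | ⟨i, j⟩ | a)
    · simpa using Weyl.gen_xx i j
    · simpa using Weyl.gen_dd i j
    · rw [map_sub, map_mul, map_mul, apply_ite (FreeAlgebra.lift k _)]
      simpa [sub_eq_iff_eq_add'] using Weyl.gen_dx i j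
    · simp⟩

end Algebras

/-! ## Filtered modules and associated graded modules -/

section Filtered

/-- An increasing `ℤ`-filtration by `k`-subspaces of a module `V` over a
`k`-algebra `A` with chosen generators `gen a` of weight `wt a`, such that `gen a` raises the
filtration degree by at most `wt a`, and commutators of generators raise it by strictly less than
the sum of the weights. -/
structure Filtr (k : Type*) [Field k] {A : Type*} [Ring A] [Algebra k A] {ι : Type*}
    (gen : ι → A) (wt : ι → ℤ) (V : Type*) [AddCommGroup V] [Module k V] [Module A V]
    [IsScalarTower k A V] where
  /-- The `i`-th step of the filtration. -/
  step : ℤ → Submodule k V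
  mono : Monotone step
  smul_mem : ∀ (a : ι) (i : ℤ) (v : V), v ∈ step i → gen a • v ∈ step (i + wt a)
  comm_mem : ∀ (a b : ι) (i : ℤ) (v : V), v ∈ step i →
    (gen a * gen b - gen b * gen a) • v ∈ step (i + wt a + wt b - 1)

variable {k : Type*} [Field k] {A : Type*} [Ring A] [Algebra k A] {ι : Type*}
  {gen : ι → A} {wt : ι → ℤ}
  {V : Type*} [AddCommGroup V] [Module k V] [Module A V] [IsScalarTower k A V]
  {W : Type*} [AddCommGroup W] [Module k W] [Module A W] [IsScalarTower k A W]

/-- The filtration induced on the target of an `A`-linear map `φ`, with steps `φ (F_i)`. -/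
def Filtr.map (F : Filtr k gen wt V) (φ : V →ₗ[A] W) : Filtr k gen wt W where
  step i := (F.step i).map (φ.restrictScalars k)
  mono _ _ h := Submodule.map_mono (F.mono h)
  smul_mem := by
    rintro a i _ ⟨v, hv, rfl⟩
    exact ⟨gen a • v, F.smul_mem a i v hv, by simp⟩
  comm_mem := by
    rintro a b i _ ⟨v, hv, rfl⟩
    exact ⟨_, F.comm_mem a b i v hv, by simp⟩

/-- The shifted filtration on the free module `A^r`: its `j`-th step consists of the vectors `P`
with `P_l ∈ F_{j - m_l}` for all `l`. -/
def Filtr.free (F : Filtr k gen wt A) {r : ℕ} (m : Fin r → ℤ) : Filtr k gen wt (Fin r → A) where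
  step j := Submodule.pi Set.univ fun l => F.step (j - m l)
  mono _ _ h := Submodule.pi_mono fun l _ => F.mono (by omega)
  smul_mem a j P hP l hl := by
    have := F.smul_mem a _ _ (hP l hl)
    change gen a • P l ∈ F.step (j + wt a - m l)
    rwa [show j + wt a - m l = j - m l + wt a by ring]
  comm_mem a b j P hP l hl := by
    have := F.comm_mem a b _ _ (hP l hl)
    change (gen a * gen b - gen b * gen a) • P l ∈ F.step (j + wt a + wt b - 1 - m l)
    rwa [show j + wt a + wt b - 1 - m l = j - m l + wt a + wt b - 1 by ring]

/-- The associated graded module `gr V = ⨁ᵢ F_i / F_{i-1}`. -/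
def Gr (F : Filtr k gen wt V) : Type _ :=
  DirectSum ℤ fun i => F.step i ⧸ (F.step (i - 1)).submoduleOf (F.step i)

namespace Gr

noncomputable instance (F : Filtr k gen wt V) : AddCommGroup (Gr F) :=
  inferInstanceAs (AddCommGroup
    (DirectSum ℤ fun i => F.step i ⧸ (F.step (i - 1)).submoduleOf (F.step i)))

noncomputable instance (F : Filtr k gen wt V) : Module k (Gr F) :=
  inferInstanceAs (Module k
    (DirectSum ℤ fun i => F.step i ⧸ (F.step (i - 1)).submoduleOf (F.step i)))

/-- The symbol map `F_i → F_i / F_{i-1} ⊆ gr V`. -/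
noncomputable def symb (F : Filtr k gen wt V) (i : ℤ) : F.step i →ₗ[k] Gr F :=
  (DirectSum.lof k ℤ (fun i => F.step i ⧸ (F.step (i - 1)).submoduleOf (F.step i)) i).comp
    (Submodule.mkQ _)

theorem symb_congr (F : Filtr k gen wt V) {i j : ℤ} (h : i = j) {v w : V} (hv : v ∈ F.step i)
    (hw : w ∈ F.step j) (e : v = w) : symb F i ⟨v, hv⟩ = symb F j ⟨w, hw⟩ := by
  subst h; subst e; rfl

theorem symb_eq_zero (F : Filtr k gen wt V) {i : ℤ} {v : F.step i} (hv : (v : V) ∈ F.step (i - 1)) :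
    symb F i v = 0 := by
  have : Submodule.mkQ ((F.step (i - 1)).submoduleOf (F.step i)) v = 0 :=
    (Submodule.Quotient.mk_eq_zero _).2 hv
  exact (congrArg (DirectSum.lof k ℤ
    (fun i => F.step i ⧸ (F.step (i - 1)).submoduleOf (F.step i)) i) this).trans (map_zero _)

theorem hom_ext {F : Filtr k gen wt V} {X : Type*} [AddCommGroup X] [Module k X]
    {f g : Gr F →ₗ[k] X} (h : ∀ i v, f (symb F i v) = g (symb F i v)) : f = g := by
  apply DirectSum.linearMap_ext
  intro i
  apply LinearMap.ext
  intro x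
  obtain ⟨v, rfl⟩ := Submodule.mkQ_surjective _ x
  exact h i v

/-- The map of associated graded modules, of degree `w`, induced by a `k`-linear map which raises
filtration degrees by at most `w`: the class of `v ∈ F_i` goes to the class of
`f v ∈ G_{i + w}`. -/
noncomputable def lift (F : Filtr k gen wt V) (G : Filtr k gen wt W) (f : V →ₗ[k] W) (w : ℤ)
    (hf : ∀ i v, v ∈ F.step i → f v ∈ G.step (i + w)) : Gr F →ₗ[k] Gr G :=
  DirectSum.toModule k ℤ _ fun i => Submodule.liftQ _
    ((symb G (i + w)).comp (f.restrict (hf i))) (by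
      intro v hv
      refine symb_eq_zero G ?_
      have := hf (i - 1) v hv
      rwa [show i - 1 + w = i + w - 1 by ring] at this)

theorem lift_symb (F : Filtr k gen wt V) (G : Filtr k gen wt W) (f : V →ₗ[k] W) (w : ℤ)
    (hf : ∀ i v, v ∈ F.step i → f v ∈ G.step (i + w)) (i : ℤ) (v : F.step i) :
    lift F G f w hf (symb F i v) = symb G (i + w) ⟨f v, hf i v v.2⟩ := by
  simp only [lift, symb]
  erw [DirectSum.toModule_lof]
  rfl

/-- The action of a generator on the associated graded module: the class of `v ∈ F_i` goes to
the class of `gen a • v ∈ F_{i + wt a}`. -/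
noncomputable def op (F : Filtr k gen wt V) (a : ι) : Module.End k (Gr F) :=
  lift F F (Algebra.lsmul k k V (gen a)) (wt a) fun i v hv => F.smul_mem a i v hv

theorem op_symb (F : Filtr k gen wt V) (a : ι) (i : ℤ) (v : F.step i) :
    op F a (symb F i v) = symb F (i + wt a) ⟨gen a • (v : V), F.smul_mem a i v v.2⟩ :=
  lift_symb F F _ _ _ i v

theorem op_comm (F : Filtr k gen wt V) (a b : ι) : op F a * op F b = op F b * op F a := by
  apply hom_ext
  intro i v
  simp only [Module.End.mul_apply, op_symb]
  rw [symb_congr F (show i + wt a + wt b = i + wt b + wt a by ring)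
    (F.smul_mem b _ _ (F.smul_mem a i v v.2)) (w := gen b • gen a • (v : V)) (by
      rw [show i + wt b + wt a = i + wt a + wt b by ring]
      exact F.smul_mem b _ _ (F.smul_mem a i v v.2)) rfl, ← sub_eq_zero, ← map_sub]
  refine symb_eq_zero F ?_
  have := F.comm_mem a b i v v.2
  rw [sub_smul, mul_smul, mul_smul] at this
  rwa [show i + wt b + wt a - 1 = i + wt a + wt b - 1 by ring]

theorem isMulCommutative (F : Filtr k gen wt V) :
    IsMulCommutative (Algebra.adjoin k (Set.range (op F))) :=
  Algebra.isMulCommutative_adjoin k (by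
    rintro _ ⟨a, rfl⟩ _ ⟨b, rfl⟩
    exact op_comm F a b)

open scoped IsMulCommutative in
/-- Since the operators `op F a` commute, the polynomial ring acts on the associated graded
module. -/
noncomputable def act (F : Filtr k gen wt V) : MvPolynomial ι k →ₐ[k] Module.End k (Gr F) :=
  haveI := isMulCommutative F
  (Algebra.adjoin k (Set.range (op F))).val.comp
    (MvPolynomial.aeval (R := k) (S₁ := Algebra.adjoin k (Set.range (op F)))
      fun a => ⟨op F a, Algebra.subset_adjoin ⟨a, rfl⟩⟩)

/-- `gr V` is a module over the polynomial ring `k[ι]`, the variable `a` acting by the class of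
`gen a`. -/
noncomputable instance (F : Filtr k gen wt V) : Module (MvPolynomial ι k) (Gr F) :=
  Module.compHom (Gr F) (act F).toRingHom

theorem smul_def (F : Filtr k gen wt V) (p : MvPolynomial ι k) (z : Gr F) :
    p • z = act F p z := rfl

theorem X_smul (F : Filtr k gen wt V) (a : ι) (z : Gr F) :
    (MvPolynomial.X a : MvPolynomial ι k) • z = op F a z := by
  simp [smul_def, act]

theorem C_smul (F : Filtr k gen wt V) (c : k) (z : Gr F) :
    (MvPolynomial.C c : MvPolynomial ι k) • z = c • z := by
  rw [smul_def, ← MvPolynomial.algebraMap_eq, AlgHom.commutes]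
  rfl

instance (F : Filtr k gen wt V) : IsScalarTower k (MvPolynomial ι k) (Gr F) where
  smul_assoc c p z := by
    rw [smul_def, smul_def, map_smul]
    rfl

/-- The map `gr V → gr W` induced by an `A`-linear map compatible with the filtrations. -/
noncomputable def map (F : Filtr k gen wt V) (G : Filtr k gen wt W) (f : V →ₗ[A] W)
    (hf : ∀ i v, v ∈ F.step i → f v ∈ G.step i) : Gr F →ₗ[MvPolynomial ι k] Gr G where
  toFun := lift F G (f.restrictScalars k) 0 (by simpa using hf)
  map_add' := map_add _
  map_smul' p z := by
    have key : ∀ i v, lift F G (f.restrictScalars k) 0 (by simpa using hf) (symb F i v) =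
        symb G i ⟨f v, hf i v v.2⟩ := fun i v => by
      rw [lift_symb]
      exact symb_congr G (add_zero i) _ _ rfl
    induction p using MvPolynomial.induction_on generalizing z with
    | C c => simp only [C_smul, map_smul, RingHom.id_apply]
    | add p q hp hq => simp only [add_smul, map_add, hp, hq, RingHom.id_apply]
    | mul_X p a hp =>
      rw [mul_smul, hp, RingHom.id_apply, RingHom.id_apply, mul_smul]
      congr 1
      rw [X_smul, X_smul]
      have : (lift F G (f.restrictScalars k) 0 (by simpa using hf)).comp (op F a) =
          (op G a).comp (lift F G (f.restrictScalars k) 0 (by simpa using hf)) := by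
        apply hom_ext
        intro i v
        simp only [LinearMap.comp_apply, op_symb, key]
        exact symb_congr G rfl _ _ (by simp)
      exact LinearMap.congr_fun this z

theorem map_symb (F : Filtr k gen wt V) (G : Filtr k gen wt W) (f : V →ₗ[A] W)
    (hf : ∀ i v, v ∈ F.step i → f v ∈ G.step i) (i : ℤ) (v : F.step i) :
    map F G f hf (symb F i v) = symb G i ⟨f v, hf i v v.2⟩ :=
  (lift_symb F G (f.restrictScalars k) 0 (by simpa using hf) i v).trans
    (symb_congr G (add_zero i) _ _ rfl)

/-- The grading of `gr V` by filtration degree: the `j`-th component is `F_j / F_{j-1}`. -/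
noncomputable def grading (F : Filtr k gen wt V) (j : ℤ) : Submodule k (Gr F) :=
  LinearMap.range (symb F j)

/-- The grading of `gr V` induced by a grading `𝒱` of `V`: its `j`-th component is spanned by the
classes in `F_i / F_{i-1}`, for all `i`, of the elements of `F_i` that are homogeneous of
degree `j`. -/
noncomputable def inducedGrading (F : Filtr k gen wt V) (𝒱 : ℤ → Submodule k V) (j : ℤ) :
    Submodule k (Gr F) :=
  ⨆ i : ℤ, ((𝒱 j).submoduleOf (F.step i)).map (symb F i)

end Gr

end Filtered

/-! ## The filtration by the weight `(1,1)` and the gradings by total degree -/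

section Weights

variable (k : Type u) [Field k] (n : ℕ)

/-- The step `L_i D`: the span of the monomials `x^α ∂^β` with `|α| + |β| ≤ i`. A monomial is
written as `x_{u₁} ⋯ x_{uₐ} ∂_{v₁} ⋯ ∂_{v_b}`, where `a = |α|` and `b = |β|`. -/
noncomputable def Weyl.stepL (i : ℤ) : Submodule k (Weyl k n) :=
  Submodule.span k {P | ∃ u v : List (Fin n), ((u.length : ℤ) + v.length ≤ i) ∧
    P = (u.map fun j => Weyl.gen k n (Sum.inl j)).prod *
      (v.map fun j => Weyl.gen k n (Sum.inr j)).prod}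

/-- The step `L_i D^(h)`: the span of the monomials `h^l x^α ∂^β` with `|α| + |β| ≤ i`. -/
noncomputable def HWeyl.stepL (i : ℤ) : Submodule k (HWeyl k n) :=
  Submodule.span k {P | ∃ (l : ℕ) (u v : List (Fin n)), ((u.length : ℤ) + v.length ≤ i) ∧
    P = HWeyl.gen k n none ^ l * ((u.map fun j => HWeyl.gen k n (some (Sum.inl j))).prod *
      (v.map fun j => HWeyl.gen k n (some (Sum.inr j))).prod)}

/-- The grading of `D^(h)` by total degree: the `d`-th component is spanned by the monomials
`h^l x^α ∂^β` with `l + |α| + |β| = d`. -/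
noncomputable def HWeyl.grading (d : ℤ) : Submodule k (HWeyl k n) :=
  Submodule.span k {P | ∃ (l : ℕ) (u v : List (Fin n)), ((l : ℤ) + u.length + v.length = d) ∧
    P = HWeyl.gen k n none ^ l * ((u.map fun j => HWeyl.gen k n (some (Sum.inl j))).prod *
      (v.map fun j => HWeyl.gen k n (some (Sum.inr j))).prod)}

/-- The standard grading of a polynomial ring, with zero components in negative degrees. -/
noncomputable def polyGrading (σ : Type*) (d : ℤ) : Submodule k (MvPolynomial σ k) :=
  if 0 ≤ d then MvPolynomial.homogeneousSubmodule σ k d.toNat else ⊥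

/-- If `d x_i = x_i d + c_i` with `c_i` in the centre, then the commutator of `d` with a word of
length `m + 1` in the `x_i` is a combination of words of length `m` with coefficients `c_i`. -/
theorem commutator_word {A ι : Type*} [Ring A] [Algebra k A] (x : ι → A) (d : A) (c : ι → A)
    (hc : ∀ i j, c i * x j = x j * c i) (h : ∀ j, d * x j = x j * d + c j) (u : List ι) :
    d * (u.map x).prod - (u.map x).prod * d ∈ Submodule.span k
      {P | ∃ (j : ι) (u' : List ι), u'.length + 1 = u.length ∧ P = c j * (u'.map x).prod} := by
  induction u with
  | nil => simp
  | cons j w ih =>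
    have e : d * ((j :: w).map x).prod - ((j :: w).map x).prod * d =
        x j * (d * (w.map x).prod - (w.map x).prod * d) + c j * (w.map x).prod := by
      simp only [List.map_cons, List.prod_cons, mul_sub, ← mul_assoc, h]
      noncomm_ring
    rw [e]
    refine Submodule.add_mem _ ?_ (Submodule.subset_span ⟨j, w, by simp, rfl⟩)
    generalize d * (w.map x).prod - (w.map x).prod * d = z at ih
    induction ih using Submodule.span_induction with
    | mem z hz =>
      obtain ⟨j', u', hu, rfl⟩ := hz
      refine Submodule.subset_span ⟨j', j :: u', by simp [hu], ?_⟩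
      simp only [List.map_cons, List.prod_cons, ← mul_assoc, hc]
    | zero => simp
    | add y z _ _ hy hz => rw [mul_add]; exact Submodule.add_mem _ hy hz
    | smul a z _ hz => rw [mul_smul_comm]; exact Submodule.smul_mem _ _ hz

theorem Weyl.stepL_mono : Monotone (Weyl.stepL k n) := by
  intro i j hij
  apply Submodule.span_mono
  rintro _ ⟨u, v, h, rfl⟩
  exact ⟨u, v, h.trans hij, rfl⟩

theorem HWeyl.stepL_mono : Monotone (HWeyl.stepL k n) := by
  intro i j hij
  apply Submodule.span_mono
  rintro _ ⟨l, u, v, h, rfl⟩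
  exact ⟨l, u, v, h.trans hij, rfl⟩

theorem Weyl.gen_mul_mem (a : Fin n ⊕ Fin n) (i : ℤ) (P : Weyl k n) (hP : P ∈ Weyl.stepL k n i) :
    Weyl.gen k n a * P ∈ Weyl.stepL k n (i + 1) := by
  induction hP using Submodule.span_induction with
  | zero => simp
  | add y z _ _ hy hz => rw [mul_add]; exact Submodule.add_mem _ hy hz
  | smul a z _ hz => rw [mul_smul_comm]; exact Submodule.smul_mem _ _ hz
  | mem P hP =>
    obtain ⟨u, v, h, rfl⟩ := hP
    cases a with
    | inl j =>
      refine Submodule.subset_span ⟨j :: u, v, by simp; omega, ?_⟩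
      simp [mul_assoc]
    | inr j =>
      have := commutator_word k (fun j => Weyl.gen k n (Sum.inl j)) (Weyl.gen k n (Sum.inr j))
        (fun i => if j = i then 1 else 0) (fun a b => by simp) (fun i => Weyl.gen_dx j i) u
      rw [← mul_assoc, ← sub_add_cancel (Weyl.gen k n (Sum.inr j) * _)
        ((u.map fun j => Weyl.gen k n (Sum.inl j)).prod * Weyl.gen k n (Sum.inr j)), add_mul]
      refine Submodule.add_mem _ ?_ (Submodule.subset_span
        ⟨u, j :: v, by simp; omega, by simp [mul_assoc]⟩)
      generalize (_ - _ : Weyl k n) = z at this ⊢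
      induction this using Submodule.span_induction with
      | zero => simp
      | add y z _ _ hy hz => rw [add_mul]; exact Submodule.add_mem _ hy hz
      | smul a z _ hz => rw [smul_mul_assoc]; exact Submodule.smul_mem _ _ hz
      | mem z hz =>
        obtain ⟨i', u', hu, rfl⟩ := hz
        split_ifs
        · exact Submodule.subset_span ⟨u', v, by omega, by simp⟩
        · simp

theorem HWeyl.h_mul_mem (i : ℤ) (P : HWeyl k n) (hP : P ∈ HWeyl.stepL k n i) :
    HWeyl.gen k n none * P ∈ HWeyl.stepL k n i := by
  induction hP using Submodule.span_induction with
  | zero => simp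
  | add y z _ _ hy hz => rw [mul_add]; exact Submodule.add_mem _ hy hz
  | smul a z _ hz => rw [mul_smul_comm]; exact Submodule.smul_mem _ _ hz
  | mem P hP =>
    obtain ⟨l, u, v, h, rfl⟩ := hP
    exact Submodule.subset_span ⟨l + 1, u, v, h, by rw [pow_succ']; simp only [mul_assoc]⟩

theorem HWeyl.gen_mul_mem (a : Fin n ⊕ Fin n) (i : ℤ) (P : HWeyl k n)
    (hP : P ∈ HWeyl.stepL k n i) :
    HWeyl.gen k n (some a) * P ∈ HWeyl.stepL k n (i + 1) := by
  induction hP using Submodule.span_induction with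
  | zero => simp
  | add y z _ _ hy hz => rw [mul_add]; exact Submodule.add_mem _ hy hz
  | smul a z _ hz => rw [mul_smul_comm]; exact Submodule.smul_mem _ _ hz
  | mem P hP =>
    obtain ⟨l, u, v, h, rfl⟩ := hP
    have hcomm : ∀ (b : Option (Fin n ⊕ Fin n)) (l : ℕ),
        HWeyl.gen k n b * HWeyl.gen k n none ^ l = HWeyl.gen k n none ^ l * HWeyl.gen k n b :=
      fun b l => (Commute.pow_left (show Commute _ _ from HWeyl.gen_h b) l).symm
    rw [← mul_assoc, hcomm, mul_assoc]
    have hpow : ∀ Q ∈ HWeyl.stepL k n (i + 1),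
        HWeyl.gen k n none ^ l * Q ∈ HWeyl.stepL k n (i + 1) := by
      intro Q hQ
      induction l with
      | zero => simpa using hQ
      | succ l ih => rw [pow_succ', mul_assoc]; exact HWeyl.h_mul_mem k n _ _ ih
    apply hpow
    cases a with
    | inl j =>
      refine Submodule.subset_span ⟨0, j :: u, v, by simp; omega, ?_⟩
      simp [mul_assoc]
    | inr j =>
      have := commutator_word k (fun j => HWeyl.gen k n (some (Sum.inl j)))
        (HWeyl.gen k n (some (Sum.inr j)))
        (fun i => if j = i then HWeyl.gen k n none ^ 2 else 0)
        (fun a b => by split_ifs <;> simp [hcomm])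
        (fun i => HWeyl.gen_dx j i) u
      rw [← mul_assoc, ← sub_add_cancel (HWeyl.gen k n (some (Sum.inr j)) * _)
        ((u.map fun j => HWeyl.gen k n (some (Sum.inl j))).prod *
          HWeyl.gen k n (some (Sum.inr j))), add_mul]
      refine Submodule.add_mem _ ?_ (Submodule.subset_span
        ⟨0, u, j :: v, by simp; omega, by simp [mul_assoc]⟩)
      generalize (_ - _ : HWeyl k n) = z at this ⊢
      induction this using Submodule.span_induction with
      | zero => simp
      | add y z _ _ hy hz => rw [add_mul]; exact Submodule.add_mem _ hy hz
      | smul a z _ hz => rw [smul_mul_assoc]; exact Submodule.smul_mem _ _ hz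
      | mem z hz =>
        obtain ⟨i', u', hu, rfl⟩ := hz
        split_ifs
        · exact Submodule.subset_span ⟨2, u', v, by omega, by simp [mul_assoc]⟩
        · simp

/-- The `(1,1)`-filtration of the Weyl algebra. -/
noncomputable def Weyl.filtr : Filtr k (Weyl.gen k n) (fun _ => 1) (Weyl k n) where
  step := Weyl.stepL k n
  mono := Weyl.stepL_mono k n
  smul_mem := Weyl.gen_mul_mem k n
  comm_mem a b i P hP := by
    have hP' : P ∈ Weyl.stepL k n (i + 1 + 1 - 1) := Weyl.stepL_mono k n (by omega) hP
    cases a <;> cases b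
    · simp [Weyl.gen_xx]
    · rw [Weyl.gen_dx]
      split_ifs
      · simpa using hP'
      · simp
    · rw [Weyl.gen_dx]
      split_ifs
      · simpa using hP'
      · simp
    · simp [Weyl.gen_dd]

theorem Weyl.single_mem {r : ℕ} (m : Fin r → ℤ) (l : Fin r) :
    Pi.single l 1 ∈ ((Weyl.filtr k n).free m).step (m l) := by
  intro l' _
  by_cases h : l' = l
  · subst h
    simp only [Pi.single_eq_same, sub_self]
    exact Submodule.subset_span ⟨[], [], by simp, by simp⟩
  · simp [Pi.single_eq_of_ne h]

/-- The weights of the generators of `D^(h)`: `h` has weight `0`, `x_i` and `∂_i` have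
weight `1`. -/
def HWeyl.wt (a : Option (Fin n ⊕ Fin n)) : ℤ := a.elim 0 fun _ => 1

/-- The `(1,1)`-filtration of the homogenized Weyl algebra. -/
noncomputable def HWeyl.filtr : Filtr k (HWeyl.gen k n) (HWeyl.wt n) (HWeyl k n) where
  step := HWeyl.stepL k n
  mono := HWeyl.stepL_mono k n
  smul_mem a i P hP := by
    cases a with
    | none => simpa [HWeyl.wt] using HWeyl.h_mul_mem k n i P hP
    | some a => exact HWeyl.gen_mul_mem k n a i P hP
  comm_mem a b i P hP := by
    cases a with
    | none => simp [HWeyl.gen_h]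
    | some a =>
      cases b with
      | none => simp [HWeyl.gen_h]
      | some b =>
        have h2 : HWeyl.gen k n none ^ 2 * P ∈ HWeyl.stepL k n (i + 1 + 1 - 1) := by
          rw [pow_two, mul_assoc]
          exact HWeyl.h_mul_mem k n _ _ (HWeyl.h_mul_mem k n _ _
            (HWeyl.stepL_mono k n (by omega) hP))
        cases a <;> cases b
        · simp [HWeyl.gen_xx]
        · rw [HWeyl.gen_dx]
          split_ifs
          · simpa [HWeyl.wt] using h2
          · simp
        · rw [HWeyl.gen_dx]
          split_ifs
          · simpa [HWeyl.wt] using h2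
          · simp
        · simp [HWeyl.gen_dd]

theorem HWeyl.single_mem {r : ℕ} (m : Fin r → ℤ) (l : Fin r) :
    Pi.single l 1 ∈ ((HWeyl.filtr k n).free m).step (m l) := by
  intro l' _
  by_cases h : l' = l
  · subst h
    simp only [Pi.single_eq_same, sub_self]
    exact Submodule.subset_span ⟨0, [], [], by simp, by simp⟩
  · simp [Pi.single_eq_of_ne h]

/-- The polynomial ring `S = gr D = k[x,∂]`. -/
abbrev S : Type u := MvPolynomial (Fin n ⊕ Fin n) k

/-- The polynomial ring `S[h] = gr D^(h) = k[h,x,∂]`. -/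
abbrev Sh : Type u := MvPolynomial (Option (Fin n ⊕ Fin n)) k

/-- `S[h]` as an `S`-algebra through the inclusion `k[x,∂] ⊆ k[h,x,∂]`. -/
noncomputable instance : Algebra (S k n) (Sh k n) :=
  (MvPolynomial.rename (R := k) (some : Fin n ⊕ Fin n → Option (Fin n ⊕ Fin n))).toRingHom.toAlgebra

end Weights

/-! ## Graded minimal free resolutions and graded Betti numbers -/

section Resolutions

variable {k : Type*} [Field k] {A : Type*} [Ring A] [Algebra k A]

/-- The grading of the shifted free module `A^r[m]`, whose `l`-th basis vector has degree `m_l`. -/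
def freeGrading (𝒜 : ℤ → Submodule k A) {r : ℕ} (m : Fin r → ℤ) (j : ℤ) :
    Submodule k (Fin r → A) :=
  Submodule.pi Set.univ fun l => 𝒜 (j - m l)

/-- The left ideal `A₊` generated by the homogeneous elements of positive degree. -/
def irrelevant (𝒜 : ℤ → Submodule k A) : Ideal A :=
  Ideal.span {a | ∃ d : ℤ, 0 < d ∧ a ∈ 𝒜 d}

/-- `⋯ → P₁ → P₀ → N → 0` is a graded minimal free resolution, over the graded algebra `(A, 𝒜)`, of
the graded left module `(N, 𝒩)`, where `P_i` (with grading `𝒢 i`) is free with a homogeneous basis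
of `r i` elements, of degrees `m i l`. -/
structure IsMinimalGradedFreeResolution (𝒜 : ℤ → Submodule k A)
    {N : Type*} [AddCommGroup N] [Module k N] [Module A N] (𝒩 : ℤ → Submodule k N)
    {P : ℕ → Type*} [∀ i, AddCommGroup (P i)] [∀ i, Module k (P i)] [∀ i, Module A (P i)]
    [∀ i, IsScalarTower k A (P i)] (𝒢 : ∀ i, ℤ → Submodule k (P i))
    (r : ℕ → ℕ) (m : ∀ i, Fin (r i) → ℤ)
    (ε : P 0 →ₗ[A] N) (d : ∀ i, P (i + 1) →ₗ[A] P i) : Prop where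
  /-- `P_i` is the direct sum of the `A b_l ≅ A[m_l]`, as a graded module. -/
  free : ∀ i, ∃ b : Module.Basis (Fin (r i)) A (P i), ∀ j,
    𝒢 i j = ⨆ l, (𝒜 (j - m i l)).map ((LinearMap.toSpanSingleton A (P i) (b l)).restrictScalars k)
  ε_homogeneous : ∀ j, ∀ p ∈ 𝒢 0 j, ε p ∈ 𝒩 j
  d_homogeneous : ∀ i j, ∀ p ∈ 𝒢 (i + 1) j, d i p ∈ 𝒢 i j
  surjective : Function.Surjective ε
  exact_zero : LinearMap.ker ε = LinearMap.range (d 0)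
  exact_succ : ∀ i, LinearMap.ker (d i) = LinearMap.range (d (i + 1))
  minimal : ∀ i, LinearMap.range (d i) ≤ irrelevant 𝒜 • (⊤ : Submodule A (P i))

/-- The table counting the generators by homological degree `i` and degree `j`. -/
def countTable (r : ℕ → ℕ) (m : ∀ i, Fin (r i) → ℤ) (i : ℕ) (j : ℤ) : ℕ :=
  (Finset.univ.filter fun l => m i l = j).card

/-- `β i j` are the graded Betti numbers of the graded module `(N, 𝒩)`: a graded minimal free
resolution by modules of finite rank exists, and in every such resolution the `i`-th term has exactly
`β i j` basis elements of degree `j`. -/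
def HasGradedBettiNumbers (𝒜 : ℤ → Submodule k A)
    {N : Type*} [AddCommGroup N] [Module k N] [Module A N] (𝒩 : ℤ → Submodule k N)
    (β : ℕ → ℤ → ℕ) : Prop :=
  (∃ (r : ℕ → ℕ) (m : ∀ i, Fin (r i) → ℤ) (ε : (Fin (r 0) → A) →ₗ[A] N)
    (d : ∀ i, (Fin (r (i + 1)) → A) →ₗ[A] (Fin (r i) → A)),
    IsMinimalGradedFreeResolution 𝒜 𝒩 (fun i => freeGrading 𝒜 (m i)) r m ε d) ∧
  ∀ (r : ℕ → ℕ) (m : ∀ i, Fin (r i) → ℤ) (ε : (Fin (r 0) → A) →ₗ[A] N)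
    (d : ∀ i, (Fin (r (i + 1)) → A) →ₗ[A] (Fin (r i) → A)),
    IsMinimalGradedFreeResolution 𝒜 𝒩 (fun i => freeGrading 𝒜 (m i)) r m ε d →
      countTable r m = β

end Resolutions

/-! ## Filtered free resolutions of `D`-modules and their homogenization -/

section FilteredResolutions

/-- A free resolution `F : ⋯ → D^{r₁} → D^{r₀} → M → 0` with shifts `m_i ∈ ℤ^{r_i}`, compatible with
the `(1,1)`-filtrations `L_j[m_i]D^{r_i}`, such that the induced complex `gr F` is a graded minimal
free resolution over `S` of `gr M`, where `M` is filtered by the images of `L_j[m₀]D^{r₀}`. -/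
structure FilteredFreeResolution (k : Type u) [Field k] (n : ℕ) (M : Type u) [AddCommGroup M]
    [Module k M] [Module (Weyl k n) M] [IsScalarTower k (Weyl k n) M] where
  /-- The ranks. -/
  r : ℕ → ℕ
  /-- The shifts. -/
  m : ∀ i, Fin (r i) → ℤ
  /-- The augmentation. -/
  ε : (Fin (r 0) → Weyl k n) →ₗ[Weyl k n] M
  /-- The differentials. -/
  φ : ∀ i, (Fin (r (i + 1)) → Weyl k n) →ₗ[Weyl k n] (Fin (r i) → Weyl k n)
  surjective : Function.Surjective ε
  exact_zero : LinearMap.ker ε = LinearMap.range (φ 0)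
  exact_succ : ∀ i, LinearMap.ker (φ i) = LinearMap.range (φ (i + 1))
  filtered : ∀ i j, ∀ P ∈ ((Weyl.filtr k n).free (m (i + 1))).step j,
    φ i P ∈ ((Weyl.filtr k n).free (m i)).step j
  gr_minimal : IsMinimalGradedFreeResolution (polyGrading k (Fin n ⊕ Fin n))
    (Gr.grading (((Weyl.filtr k n).free (m 0)).map ε))
    (fun i => Gr.grading ((Weyl.filtr k n).free (m i))) r m
    (Gr.map ((Weyl.filtr k n).free (m 0)) (((Weyl.filtr k n).free (m 0)).map ε) ε
      fun _ v hv => ⟨v, hv, rfl⟩)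
    (fun i => Gr.map ((Weyl.filtr k n).free (m (i + 1))) ((Weyl.filtr k n).free (m i)) (φ i)
      (filtered i))

namespace FilteredFreeResolution

variable {k : Type u} [Field k] {n : ℕ} {M : Type u} [AddCommGroup M]
  [Module k M] [Module (Weyl k n) M] [IsScalarTower k (Weyl k n) M]
  (F : FilteredFreeResolution k n M)

/-- The filtration `L_j[m_i]D^{r_i}`. -/
noncomputable abbrev freeFiltr (i : ℕ) :
    Filtr k (Weyl.gen k n) (fun _ => 1) (Fin (F.r i) → Weyl k n) :=
  (Weyl.filtr k n).free (F.m i)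

/-- The class in `gr D^{r_i}` of the `l`-th basis vector, of degree `m_{i,l}`. -/
noncomputable def e (i : ℕ) (l : Fin (F.r i)) : Gr (F.freeFiltr i) :=
  Gr.symb (F.freeFiltr i) (F.m i l) ⟨Pi.single l 1, Weyl.single_mem k n (F.m i) l⟩

/-- The filtration of `M` by the images of the `L_j[m₀]D^{r₀}`. -/
noncomputable abbrev filtrM : Filtr k (Weyl.gen k n) (fun _ => 1) M := (F.freeFiltr 0).map F.ε

/-- The map `gr D^{r₀} → gr M` of the complex `gr F`. -/
noncomputable abbrev grε : Gr (F.freeFiltr 0) →ₗ[S k n] Gr F.filtrM :=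
  Gr.map (F.freeFiltr 0) F.filtrM F.ε fun _ v hv => ⟨v, hv, rfl⟩

/-- The differentials of the complex `gr F`. -/
noncomputable abbrev grφ (i : ℕ) : Gr (F.freeFiltr (i + 1)) →ₗ[S k n] Gr (F.freeFiltr i) :=
  Gr.map (F.freeFiltr (i + 1)) (F.freeFiltr i) (F.φ i) (F.filtered i)

/-- The maps `ψ_i` between free `D^(h)`-modules are the homogenizations of the `φ_i`: the `(a,b)`
entry of the matrix of `ψ_i` is homogeneous of degree `m_{i+1,a} - m_{i,b}` and becomes the entry
of the matrix of `φ_i` for `h = 1`. -/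
def IsHomogenization
    (ψ : ∀ i, (Fin (F.r (i + 1)) → HWeyl k n) →ₗ[HWeyl k n] (Fin (F.r i) → HWeyl k n)) : Prop :=
  ∀ i a b, ψ i (Pi.single a 1) b ∈ HWeyl.grading k n (F.m (i + 1) a - F.m i b) ∧
    dehom k n (ψ i (Pi.single a 1) b) = F.φ i (Pi.single a 1) b

variable
  (ψ : ∀ i, (Fin (F.r (i + 1)) → HWeyl k n) →ₗ[HWeyl k n] (Fin (F.r i) → HWeyl k n))

/-- The homogenized module `M^(h)`, the cokernel of the first map of `F^(h)`. -/
noncomputable abbrev Mh : Type u := (Fin (F.r 0) → HWeyl k n) ⧸ LinearMap.range (ψ 0)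

/-- The augmentation of `F^(h)`. -/
noncomputable abbrev εh : (Fin (F.r 0) → HWeyl k n) →ₗ[HWeyl k n] F.Mh ψ := (LinearMap.range (ψ 0)).mkQ

/-- The grading of `(D^(h))^{r_i}[m_i]` by total degree. -/
noncomputable abbrev freeGradingh (i : ℕ) : ℤ → Submodule k (Fin (F.r i) → HWeyl k n) :=
  freeGrading (HWeyl.grading k n) (F.m i)

/-- The grading of `M^(h)`, as a quotient of `(D^(h))^{r₀}[m₀]`. -/
noncomputable def gradingMh (j : ℤ) : Submodule k (F.Mh ψ) :=
  (F.freeGradingh 0 j).map ((F.εh ψ).restrictScalars k)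

/-- The filtration `L_j[m_i](D^(h))^{r_i}`. -/
noncomputable abbrev freeFiltrh (i : ℕ) :
    Filtr k (HWeyl.gen k n) (HWeyl.wt n) (Fin (F.r i) → HWeyl k n) :=
  (HWeyl.filtr k n).free (F.m i)

/-- The class in `gr (D^(h))^{r_i}` of the `l`-th basis vector, of degree `m_{i,l}`. -/
noncomputable def eh (i : ℕ) (l : Fin (F.r i)) : Gr (F.freeFiltrh i) :=
  Gr.symb (F.freeFiltrh i) (F.m i l) ⟨Pi.single l 1, HWeyl.single_mem k n (F.m i) l⟩

/-- The filtration of `M^(h)` by the images of the `L_j[m₀](D^(h))^{r₀}`. -/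
noncomputable abbrev filtrMh : Filtr k (HWeyl.gen k n) (HWeyl.wt n) (F.Mh ψ) :=
  (F.freeFiltrh 0).map (F.εh ψ)

/-- The map `gr (D^(h))^{r₀} → gr M^(h)` of the complex `gr F^(h)`. -/
noncomputable abbrev grεh : Gr (F.freeFiltrh 0) →ₗ[Sh k n] Gr (F.filtrMh ψ) :=
  Gr.map (F.freeFiltrh 0) (F.filtrMh ψ) (F.εh ψ) fun _ v hv => ⟨v, hv, rfl⟩

/-- The grading of `gr M^(h)` by total degree. -/
noncomputable abbrev gradingGrMh : ℤ → Submodule k (Gr (F.filtrMh ψ)) :=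
  Gr.inducedGrading (F.filtrMh ψ) (F.gradingMh ψ)

/-- The grading of `gr (D^(h))^{r_i}` by total degree. -/
noncomputable abbrev gradingGrFreeh (i : ℕ) : ℤ → Submodule k (Gr (F.freeFiltrh i)) :=
  Gr.inducedGrading (F.freeFiltrh i) (F.freeGradingh i)

end FilteredFreeResolution

end FilteredResolutions

end GradedBetti

/-!
Write `D` for the Weyl algebra, `D^(h)` for its homogenization, `S = k[x, ∂]` and `S[h]`. The
theorem rests on two comparisons: of filtered with graded complexes, and of `D` with `D^(h)`.

**Normal ordering.** `D` and `D^(h)` act on polynomials in commuting variables `x`, `ξ` (and `h`),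
with `∂_i` acting by `ξ_i + c ∂/∂x_i`, where `c = 1` for `D` and `c = h²` for `D^(h)`. Applied to the
polynomial `1`, a normally ordered monomial gives the monomial with the same exponents. So the
normally ordered monomials form a basis, and the resulting full symbols (`Weyl.symbolMap`,
`HWeyl.symbolMap`) turn the filtrations and gradings into those by weight and by total degree. In
particular `gr` of a shifted free module is free on the classes of the basis vectors
(`SymbolMap.grBasis`).

**Strictness.** A filtered complex with exact associated graded complex is strictly exact when the
filtration is bounded below (`Gr.exists_eq_of_exact`), and conversely a strictly exact sequence has
an exact associated graded sequence (`Gr.ker_map_eq_range_map`). A resolution as required is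
constructed by lifting minimal homogeneous generators of `gr M`, then of `gr` of the kernel, and so
on (`exists_minimal_cover`, `Syzygy.exists_next`); `gr` of a kernel is finitely generated since `S`
is noetherian.

**Homogenization.** Setting `h = 1` maps the elements of `D^(h)` of degree `d` bijectively onto
`L_d D` (`exists_dehom_eq`, `dehom_injOn`), and its kernel is generated by `h - 1`
(`dehom_eq_zero_iff`). Hence the homogenization exists and is unique, `M^(h)` specializes to `M`,
and the exactness of `F^(h)` in degree `d` is the strict exactness of `F` in the `d`-th step. The
leading form of a homogeneous `P`, for the weight in which `h` has weight `0`, is free of `h` and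
equals the leading form of its dehomogenization (`leading_form_eq`). So the matrices of `gr F^(h)`
are those of `gr F`, which gives `gr F^(h) ≅ S[h] ⊗ gr F` on the free terms, and exactness at those
of positive index by flatness of `S[h]` over `S`. This exactness makes the first differential of
`F^(h)` strict, and so the augmented complex is exact as well. A nonzero constant in a matrix of
`F^(h)` or `gr F^(h)` would appear in `gr F`; this gives minimality.

**Betti numbers and projective dimensions.** All three resolutions have the same ranks and shifts.
Two minimal resolutions of a graded module are related by chain maps whose composites are homotopic
to the identity, hence are the identity modulo the irrelevant ideal
(`hasGradedBettiNumbers_of_resolution`). The projective dimension is less than `i` if and only if the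
`i`-th term of a minimal resolution vanishes
(`IsMinimalGradedFreeResolution.hasProjectiveDimensionLT_iff`).
-/

/-! ### Families of homogeneous components -/

namespace GradedBetti

section GradedSubmodules

variable {k : Type*} [Field k] {V W : Type*} [AddCommGroup V] [Module k V]
  [AddCommGroup W] [Module k W] {𝒱 : ℤ → Submodule k V} {𝒲 : ℤ → Submodule k W}

/-- A map that preserves degrees attains a homogeneous value on a graded subspace `U` at a
homogeneous element of `U`. -/
theorem exists_homogeneous_lift (h𝒲 : iSupIndep 𝒲) {U : Submodule k V}
    (hU : U ≤ ⨆ j, 𝒱 j ⊓ U) (f : V →ₗ[k] W) (hf : ∀ j, ∀ v ∈ 𝒱 j, f v ∈ 𝒲 j) {j : ℤ} {u : V}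
    (hu : u ∈ U) (hfu : f u ∈ 𝒲 j) : ∃ u' ∈ 𝒱 j ⊓ U, f u' = f u := by
  obtain ⟨g, hg, hgu⟩ := (Submodule.mem_iSup_iff_exists_finsupp _ _).1 (hU hu)
  refine ⟨g j, hg j, ?_⟩
  have key := (iSupIndep_iff_finsetSum_eq_imp_eq 𝒲).1 h𝒲 (insert j g.support)
    (fun i => f (g i)) (fun i => if i = j then f u else 0) ?_ ?_ j (by simp)
  · simpa using key
  · intro i _
    refine ⟨hf i _ (hg i).1, ?_⟩
    split_ifs with h
    · exact h ▸ hfu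
    · exact zero_mem _
  · rw [Finset.sum_ite_eq' (insert j g.support) j, if_pos (by simp), ← hgu, Finsupp.sum, map_sum]
    refine (Finset.sum_subset (Finset.subset_insert _ _) ?_).symm
    intro i _ hi
    simp [Finsupp.notMem_support_iff.1 hi]

/-- The kernel of a map that preserves degrees is a graded subspace. -/
theorem ker_le_iSup_inf (h𝒱 : ⨆ j, 𝒱 j = ⊤) (h𝒲 : iSupIndep 𝒲) (f : V →ₗ[k] W)
    (hf : ∀ j, ∀ v ∈ 𝒱 j, f v ∈ 𝒲 j) :
    LinearMap.ker f ≤ ⨆ j, 𝒱 j ⊓ LinearMap.ker f := by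
  intro u hu
  obtain ⟨g, hg, rfl⟩ := (Submodule.mem_iSup_iff_exists_finsupp _ u).1 (h𝒱 ▸ Submodule.mem_top)
  have key := (iSupIndep_iff_finsetSum_eq_zero_imp_eq_zero 𝒲).1 h𝒲 g.support
    (fun i => f (g i)) (fun i _ => hf i _ (hg i)) (by simpa [Finsupp.sum] using hu)
  exact Submodule.sum_mem _ fun i hi =>
    Submodule.mem_iSup_of_mem i ⟨hg i, key i hi⟩

/-- The range of a map that preserves degrees is a graded subspace. -/
theorem range_le_iSup_inf (h𝒱 : ⨆ j, 𝒱 j = ⊤) (f : V →ₗ[k] W)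
    (hf : ∀ j, ∀ v ∈ 𝒱 j, f v ∈ 𝒲 j) :
    LinearMap.range f ≤ ⨆ j, 𝒲 j ⊓ LinearMap.range f := by
  rintro _ ⟨u, rfl⟩
  obtain ⟨g, hg, rfl⟩ := (Submodule.mem_iSup_iff_exists_finsupp _ u).1 (h𝒱 ▸ Submodule.mem_top)
  rw [Finsupp.sum, map_sum]
  exact Submodule.sum_mem _ fun i _ =>
    Submodule.mem_iSup_of_mem i ⟨hf i _ (hg i), ⟨_, rfl⟩⟩

/-- The images of the homogeneous components are independent modulo a graded subspace. -/
theorem iSupIndep_map_of_ker_le (h𝒱 : iSupIndep 𝒱) (f : V →ₗ[k] W)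
    (hf : LinearMap.ker f ≤ ⨆ j, 𝒱 j ⊓ LinearMap.ker f) :
    iSupIndep fun j => (𝒱 j).map f := by
  classical
  rw [iSupIndep_iff_finsetSum_eq_zero_imp_eq_zero]
  intro s v hv hsum
  choose! u hu huv using hv
  have hker : ∑ i ∈ s, u i ∈ LinearMap.ker f := by
    rw [LinearMap.mem_ker, map_sum, ← hsum]
    exact Finset.sum_congr rfl huv
  obtain ⟨g, hg, hgu⟩ := (Submodule.mem_iSup_iff_exists_finsupp _ _).1 (hf hker)
  intro i hi
  have key := (iSupIndep_iff_finsetSum_eq_imp_eq 𝒱).1 h𝒱 (s ∪ g.support)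
    (fun i => g i) (fun i => if i ∈ s then u i else 0) ?_ ?_ i (by simp [hi])
  · simp only [hi, if_true] at key
    rw [← huv i hi, ← key]
    exact (hg i).2
  · intro i _
    refine ⟨(hg i).1, ?_⟩
    split_ifs with h
    · exact hu i h
    · exact zero_mem _
  · rw [← Finset.sum_filter, Finset.filter_mem_eq_inter,
      Finset.inter_eq_right.2 Finset.subset_union_left, ← hgu, Finsupp.sum]
    refine (Finset.sum_subset Finset.subset_union_right ?_).symm
    intro i _ hi
    simpa using hi

theorem iSupIndep_comap_of_injective (h𝒲 : iSupIndep 𝒲) (f : V →ₗ[k] W)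
    (hf : Function.Injective f) : iSupIndep fun j => (𝒲 j).comap f := by
  rw [iSupIndep_iff_finsetSum_eq_zero_imp_eq_zero] at h𝒲 ⊢
  intro s v hv hsum i hi
  exact hf ((h𝒲 s (fun i => f (v i)) hv (by rw [← map_sum, hsum, map_zero]) i hi).trans
    (map_zero f).symm)

end GradedSubmodules

section FreeGrading

variable {k : Type*} [Field k] {A : Type*} [Ring A] [Algebra k A] {𝒜 : ℤ → Submodule k A}

theorem freeGrading_iSupIndep (h𝒜 : iSupIndep 𝒜) {r : ℕ} (m : Fin r → ℤ) :
    iSupIndep (freeGrading 𝒜 m) := by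
  rw [iSupIndep_iff_finsetSum_eq_zero_imp_eq_zero]
  intro s v hv hsum i hi
  funext l
  have hl : iSupIndep fun j => 𝒜 (j - m l) := h𝒜.comp (sub_left_injective (b := m l))
  exact (iSupIndep_iff_finsetSum_eq_zero_imp_eq_zero _).1 hl s (fun i => v i l)
    (fun i hi => hv i hi l trivial) (by simpa using congrFun hsum l) i hi

/-- A product of graded subspaces is a graded subspace of the shifted free module. -/
theorem pi_le_iSup_freeGrading {r : ℕ} (m : Fin r → ℤ) (U : Fin r → Submodule k A)
    (hU : ∀ l, U l ≤ ⨆ j, 𝒜 j ⊓ U l) :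
    Submodule.pi Set.univ U ≤ ⨆ j, freeGrading 𝒜 m j ⊓ Submodule.pi Set.univ U := by
  intro u hu
  rw [← Finset.univ_sum_single u]
  refine Submodule.sum_mem _ fun l _ => ?_
  obtain ⟨g, hg, hgu⟩ := (Submodule.mem_iSup_iff_exists_finsupp _ _).1 (hU l (hu l trivial))
  rw [← hgu, Finsupp.sum, ← LinearMap.coe_single k, map_sum]
  refine Submodule.sum_mem _ fun j _ => Submodule.mem_iSup_of_mem (j + m l) ?_
  constructor
  · intro l' _
    by_cases h : l' = l
    · subst h
      simpa using (hg j).1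
    · simp [h]
  · intro l' _
    by_cases h : l' = l
    · subst h
      simpa using (hg j).2
    · simp [h]

theorem iSup_freeGrading (h𝒜 : ⨆ j, 𝒜 j = ⊤) {r : ℕ} (m : Fin r → ℤ) :
    ⨆ j, freeGrading 𝒜 m j = ⊤ := by
  have h := pi_le_iSup_freeGrading (𝒜 := 𝒜) m (fun _ => ⊤) (by simp [h𝒜])
  rw [eq_top_iff]
  simpa using h

/-- The graded free module with a homogeneous basis `b`, described through coordinates. -/
theorem iSup_map_toSpanSingleton_eq {P : Type*} [AddCommGroup P] [Module k P] [Module A P]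
    [IsScalarTower k A P] {r : ℕ} (m : Fin r → ℤ) (b : Module.Basis (Fin r) A P) (j : ℤ) :
    ⨆ l, (𝒜 (j - m l)).map ((LinearMap.toSpanSingleton A P (b l)).restrictScalars k) =
      (freeGrading 𝒜 m j).comap (b.equivFun.toLinearMap.restrictScalars k) := by
  apply le_antisymm
  · refine iSup_le fun l => ?_
    rintro _ ⟨a, ha, rfl⟩ l' _
    by_cases h : l = l'
    · subst h
      simpa using ha
    · simp [h]
  · intro z hz
    rw [← b.sum_equivFun z]
    exact Submodule.sum_mem _ fun l _ => Submodule.mem_iSup_of_mem l ⟨_, hz l trivial, by simp⟩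

theorem freeGrading_eq_iSup {r : ℕ} (m : Fin r → ℤ) (j : ℤ) :
    freeGrading 𝒜 m j = ⨆ l, (𝒜 (j - m l)).map
      ((LinearMap.toSpanSingleton A (Fin r → A) (Pi.basisFun A (Fin r) l)).restrictScalars k) := by
  rw [iSup_map_toSpanSingleton_eq]
  rfl

end FreeGrading

/-! ### Uniqueness of graded Betti numbers -/

section Betti

variable {k : Type*} [Field k] {A : Type*} [Ring A] [Algebra k A] {𝒜 : ℤ → Submodule k A}

theorem irrelevant_le_ker {aug : A →+* k} (haug : ∀ d ≠ 0, ∀ a ∈ 𝒜 d, aug a = 0) :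
    irrelevant 𝒜 ≤ RingHom.ker aug := by
  refine Ideal.span_le.2 ?_
  rintro a ⟨d, hd, ha⟩
  exact haug d hd.ne' a ha

theorem repr_mem_of_mem_smul_top {P : Type*} [AddCommGroup P] [Module A P] {r : ℕ}
    (b : Module.Basis (Fin r) A P) {aug : A →+* k} (haug : ∀ d ≠ 0, ∀ a ∈ 𝒜 d, aug a = 0)
    {z : P} (hz : z ∈ irrelevant 𝒜 • (⊤ : Submodule A P)) (l : Fin r) :
    aug (b.repr z l) = 0 := by
  refine Submodule.smul_induction_on hz (fun a ha n _ => ?_) fun x y hx hy => ?_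
  · have : aug a = 0 := irrelevant_le_ker haug ha
    simp [this]
  · simp [hx, hy]

theorem aug_apply_eq_zero_of_mem {aug : A →+* k} (haug : ∀ d ≠ 0, ∀ a ∈ 𝒜 d, aug a = 0) {r : ℕ}
    {z : Fin r → A} (hz : z ∈ irrelevant 𝒜 • (⊤ : Submodule A (Fin r → A))) (l : Fin r) :
    aug (z l) = 0 := by
  simpa using repr_mem_of_mem_smul_top (Pi.basisFun A (Fin r)) haug hz l

theorem mem_smul_top_of_repr_mem {P : Type*} [AddCommGroup P] [Module A P] {r : ℕ}
    (b : Module.Basis (Fin r) A P) {I : Ideal A} {z : P} (hz : ∀ l, b.repr z l ∈ I) :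
    z ∈ I • (⊤ : Submodule A P) := by
  rw [← b.sum_repr z]
  exact Submodule.sum_mem _ fun l _ => Submodule.smul_mem_smul (hz l) Submodule.mem_top

theorem map_apply_eq_sum {r r' : ℕ} (f : (Fin r → A) →ₗ[A] (Fin r' → A)) (z : Fin r → A)
    (l : Fin r') : f z l = ∑ a, z a * f (Pi.single a 1) l := by
  conv_lhs => rw [← Finset.univ_sum_single z]
  rw [map_sum, Finset.sum_apply]
  refine Finset.sum_congr rfl fun a _ => ?_
  have : (Pi.single a (z a) : Fin r → A) = z a • Pi.single a 1 := by simp [← Pi.single_smul]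
  rw [this, map_smul, Pi.smul_apply, smul_eq_mul]

omit [Algebra k A] in
theorem aug_map_apply_eq_zero {aug : A →+* k} {r r' : ℕ} (f : (Fin r → A) →ₗ[A] (Fin r' → A))
    {z : Fin r → A} (hz : ∀ a, aug (z a) = 0) (l : Fin r') : aug (f z l) = 0 := by
  rw [map_apply_eq_sum f, map_sum]
  exact Finset.sum_eq_zero fun a _ => by rw [map_mul, hz, zero_mul]

/-- Lifting from a free module through a surjection onto the values. -/
theorem exists_comp_eq {X P Q : Type*} [AddCommGroup X] [Module A X] [AddCommGroup P] [Module A P]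
    [Module.Projective A X] [AddCommGroup Q] [Module A Q] (d : P →ₗ[A] Q) (f : X →ₗ[A] Q)
    (hf : LinearMap.range f ≤ LinearMap.range d) : ∃ h : X →ₗ[A] P, d ∘ₗ h = f := by
  obtain ⟨h, hh⟩ := Module.projective_lifting_property d.rangeRestrict
    (f.codRestrict (LinearMap.range d) fun x => hf ⟨x, rfl⟩) d.surjective_rangeRestrict
  refine ⟨h, LinearMap.ext fun x => ?_⟩
  exact congrArg Subtype.val (LinearMap.congr_fun hh x)

/-- A chain endomorphism of a minimal resolution which lifts zero is null homotopic, and therefore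
vanishes modulo `A₊`. -/
theorem aug_eq_zero_of_lifts_zero {aug : A →+* k} (haug : ∀ d ≠ 0, ∀ a ∈ 𝒜 d, aug a = 0)
    {N : Type*} [AddCommGroup N] [Module A N] {r : ℕ → ℕ} {ε : (Fin (r 0) → A) →ₗ[A] N}
    {d : ∀ i, (Fin (r (i + 1)) → A) →ₗ[A] (Fin (r i) → A)}
    (exact_zero : LinearMap.ker ε = LinearMap.range (d 0))
    (exact_succ : ∀ i, LinearMap.ker (d i) = LinearMap.range (d (i + 1)))
    (minimal : ∀ i, LinearMap.range (d i) ≤ irrelevant 𝒜 • (⊤ : Submodule A (Fin (r i) → A)))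
    (φ : ∀ i, (Fin (r i) → A) →ₗ[A] (Fin (r i) → A)) (hε : ε ∘ₗ φ 0 = 0)
    (hd : ∀ i, d i ∘ₗ φ (i + 1) = φ i ∘ₗ d i) (i : ℕ) (z : Fin (r i) → A) (l : Fin (r i)) :
    aug (φ i z l) = 0 := by
  have h0 : ∃ h : (Fin (r 0) → A) →ₗ[A] (Fin (r 1) → A), d 0 ∘ₗ h = φ 0 := by
    refine exists_comp_eq _ _ ?_
    rw [← exact_zero]
    rintro _ ⟨x, rfl⟩
    exact LinearMap.congr_fun hε x
  have step : ∀ i (h : (Fin (r i) → A) →ₗ[A] (Fin (r (i + 1)) → A)),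
      d i ∘ₗ h ∘ₗ d i = φ i ∘ₗ d i →
      ∃ h' : (Fin (r (i + 1)) → A) →ₗ[A] (Fin (r (i + 2)) → A),
        d (i + 1) ∘ₗ h' = φ (i + 1) - h ∘ₗ d i := by
    intro i h hh
    refine exists_comp_eq _ _ ?_
    rw [← exact_succ]
    rintro _ ⟨x, rfl⟩
    have h1 := LinearMap.congr_fun hh x
    have h2 := LinearMap.congr_fun (hd i) x
    simp only [LinearMap.comp_apply] at h1 h2
    simp [h1, h2]
  have dd : ∀ i, d i ∘ₗ d (i + 1) = 0 := fun i => LinearMap.ext fun x => by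
    have : d (i + 1) x ∈ LinearMap.ker (d i) := exact_succ i ▸ ⟨x, rfl⟩
    exact this
  -- Only the consequence `d h d = φ d` of the homotopy relation is needed to continue.
  have all : ∀ i, ∃ h : (Fin (r i) → A) →ₗ[A] (Fin (r (i + 1)) → A),
      d i ∘ₗ h ∘ₗ d i = φ i ∘ₗ d i := by
    intro i
    induction i with
    | zero =>
      obtain ⟨h, hh⟩ := h0
      exact ⟨h, by rw [← LinearMap.comp_assoc, hh]⟩
    | succ i ih =>
      obtain ⟨h, hh⟩ := ih
      obtain ⟨h', hh'⟩ := step i h hh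
      refine ⟨h', ?_⟩
      rw [← LinearMap.comp_assoc, hh', LinearMap.sub_comp, LinearMap.comp_assoc, dd]
      simp
  have hdaug : ∀ i z l, aug (d i z l) = 0 := fun i z l =>
    aug_apply_eq_zero_of_mem haug (minimal i ⟨z, rfl⟩) l
  cases i with
  | zero =>
    obtain ⟨h, hh⟩ := h0
    rw [← hh]
    exact hdaug 0 _ l
  | succ i =>
    -- `φ (i + 1) = d h' + h d`, and both summands vanish modulo `A₊`.
    obtain ⟨h, hh⟩ := all i
    obtain ⟨h', hh'⟩ := step i h hh
    have := congrFun (LinearMap.congr_fun hh' z) l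
    simp only [LinearMap.comp_apply, LinearMap.sub_apply, Pi.sub_apply] at this
    rw [eq_sub_iff_add_eq] at this
    rw [← this, map_add, hdaug, aug_map_apply_eq_zero h (hdaug i z), add_zero]

/-- A map of degree `0` out of a graded free module lifts, with degree `0`, through every map of
degree `0` whose range contains the values. -/
theorem exists_graded_lift (h𝒜' : ⨆ j, 𝒜 j = ⊤) {s s' : ℕ} {m : Fin s → ℤ} {m' : Fin s' → ℤ}
    {X : Type*} [AddCommGroup X] [Module k X] [Module A X] [IsScalarTower k A X]
    {𝒳 : ℤ → Submodule k X} (h𝒳 : iSupIndep 𝒳)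
    (g : (Fin s' → A) →ₗ[A] X) (f : (Fin s → A) →ₗ[A] X)
    (hg : ∀ j, ∀ p ∈ freeGrading 𝒜 m' j, g p ∈ 𝒳 j) (hf : ∀ a, f (Pi.single a 1) ∈ 𝒳 (m a))
    (hgf : ∀ x, ∃ y, g y = f x) : ∃ h : (Fin s → A) →ₗ[A] (Fin s' → A), g ∘ₗ h = f ∧
      ∀ a, h (Pi.single a 1) ∈ freeGrading 𝒜 m' (m a) := by
  have : ∀ a, ∃ y ∈ freeGrading 𝒜 m' (m a), g y = f (Pi.single a 1) := by
    intro a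
    obtain ⟨y, hy⟩ := hgf (Pi.single a 1)
    obtain ⟨y', hy', e⟩ := exists_homogeneous_lift (𝒱 := freeGrading 𝒜 m') h𝒳 (U := ⊤)
      (by simp [iSup_freeGrading h𝒜']) (g.restrictScalars k) hg (u := y) (j := m a) trivial
      (by simpa [hy] using hf a)
    exact ⟨y', hy'.1, e.trans hy⟩
  choose y hy e using this
  refine ⟨(Pi.basisFun A (Fin s)).constr ℕ y, (Pi.basisFun A (Fin s)).ext fun a => ?_,
    fun a => ?_⟩
  · rw [LinearMap.comp_apply, Module.Basis.constr_basis, e, Pi.basisFun_apply]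
  · rw [← Pi.basisFun_apply, Module.Basis.constr_basis]
    exact hy a

/-- Two graded resolutions of the same module are related by a chain map of degree `0`. -/
theorem exists_chain_map (h𝒜 : iSupIndep 𝒜) (h𝒜' : ⨆ j, 𝒜 j = ⊤)
    {N : Type*} [AddCommGroup N] [Module k N] [Module A N] [IsScalarTower k A N]
    {𝒩 : ℤ → Submodule k N} (h𝒩 : iSupIndep 𝒩)
    {r r' : ℕ → ℕ} {m : ∀ i, Fin (r i) → ℤ} {m' : ∀ i, Fin (r' i) → ℤ}
    {ε : (Fin (r 0) → A) →ₗ[A] N} {ε' : (Fin (r' 0) → A) →ₗ[A] N}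
    {d : ∀ i, (Fin (r (i + 1)) → A) →ₗ[A] (Fin (r i) → A)}
    {d' : ∀ i, (Fin (r' (i + 1)) → A) →ₗ[A] (Fin (r' i) → A)}
    (H : IsMinimalGradedFreeResolution 𝒜 𝒩 (fun i => freeGrading 𝒜 (m i)) r m ε d)
    (H' : IsMinimalGradedFreeResolution 𝒜 𝒩 (fun i => freeGrading 𝒜 (m' i)) r' m' ε' d')
    (one_mem : (1 : A) ∈ 𝒜 0) (mul_mem : ∀ i j, ∀ a ∈ 𝒜 i, ∀ b ∈ 𝒜 j, a * b ∈ 𝒜 (i + j)) :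
    ∃ f : ∀ i, (Fin (r i) → A) →ₗ[A] (Fin (r' i) → A), ε' ∘ₗ f 0 = ε ∧
      (∀ i, d' i ∘ₗ f (i + 1) = f i ∘ₗ d i) ∧
      ∀ i a, f i (Pi.single a 1) ∈ freeGrading 𝒜 (m' i) (m i a) := by
  have single_mem : ∀ i a, Pi.single a 1 ∈ freeGrading 𝒜 (m i) (m i a) := by
    intro i a l _
    by_cases h : l = a
    · subst h
      simpa using one_mem
    · simp [h]
  have graded : ∀ i (f : (Fin (r i) → A) →ₗ[A] (Fin (r' i) → A)),
      (∀ a, f (Pi.single a 1) ∈ freeGrading 𝒜 (m' i) (m i a)) →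
      ∀ j, ∀ p ∈ freeGrading 𝒜 (m i) j, f p ∈ freeGrading 𝒜 (m' i) j := by
    intro i f hf j p hp l _
    rw [map_apply_eq_sum]
    refine Submodule.sum_mem _ fun a _ => ?_
    have := mul_mem _ _ _ (hp a trivial) _ (hf a l trivial)
    rwa [sub_add_sub_cancel] at this
  obtain ⟨f0, hf0, hf0'⟩ := exists_graded_lift h𝒜' h𝒩 ε' ε H'.ε_homogeneous
    (fun a => H.ε_homogeneous _ _ (single_mem 0 a)) fun x => H'.surjective _
  let p : ∀ i, ((Fin (r i) → A) →ₗ[A] (Fin (r' i) → A)) → Prop := fun i f =>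
    (∀ a, f (Pi.single a 1) ∈ freeGrading 𝒜 (m' i) (m i a)) ∧ ∀ x, ∃ y, d' i y = f (d i x)
  have hp0 : p 0 f0 := by
    refine ⟨hf0', fun x => ?_⟩
    have : f0 (d 0 x) ∈ LinearMap.ker ε' := by
      have h1 : d 0 x ∈ LinearMap.ker ε := H.exact_zero ▸ ⟨x, rfl⟩
      rw [LinearMap.mem_ker, ← LinearMap.comp_apply, hf0]
      exact h1
    rwa [H'.exact_zero] at this
  have next : ∀ i (f : {f // p i f}), ∃ f' : {f' // p (i + 1) f'},
      d' i ∘ₗ f'.1 = f.1 ∘ₗ d i := by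
    rintro i ⟨f, hf, hf'⟩
    obtain ⟨f', h1, h2⟩ := exists_graded_lift h𝒜' (freeGrading_iSupIndep h𝒜 (m' i)) (d' i)
      (f ∘ₗ d i) (H'.d_homogeneous i)
      (fun a => graded i f hf _ _ (H.d_homogeneous i _ _ (single_mem (i + 1) a))) hf'
    refine ⟨⟨f', h2, fun x => ?_⟩, h1⟩
    have : f' (d (i + 1) x) ∈ LinearMap.ker (d' i) := by
      have h3 : d (i + 1) x ∈ LinearMap.ker (d i) := H.exact_succ i ▸ ⟨x, rfl⟩
      rw [LinearMap.mem_ker] at h3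
      rw [LinearMap.mem_ker, ← LinearMap.comp_apply, h1, LinearMap.comp_apply, h3, map_zero]
    rwa [H'.exact_succ] at this
  choose nx hnx using next
  let F : ∀ i, {f // p i f} := fun i => Nat.rec ⟨f0, hp0⟩ nx i
  exact ⟨fun i => (F i).1, hf0, fun i => hnx i (F i), fun i a => (F i).2.1 a⟩

/-- Graded matrices that are inverse to each other have as many rows as columns in each degree. -/
theorem card_filter_eq_of_mul_eq_one {s t : ℕ} {m : Fin s → ℤ} {m' : Fin t → ℤ}
    (F : Matrix (Fin s) (Fin t) k) (G : Matrix (Fin t) (Fin s) k) (hFG : F * G = 1)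
    (hGF : G * F = 1) (hF : ∀ a b, m a ≠ m' b → F a b = 0) (hG : ∀ a b, m' a ≠ m b → G a b = 0)
    (j : ℤ) : (Finset.univ.filter fun l => m l = j).card =
      (Finset.univ.filter fun l => m' l = j).card := by
  have block : ∀ {s t : ℕ} {m : Fin s → ℤ} {m' : Fin t → ℤ}
      (F : Matrix (Fin s) (Fin t) k) (G : Matrix (Fin t) (Fin s) k), F * G = 1 →
      (∀ a b, m a ≠ m' b → F a b = 0) →
      (F.submatrix (fun a : {a // m a = j} => a.1) fun b : {b // m' b = j} => b.1) *
        (G.submatrix (fun a : {a // m' a = j} => a.1) fun b : {b // m b = j} => b.1) = 1 := by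
    intro s t m m' F G hFG hF
    ext ⟨a, ha⟩ ⟨c, hc⟩
    have := congrFun (congrFun hFG a) c
    rw [Matrix.mul_apply, Matrix.one_apply] at this
    simp only [Matrix.mul_apply, Matrix.one_apply, Matrix.submatrix_apply, Subtype.mk.injEq]
    rw [← this, ← Finset.sum_subtype (Finset.univ.filter fun b => m' b = j) (by simp)
      (fun b => F a b * G b c), Finset.sum_filter]
    refine Finset.sum_congr rfl fun b _ => ?_
    split_ifs with h
    · rfl
    · rw [hF a b fun e => h (e.symm.trans ha), zero_mul]
  rw [← Fintype.card_subtype, ← Fintype.card_subtype]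
  exact Matrix.square_of_invertible _ _ (block F G hFG hF) (block G F hGF hG)

/-- The entries of a map of degree `0` between graded free modules vanish modulo `A₊`, except
between generators of the same degree. -/
theorem aug_entry_eq_zero {aug : A →+* k} (haug : ∀ d ≠ 0, ∀ a ∈ 𝒜 d, aug a = 0) {s t : ℕ}
    {m : Fin s → ℤ} {m' : Fin t → ℤ} (f : (Fin s → A) →ₗ[A] (Fin t → A))
    (hf : ∀ a, f (Pi.single a 1) ∈ freeGrading 𝒜 m' (m a)) (a : Fin s) (b : Fin t)
    (h : m a ≠ m' b) : aug (f (Pi.single a 1) b) = 0 :=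
  haug _ (sub_ne_zero.2 h) _ (hf a b trivial)

/-- Two graded minimal free resolutions of a module have the same numbers of generators in each
degree. -/
theorem countTable_eq (h𝒜 : iSupIndep 𝒜) (h𝒜' : ⨆ j, 𝒜 j = ⊤) (one_mem : (1 : A) ∈ 𝒜 0)
    (mul_mem : ∀ i j, ∀ a ∈ 𝒜 i, ∀ b ∈ 𝒜 j, a * b ∈ 𝒜 (i + j))
    {aug : A →+* k} (haug : ∀ d ≠ 0, ∀ a ∈ 𝒜 d, aug a = 0)
    {N : Type*} [AddCommGroup N] [Module k N] [Module A N] [IsScalarTower k A N]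
    {𝒩 : ℤ → Submodule k N} (h𝒩 : iSupIndep 𝒩)
    {r r' : ℕ → ℕ} {m : ∀ i, Fin (r i) → ℤ} {m' : ∀ i, Fin (r' i) → ℤ}
    {ε : (Fin (r 0) → A) →ₗ[A] N} {ε' : (Fin (r' 0) → A) →ₗ[A] N}
    {d : ∀ i, (Fin (r (i + 1)) → A) →ₗ[A] (Fin (r i) → A)}
    {d' : ∀ i, (Fin (r' (i + 1)) → A) →ₗ[A] (Fin (r' i) → A)}
    (H : IsMinimalGradedFreeResolution 𝒜 𝒩 (fun i => freeGrading 𝒜 (m i)) r m ε d)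
    (H' : IsMinimalGradedFreeResolution 𝒜 𝒩 (fun i => freeGrading 𝒜 (m' i)) r' m' ε' d') :
    countTable r m = countTable r' m' := by
  obtain ⟨f, hf0, hf, hfm⟩ := exists_chain_map h𝒜 h𝒜' h𝒩 H H' one_mem mul_mem
  obtain ⟨g, hg0, hg, hgm⟩ := exists_chain_map h𝒜 h𝒜' h𝒩 H' H one_mem mul_mem
  -- Modulo `A₊` the matrices of `f i` and `g i` are inverse to each other.
  have mul_one : ∀ {s t : ℕ} (f : (Fin s → A) →ₗ[A] (Fin t → A))
      (g : (Fin t → A) →ₗ[A] (Fin s → A)),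
      (∀ z l, aug ((g ∘ₗ f - LinearMap.id : (Fin s → A) →ₗ[A] (Fin s → A)) z l) = 0) →
      (Matrix.of fun a b => aug (f (Pi.single a 1) b)) *
        (Matrix.of fun a b => aug (g (Pi.single a 1) b)) = 1 := by
    intro s t f g h
    ext a c
    have := h (Pi.single a 1) c
    rw [LinearMap.sub_apply, Pi.sub_apply, map_sub, sub_eq_zero, LinearMap.comp_apply,
      map_apply_eq_sum g, map_sum] at this
    rw [Matrix.mul_apply, Matrix.one_apply]
    simp only [map_mul] at this
    refine this.trans ?_
    by_cases hac : a = c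
    · subst hac; simp
    · simp [hac]
  have hFG := aug_eq_zero_of_lifts_zero haug H.exact_zero H.exact_succ H.minimal
    (fun i => g i ∘ₗ f i - LinearMap.id)
    (by rw [LinearMap.comp_sub, ← LinearMap.comp_assoc, hg0, hf0]; simp)
    (fun i => by rw [LinearMap.comp_sub, ← LinearMap.comp_assoc, hg, LinearMap.comp_assoc, hf]
                 rfl)
  have hGF := aug_eq_zero_of_lifts_zero haug H'.exact_zero H'.exact_succ H'.minimal
    (fun i => f i ∘ₗ g i - LinearMap.id)
    (by rw [LinearMap.comp_sub, ← LinearMap.comp_assoc, hf0, hg0]; simp)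
    (fun i => by rw [LinearMap.comp_sub, ← LinearMap.comp_assoc, hf, LinearMap.comp_assoc, hg]
                 rfl)
  funext i j
  exact card_filter_eq_of_mul_eq_one _ _ (mul_one (f i) (g i) (hFG i)) (mul_one (g i) (f i) (hGF i))
    (aug_entry_eq_zero haug (f i) (hfm i)) (aug_entry_eq_zero haug (g i) (hgm i)) j

/-- Homogeneous bases identify a graded minimal free resolution with one by the standard graded
free modules. -/
theorem IsMinimalGradedFreeResolution.exists_pi {N : Type*} [AddCommGroup N] [Module k N]
    [Module A N] {𝒩 : ℤ → Submodule k N} {P : ℕ → Type*} [∀ i, AddCommGroup (P i)]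
    [∀ i, Module k (P i)] [∀ i, Module A (P i)] [∀ i, IsScalarTower k A (P i)]
    {𝒢 : ∀ i, ℤ → Submodule k (P i)} {r : ℕ → ℕ} {m : ∀ i, Fin (r i) → ℤ}
    {ε : P 0 →ₗ[A] N} {d : ∀ i, P (i + 1) →ₗ[A] P i}
    (H : IsMinimalGradedFreeResolution 𝒜 𝒩 𝒢 r m ε d) :
    ∃ (ε' : (Fin (r 0) → A) →ₗ[A] N) (d' : ∀ i, (Fin (r (i + 1)) → A) →ₗ[A] (Fin (r i) → A)),
      IsMinimalGradedFreeResolution 𝒜 𝒩 (fun i => freeGrading 𝒜 (m i)) r m ε' d' := by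
  choose b hb using H.free
  have hb' : ∀ i j p, p ∈ freeGrading 𝒜 (m i) j → (b i).equivFun.symm p ∈ 𝒢 i j := by
    intro i j p hp
    rw [hb, iSup_map_toSpanSingleton_eq]
    rw [Submodule.mem_comap, LinearMap.restrictScalars_apply, LinearEquiv.coe_coe,
      LinearEquiv.apply_symm_apply]
    exact hp
  have hb'' : ∀ i j p, p ∈ 𝒢 i j → (b i).equivFun p ∈ freeGrading 𝒜 (m i) j := by
    intro i j p hp
    rw [hb, iSup_map_toSpanSingleton_eq] at hp
    exact hp
  refine ⟨ε ∘ₗ (b 0).equivFun.symm.toLinearMap, fun i =>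
    (b i).equivFun.toLinearMap ∘ₗ d i ∘ₗ (b (i + 1)).equivFun.symm.toLinearMap, ?_⟩
  constructor
  · exact fun i => ⟨Pi.basisFun A _, freeGrading_eq_iSup (m i)⟩
  · exact fun j p hp => H.ε_homogeneous j _ (hb' 0 j p hp)
  · exact fun i j p hp => hb'' i j _ (H.d_homogeneous i j _ (hb' (i + 1) j p hp))
  · exact H.surjective.comp (b 0).equivFun.symm.surjective
  · rw [LinearMap.ker_comp, H.exact_zero, LinearMap.range_comp, LinearMap.range_comp,
      LinearEquiv.range, Submodule.map_top]
    exact (Submodule.map_equiv_eq_comap_symm _ _).symm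
  · intro i
    rw [LinearMap.ker_comp, LinearEquiv.ker, Submodule.comap_bot, LinearMap.ker_comp,
      LinearMap.range_comp, LinearMap.range_comp, LinearEquiv.range, Submodule.map_top,
      H.exact_succ]
    exact (Submodule.map_equiv_eq_comap_symm _ _).symm
  · rintro i _ ⟨z, rfl⟩
    refine Submodule.smul_induction_on (p := fun z => (b i).equivFun z ∈ irrelevant 𝒜 • ⊤)
      (H.minimal i ⟨(b (i + 1)).equivFun.symm z, rfl⟩) (fun a ha x _ => ?_) fun x y hx hy => ?_
    · rw [map_smul]
      exact Submodule.smul_mem_smul ha trivial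
    · rw [map_add]
      exact add_mem hx hy

/-- The graded Betti numbers of a module over a graded algebra with an augmentation can be read off
any graded minimal free resolution. -/
theorem hasGradedBettiNumbers_of_resolution (h𝒜 : iSupIndep 𝒜) (h𝒜' : ⨆ j, 𝒜 j = ⊤)
    (one_mem : (1 : A) ∈ 𝒜 0) (mul_mem : ∀ i j, ∀ a ∈ 𝒜 i, ∀ b ∈ 𝒜 j, a * b ∈ 𝒜 (i + j))
    {aug : A →+* k} (haug : ∀ d ≠ 0, ∀ a ∈ 𝒜 d, aug a = 0)
    {N : Type*} [AddCommGroup N] [Module k N] [Module A N] [IsScalarTower k A N]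
    {𝒩 : ℤ → Submodule k N} (h𝒩 : iSupIndep 𝒩) {P : ℕ → Type*} [∀ i, AddCommGroup (P i)]
    [∀ i, Module k (P i)] [∀ i, Module A (P i)] [∀ i, IsScalarTower k A (P i)]
    {𝒢 : ∀ i, ℤ → Submodule k (P i)} {r : ℕ → ℕ} {m : ∀ i, Fin (r i) → ℤ}
    {ε : P 0 →ₗ[A] N} {d : ∀ i, P (i + 1) →ₗ[A] P i}
    (H : IsMinimalGradedFreeResolution 𝒜 𝒩 𝒢 r m ε d) :
    HasGradedBettiNumbers 𝒜 𝒩 (countTable r m) := by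
  obtain ⟨ε', d', H'⟩ := H.exists_pi
  exact ⟨⟨r, m, ε', d', H'⟩, fun r'' m'' ε'' d'' H'' =>
    countTable_eq h𝒜 h𝒜' one_mem mul_mem haug h𝒩 H'' H'⟩

end Betti

end GradedBetti

/-! ### Projective dimension and minimal resolutions -/

namespace GradedBetti

section ProjectiveDimension

open CategoryTheory

universe v w

variable {A : Type v} [Ring A]

theorem hasProjectiveDimensionLT_succ_of_ker {P N : Type w} [AddCommGroup P] [Module A P]
    [Module.Projective A P] [AddCommGroup N] [Module A N] {ε : P →ₗ[A] N}
    (hε : Function.Surjective ε) (n : ℕ)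
    (h : HasProjectiveDimensionLT (ModuleCat.of A (LinearMap.ker ε)) n) [Small.{w} A] :
    HasProjectiveDimensionLT (ModuleCat.of A N) (n + 1) := by
  have : Projective (ModuleCat.of A P) := (IsProjective.iff_projective _).1 ‹_›
  exact (LinearMap.shortExact_shortComplexKer hε).hasProjectiveDimensionLT_X₃ n h
    (hasProjectiveDimensionLT_of_ge (ModuleCat.of A P) 1 (n + 1) (by omega))

theorem hasProjectiveDimensionLT_ker {P N : Type w} [AddCommGroup P] [Module A P]
    [Module.Projective A P] [AddCommGroup N] [Module A N] {ε : P →ₗ[A] N}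
    (hε : Function.Surjective ε) (n : ℕ) [Small.{w} A]
    (h : HasProjectiveDimensionLT (ModuleCat.of A N) (n + 2)) :
    HasProjectiveDimensionLT (ModuleCat.of A (LinearMap.ker ε)) (n + 1) := by
  have : Projective (ModuleCat.of A P) := (IsProjective.iff_projective _).1 ‹_›
  exact (LinearMap.shortExact_shortComplexKer hε).hasProjectiveDimensionLT_X₁ (n + 1)
    (hasProjectiveDimensionLT_of_ge (ModuleCat.of A P) 1 (n + 1) (by omega)) h

/-- The first differential, with values in the kernel of the augmentation, is the augmentation of the
resolution obtained by removing the term `P`. -/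
theorem codRestrict_surjective {P Q N : Type*} [AddCommGroup P] [Module A P]
    [AddCommGroup Q] [Module A Q] [AddCommGroup N] [Module A N] {ε : P →ₗ[A] N} {d : Q →ₗ[A] P}
    (h : LinearMap.ker ε = LinearMap.range d) :
    Function.Surjective (d.codRestrict (LinearMap.ker ε) fun x => h ▸ ⟨x, rfl⟩) := by
  rintro ⟨y, hy⟩
  rw [h] at hy
  obtain ⟨x, rfl⟩ := hy
  exact ⟨x, rfl⟩

theorem hasProjectiveDimensionLT_of_subsingleton [Small.{w} A] (n : ℕ) :
    ∀ {N : Type w} [AddCommGroup N] [Module A N] {P : ℕ → Type w} [∀ i, AddCommGroup (P i)]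
    [∀ i, Module A (P i)] [∀ i, Module.Projective A (P i)] (ε : P 0 →ₗ[A] N)
    (d : ∀ i, P (i + 1) →ₗ[A] P i) (_ : Function.Surjective ε)
    (_ : LinearMap.ker ε = LinearMap.range (d 0))
    (_ : ∀ i, LinearMap.ker (d i) = LinearMap.range (d (i + 1))) (_ : Subsingleton (P n)),
    HasProjectiveDimensionLT (ModuleCat.of A N) n := by
  induction n with
  | zero =>
    intro N _ _ P _ _ _ ε d hε h0 hs hn
    have : Subsingleton N := hε.subsingleton
    exact (ModuleCat.isZero_of_subsingleton (ModuleCat.of A N)).hasProjectiveDimensionLT_zero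
  | succ n ih =>
    intro N _ _ P _ _ _ ε d hε h0 hs hn
    refine hasProjectiveDimensionLT_succ_of_ker hε n ?_
    exact ih (P := fun i => P (i + 1)) _ (fun i => d (i + 1)) (codRestrict_surjective h0)
      (by rw [LinearMap.ker_codRestrict, hs]) (fun i => hs (i + 1)) hn

/-- If the projective dimension is at most `n`, then the module of `n`-th syzygies is projective, and
therefore the range of `d n` is a direct summand of `P n`. This is stated as the existence of a
generalized inverse of `d n`. -/
theorem exists_comp_comp_eq_of_hasProjectiveDimensionLT [Small.{w} A] (n : ℕ) :
    ∀ {N : Type w} [AddCommGroup N] [Module A N] {P : ℕ → Type w} [∀ i, AddCommGroup (P i)]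
    [∀ i, Module A (P i)] [∀ i, Module.Projective A (P i)] (ε : P 0 →ₗ[A] N)
    (d : ∀ i, P (i + 1) →ₗ[A] P i) (_ : Function.Surjective ε)
    (_ : LinearMap.ker ε = LinearMap.range (d 0))
    (_ : ∀ i, LinearMap.ker (d i) = LinearMap.range (d (i + 1)))
    (_ : HasProjectiveDimensionLT (ModuleCat.of A N) (n + 1)),
    ∃ t : P n →ₗ[A] P (n + 1), d n ∘ₗ t ∘ₗ d n = d n := by
  induction n with
  | zero =>
    intro N _ _ P _ _ _ ε d hε h0 hs hn
    have hN : Projective (ModuleCat.of A N) := projective_iff_hasProjectiveDimensionLT_one.2 hn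
    have : Module.Projective A N := (IsProjective.iff_projective _).2 hN
    obtain ⟨s, hs⟩ := Module.projective_lifting_property ε LinearMap.id hε
    obtain ⟨t, ht⟩ := exists_comp_eq (d 0) (LinearMap.id - s ∘ₗ ε) (by
      rw [← h0]
      rintro _ ⟨x, rfl⟩
      have := LinearMap.congr_fun hs (ε x)
      simp only [LinearMap.comp_apply, LinearMap.id_apply] at this
      simp [this])
    refine ⟨t, ?_⟩
    have hd : ε ∘ₗ d 0 = 0 := LinearMap.range_le_ker_iff.1 h0.ge
    rw [← LinearMap.comp_assoc, ht, LinearMap.sub_comp, LinearMap.comp_assoc, hd]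
    simp
  | succ n ih =>
    intro N _ _ P _ _ _ ε d hε h0 hs hn
    exact ih (P := fun i => P (i + 1)) _ (fun i => d (i + 1)) (codRestrict_surjective h0)
      (by rw [LinearMap.ker_codRestrict, hs]) (fun i => hs (i + 1))
      (hasProjectiveDimensionLT_ker hε n hn)

variable {k : Type*} [Field k] [Algebra k A] {𝒜 : ℤ → Submodule k A}

/-- The projective dimension is less than `n` if and only if the `n`-th term of a minimal resolution
vanishes. Indeed, if the range of `d n` is a direct summand of `P n`, then the kernel of `d n` is one of
`P (n + 1)`; by minimality it lies in `A₊ P (n + 1)`, and so does the complement, which forces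
`P (n + 1) = 0`. -/
theorem IsMinimalGradedFreeResolution.hasProjectiveDimensionLT_iff [Small.{w} A] {aug : A →+* k}
    (haug : ∀ d ≠ 0, ∀ a ∈ 𝒜 d, aug a = 0) {N : Type w} [AddCommGroup N] [Module k N]
    [Module A N] {𝒩 : ℤ → Submodule k N} {P : ℕ → Type w} [∀ i, AddCommGroup (P i)]
    [∀ i, Module k (P i)] [∀ i, Module A (P i)] [∀ i, IsScalarTower k A (P i)]
    {𝒢 : ∀ i, ℤ → Submodule k (P i)} {r : ℕ → ℕ} {m : ∀ i, Fin (r i) → ℤ}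
    {ε : P 0 →ₗ[A] N} {d : ∀ i, P (i + 1) →ₗ[A] P i}
    (H : IsMinimalGradedFreeResolution 𝒜 𝒩 𝒢 r m ε d) (n : ℕ) :
    HasProjectiveDimensionLT (ModuleCat.of A N) n ↔ r n = 0 := by
  choose b hb using H.free
  have (i : ℕ) : Module.Projective A (P i) := Module.Projective.of_basis (b i)
  constructor
  · intro h
    by_contra hr
    let l : Fin (r n) := ⟨0, Nat.pos_of_ne_zero hr⟩
    have no_mem : b n l ∉ irrelevant 𝒜 • (⊤ : Submodule A (P n)) := fun hl => by
      simpa using repr_mem_of_mem_smul_top (b n) haug hl l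
    apply no_mem
    cases n with
    | zero =>
      have : Subsingleton N :=
        ModuleCat.isZero_iff_subsingleton.1 (isZero_of_hasProjectiveDimensionLT_zero (ModuleCat.of A N))
      apply H.minimal 0
      rw [← H.exact_zero]
      exact Subsingleton.elim _ _
    | succ n =>
      obtain ⟨t, ht⟩ := exists_comp_comp_eq_of_hasProjectiveDimensionLT n ε d H.surjective
        H.exact_zero H.exact_succ h
      -- `b = (b - t (d b)) + t (d b)` with the first summand in `ker d` and `d b` in `A₊ P`.
      have h1 : b (n + 1) l - t (d n (b (n + 1) l)) ∈ irrelevant 𝒜 • (⊤ : Submodule A _) := by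
        apply H.minimal (n + 1)
        rw [← H.exact_succ, LinearMap.mem_ker, map_sub, sub_eq_zero]
        exact (LinearMap.congr_fun ht _).symm
      have h2 : t (d n (b (n + 1) l)) ∈ irrelevant 𝒜 • (⊤ : Submodule A _) := by
        refine Submodule.smul_induction_on (p := fun z => t z ∈ irrelevant 𝒜 • ⊤)
          (H.minimal n ⟨_, rfl⟩) (fun a ha x _ => ?_) fun x y hx hy => ?_
        · rw [map_smul]
          exact Submodule.smul_mem_smul ha trivial
        · rw [map_add]
          exact add_mem hx hy
      simpa using add_mem h1 h2
  · intro h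
    refine hasProjectiveDimensionLT_of_subsingleton n ε d H.surjective H.exact_zero H.exact_succ ?_
    have : IsEmpty (Fin (r n)) := by rw [h]; infer_instance
    exact (b n).repr.toEquiv.subsingleton

theorem projectiveDimension_eq_of_iff {C D : Type*} [Category* C] [Abelian C] [Category* D]
    [Abelian D] {X : C} {Y : D}
    (h : ∀ n, HasProjectiveDimensionLT X n ↔ HasProjectiveDimensionLT Y n) :
    projectiveDimension X = projectiveDimension Y := by
  simp only [projectiveDimension, h]

end ProjectiveDimension

end GradedBetti

/-! ### Associated graded modules -/

namespace GradedBetti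

section Gr

variable {k : Type*} [Field k] {A : Type*} [Ring A] [Algebra k A] {ι : Type*}
  {gen : ι → A} {wt : ι → ℤ}
  {V : Type*} [AddCommGroup V] [Module k V] [Module A V] [IsScalarTower k A V]
  {W : Type*} [AddCommGroup W] [Module k W] [Module A W] [IsScalarTower k A W]

namespace Gr

/-- The map out of `gr V` given by maps on the steps `F_i` which vanish on `F_{i-1}`. -/
noncomputable def desc (F : Filtr k gen wt V) {X : Type*} [AddCommGroup X] [Module k X]
    (f : ∀ i, F.step i →ₗ[k] X) (hf : ∀ i (v : F.step i), (v : V) ∈ F.step (i - 1) → f i v = 0) :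
    Gr F →ₗ[k] X :=
  DirectSum.toModule k ℤ _ fun i => Submodule.liftQ _ (f i) fun v hv => hf i v hv

theorem desc_symb (F : Filtr k gen wt V) {X : Type*} [AddCommGroup X] [Module k X]
    (f : ∀ i, F.step i →ₗ[k] X) (hf : ∀ i (v : F.step i), (v : V) ∈ F.step (i - 1) → f i v = 0)
    (i : ℤ) (v : F.step i) : desc F f hf (symb F i v) = f i v := by
  simp only [desc, symb]
  erw [DirectSum.toModule_lof]
  rfl

theorem iSup_grading (F : Filtr k gen wt V) : ⨆ j, grading F j = ⊤ := by
  rw [← Submodule.ker_mkQ (⨆ j, grading F j), LinearMap.ker_eq_top]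
  apply hom_ext
  intro i v
  rw [LinearMap.zero_apply, Submodule.mkQ_apply, Submodule.Quotient.mk_eq_zero]
  exact Submodule.mem_iSup_of_mem i ⟨v, rfl⟩

/-- The projection of `gr V` to `F_j / F_{j-1}`. -/
noncomputable def component (F : Filtr k gen wt V) (j : ℤ) :
    Gr F →ₗ[k] F.step j ⧸ (F.step (j - 1)).submoduleOf (F.step j) :=
  DirectSum.component k ℤ (fun i => F.step i ⧸ (F.step (i - 1)).submoduleOf (F.step i)) j

theorem component_symb (F : Filtr k gen wt V) (j : ℤ) (v : F.step j) :
    component F j (symb F j v) = Submodule.Quotient.mk v :=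
  DirectSum.component.lof_self k
    (M := fun i => F.step i ⧸ (F.step (i - 1)).submoduleOf (F.step i)) j _

theorem component_symb_of_ne (F : Filtr k gen wt V) {i j : ℤ} (h : i ≠ j) (v : F.step i) :
    component F j (symb F i v) = 0 := by
  have := DirectSum.component.of k
    (M := fun i => F.step i ⧸ (F.step (i - 1)).submoduleOf (F.step i)) j i (Submodule.Quotient.mk v)
  rw [dif_neg h] at this
  exact this

theorem symb_eq_zero_iff (F : Filtr k gen wt V) {i : ℤ} (v : F.step i) :
    symb F i v = 0 ↔ (v : V) ∈ F.step (i - 1) := by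
  refine ⟨fun h => ?_, symb_eq_zero F⟩
  have := component_symb F i v
  rw [h, map_zero, eq_comm, Submodule.Quotient.mk_eq_zero] at this
  exact this

theorem iSupIndep_grading (F : Filtr k gen wt V) : iSupIndep (grading F) := by
  rw [iSupIndep_iff_finsetSum_eq_zero_imp_eq_zero]
  intro s z hz hsum i hi
  choose! v hv using hz
  have := congrArg (component F i) hsum
  rw [map_sum, map_zero, Finset.sum_eq_single i] at this
  · rw [← hv i hi, component_symb, Submodule.Quotient.mk_eq_zero] at this
    rw [← hv i hi, symb_eq_zero_iff]
    exact this
  · intro j hj hji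
    rw [← hv j hj, component_symb_of_ne F hji]
  · exact fun h => absurd hi h

theorem map_mem_grading (F : Filtr k gen wt V) (G : Filtr k gen wt W) (f : V →ₗ[A] W)
    (hf : ∀ i v, v ∈ F.step i → f v ∈ G.step i) (j : ℤ) (z : Gr F) (hz : z ∈ grading F j) :
    map F G f hf z ∈ grading G j := by
  obtain ⟨v, rfl⟩ := hz
  rw [map_symb]
  exact ⟨_, rfl⟩

theorem map_mem_inducedGrading (F : Filtr k gen wt V) (G : Filtr k gen wt W) (f : V →ₗ[A] W)
    (hf : ∀ i v, v ∈ F.step i → f v ∈ G.step i) {𝒱 : ℤ → Submodule k V} {𝒲 : ℤ → Submodule k W}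
    (hfg : ∀ j, ∀ v ∈ 𝒱 j, f v ∈ 𝒲 j) (j : ℤ) (z : Gr F) (hz : z ∈ inducedGrading F 𝒱 j) :
    map F G f hf z ∈ inducedGrading G 𝒲 j := by
  suffices h : inducedGrading F 𝒱 j ≤
      (inducedGrading G 𝒲 j).comap ((map F G f hf).restrictScalars k) from h hz
  refine iSup_le fun i => ?_
  rintro _ ⟨v, hv, rfl⟩
  rw [Submodule.mem_comap, LinearMap.restrictScalars_apply, map_symb]
  exact Submodule.mem_iSup_of_mem i ⟨_, hfg j _ hv, rfl⟩

/-- Over the filtered map, `gr` is surjective as soon as the filtration of the target is the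
image filtration. -/
theorem map_surjective (F : Filtr k gen wt V) (G : Filtr k gen wt W) (f : V →ₗ[A] W)
    (hf : ∀ i v, v ∈ F.step i → f v ∈ G.step i)
    (hG : ∀ i, ∀ w ∈ G.step i, ∃ v ∈ F.step i, f v = w) :
    Function.Surjective (map F G f hf) := by
  have : LinearMap.range ((map F G f hf).restrictScalars k) = ⊤ := by
    rw [eq_top_iff, ← iSup_grading G]
    refine iSup_le fun i => ?_
    rintro _ ⟨⟨w, hw⟩, rfl⟩
    obtain ⟨v, hv, rfl⟩ := hG i w hw
    exact ⟨symb F i ⟨v, hv⟩, map_symb F G f hf i ⟨v, hv⟩⟩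
  exact LinearMap.range_eq_top (f := (map F G f hf).restrictScalars k).1 this

theorem map_injective (F : Filtr k gen wt V) (G : Filtr k gen wt W) (f : V →ₗ[A] W)
    (hf : ∀ i v, v ∈ F.step i → f v ∈ G.step i)
    (hF : ∀ i v, v ∈ F.step i → f v ∈ G.step (i - 1) → v ∈ F.step (i - 1)) :
    Function.Injective (map F G f hf) := by
  refine LinearMap.ker_eq_bot (f := (map F G f hf).restrictScalars k).1 (eq_bot_iff.2 ?_)
  refine (ker_le_iSup_inf (iSup_grading F) (iSupIndep_grading G) _
    (map_mem_grading F G f hf)).trans (iSup_le fun j => ?_)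
  rintro _ ⟨⟨v, rfl⟩, hv⟩
  replace hv : map F G f hf (symb F j v) = 0 := hv
  rw [map_symb, symb_eq_zero_iff] at hv
  exact (symb_eq_zero_iff F v).2 (hF j v v.2 hv)

section Exact

variable {U : Type*} [AddCommGroup U] [Module k U] [Module A U] [IsScalarTower k A U]
  (E : Filtr k gen wt U) (F : Filtr k gen wt V) (G : Filtr k gen wt W) (φ : U →ₗ[A] V)
  (f : V →ₗ[A] W) (hφ : ∀ i v, v ∈ E.step i → φ v ∈ F.step i)
  (hf : ∀ i v, v ∈ F.step i → f v ∈ G.step i)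

/-- A strictly exact sequence of filtered modules has an exact associated graded sequence. -/
theorem ker_map_eq_range_map (hfφ : f ∘ₗ φ = 0)
    (strict : ∀ j, ∀ v ∈ F.step j, f v ∈ G.step (j - 1) → ∃ v' ∈ F.step (j - 1), f v' = f v)
    (exact : ∀ j, ∀ v ∈ F.step j, f v = 0 → ∃ u ∈ E.step j, φ u = v) :
    LinearMap.ker (map F G f hf) = LinearMap.range (map E F φ hφ) := by
  apply le_antisymm
  · rw [← Submodule.restrictScalars_le (S := k)]
    refine (ker_le_iSup_inf (iSup_grading F) (iSupIndep_grading G)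
      ((map F G f hf).restrictScalars k) (map_mem_grading F G f hf)).trans (iSup_le fun j => ?_)
    rintro _ ⟨⟨v, rfl⟩, hv⟩
    replace hv : map F G f hf (symb F j v) = 0 := hv
    rw [map_symb, symb_eq_zero_iff] at hv
    obtain ⟨v', hv', e⟩ := strict j v v.2 hv
    obtain ⟨u, hu, e'⟩ := exact j (v - v') (sub_mem v.2 (F.mono (by omega) hv'))
      (by rw [map_sub, e, sub_self])
    refine ⟨symb E j ⟨u, hu⟩, ?_⟩
    rw [map_symb, ← sub_eq_zero, ← map_sub, symb_eq_zero_iff]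
    simpa [e'] using hv'
  · rintro _ ⟨z, rfl⟩
    rw [LinearMap.mem_ker]
    have h : ((map F G f hf).restrictScalars k) ∘ₗ ((map E F φ hφ).restrictScalars k) = 0 := by
      apply hom_ext
      intro i u
      simp only [LinearMap.comp_apply, LinearMap.restrictScalars_apply, map_symb,
        LinearMap.zero_apply]
      apply symb_eq_zero
      have : f (φ u) = 0 := LinearMap.congr_fun hfφ u
      simp [this]
    exact LinearMap.congr_fun h z

variable {E F G φ f hφ hf}

/-- One step of successive approximation: an element with image of lower filtration degree is an
image up to terms of lower filtration degree. -/
theorem exists_map_symb (hex : LinearMap.ker (map F G f hf) ≤ LinearMap.range (map E F φ hφ))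
    (j : ℤ) (v : V) (hv : v ∈ F.step j) (hfv : f v ∈ G.step (j - 1)) :
    ∃ u ∈ E.step j, v - φ u ∈ F.step (j - 1) := by
  have : symb F j ⟨v, hv⟩ ∈ LinearMap.ker (map F G f hf) := by
    rw [LinearMap.mem_ker, map_symb]
    exact symb_eq_zero G hfv
  obtain ⟨z, hz⟩ := hex this
  obtain ⟨z', hz', e⟩ := exists_homogeneous_lift (𝒱 := grading E) (iSupIndep_grading F) (U := ⊤)
    (by simp [iSup_grading]) ((map E F φ hφ).restrictScalars k) (map_mem_grading E F φ hφ)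
    (u := z) (j := j) trivial ⟨⟨v, hv⟩, hz.symm⟩
  obtain ⟨⟨u, hu⟩, rfl⟩ := hz'.1
  refine ⟨u, hu, ?_⟩
  rw [LinearMap.restrictScalars_apply, LinearMap.restrictScalars_apply, hz, map_symb, eq_comm,
    ← sub_eq_zero, ← map_sub, symb_eq_zero_iff] at e
  exact e

/-- A sequence with exact associated graded sequence is strictly exact, if the filtration in the
middle is bounded below. -/
theorem exists_eq_of_exact (hex : LinearMap.ker (map F G f hf) ≤ LinearMap.range (map E F φ hφ))
    (hfφ : f ∘ₗ φ = 0) {c : ℤ} (hc : F.step c = ⊥) (j : ℤ) :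
    ∀ v ∈ F.step j, f v = 0 → ∃ u ∈ E.step j, φ u = v := by
  rcases le_total j c with h | h
  · intro v hv _
    have : v = 0 := by simpa [hc] using F.mono h hv
    exact ⟨0, zero_mem _, by simp [this]⟩
  · induction j, h using Int.leInduction with
    | base =>
      intro v hv _
      have : v = 0 := by simpa [hc] using hv
      exact ⟨0, zero_mem _, by simp [this]⟩
    | succ j _ ih =>
      intro v hv hfv
      obtain ⟨u, hu, huv⟩ := exists_map_symb hex (j + 1) v hv (by simp [hfv])
      obtain ⟨u', hu', e⟩ := ih (v - φ u) (by simpa using huv)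
        (by rw [map_sub, hfv, ← LinearMap.comp_apply, hfφ]; simp)
      exact ⟨u + u', add_mem hu (E.mono (by omega) hu'), by rw [map_add, e]; abel⟩

/-- If the associated graded sequence is exact, then the filtration of the target induces the image
filtration on the range. -/
theorem exists_strict_of_exact
    (hex : LinearMap.ker (map F G f hf) ≤ LinearMap.range (map E F φ hφ))
    (hfφ : f ∘ₗ φ = 0) {i j : ℤ} (hij : j ≤ i) :
    ∀ v ∈ F.step i, f v ∈ G.step j → ∃ v' ∈ F.step j, f v' = f v := by
  induction i, hij using Int.leInduction with
  | base => exact fun v hv _ => ⟨v, hv, rfl⟩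
  | succ i hij ih =>
    intro v hv hfv
    obtain ⟨u, hu, huv⟩ := exists_map_symb hex (i + 1) v hv (G.mono (by omega) hfv)
    have e : f (v - φ u) = f v := by
      rw [map_sub, ← LinearMap.comp_apply, hfφ]; simp
    rw [← e] at hfv ⊢
    exact ih _ (by simpa using huv) hfv

end Exact

/-- If the image of `gr f` is everything and the filtration of the target is bounded below, then
the filtration of the target is the image filtration. -/
theorem exists_eq_of_surjective {F : Filtr k gen wt V} {G : Filtr k gen wt W} {f : V →ₗ[A] W}
    {hf : ∀ i v, v ∈ F.step i → f v ∈ G.step i} (hs : Function.Surjective (map F G f hf))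
    {c : ℤ} (hc : G.step c = ⊥) (j : ℤ) (w : W) (hw : w ∈ G.step j) :
    ∃ v ∈ F.step j, f v = w := by
  let Z : Filtr k gen wt PUnit.{1} := ⟨fun _ => ⊥, fun _ _ _ => le_rfl, by simp, by simp⟩
  refine exists_eq_of_exact (G := Z) (f := 0) (hf := fun i v _ => zero_mem _) (hφ := hf) ?_
    (by simp) hc j w hw rfl
  rw [LinearMap.range_eq_top.2 hs]
  exact le_top

end Gr

/-- The filtration induced on the source of an `A`-linear map. -/
def Filtr.comap (G : Filtr k gen wt W) (φ : V →ₗ[A] W) : Filtr k gen wt V where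
  step i := (G.step i).comap (φ.restrictScalars k)
  mono _ _ h := Submodule.comap_mono (G.mono h)
  smul_mem a i v hv := by
    simpa using G.smul_mem a i _ hv
  comm_mem a b i v hv := by
    simpa using G.comm_mem a b i _ hv

end Gr

end GradedBetti

/-! ### Weighted degrees of polynomials -/

namespace GradedBetti

open MvPolynomial

section Weights

variable {k : Type*} [Field k] {ι : Type*} {wt : ι → ℤ}

/-- The polynomials all of whose monomials have weight at most `i`. -/
noncomputable def weightLE (k : Type*) [Field k] {ι : Type*} (wt : ι → ℤ) (i : ℤ) :
    Submodule k (MvPolynomial ι k) :=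
  restrictSupport k {α | Finsupp.weight wt α ≤ i}

theorem mem_weightLE {i : ℤ} {p : MvPolynomial ι k} :
    p ∈ weightLE k wt i ↔ ∀ α ∈ p.support, Finsupp.weight wt α ≤ i :=
  mem_restrictSupport_iff k

theorem weightedHomogeneousSubmodule_le_weightLE (i : ℤ) :
    weightedHomogeneousSubmodule k wt i ≤ weightLE k wt i := by
  intro p hp
  rw [mem_weightLE]
  exact fun α hα => (hp (mem_support_iff.1 hα)).le

theorem weightedHomogeneousComponent_eq_zero_of_mem_weightLE {i j : ℤ} (h : i < j)
    {p : MvPolynomial ι k} (hp : p ∈ weightLE k wt i) : weightedHomogeneousComponent wt j p = 0 :=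
  weightedHomogeneousComponent_eq_zero' j p fun α hα => (((mem_weightLE.1 hp) α hα).trans_lt h).ne

/-- The component of weight `i` is the leading form. -/
theorem mem_weightLE_sub_one_iff {i : ℤ} {p : MvPolynomial ι k} (hp : p ∈ weightLE k wt i) :
    p ∈ weightLE k wt (i - 1) ↔ weightedHomogeneousComponent wt i p = 0 := by
  classical
  refine ⟨weightedHomogeneousComponent_eq_zero_of_mem_weightLE (by omega), fun h => ?_⟩
  rw [mem_weightLE] at hp ⊢
  intro α hα
  have h1 := hp α hα
  have h2 : Finsupp.weight wt α ≠ i := by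
    rintro rfl
    have := congrArg (coeff α) h
    rw [coeff_weightedHomogeneousComponent, if_pos rfl, coeff_zero] at this
    exact mem_support_iff.1 hα this
  omega

theorem weightedHomogeneousComponent_X_mul (a : ι) (i : ℤ) (p : MvPolynomial ι k) :
    weightedHomogeneousComponent wt (i + wt a) (X a * p) =
      X a * weightedHomogeneousComponent wt i p := by
  classical
  induction p using MvPolynomial.induction_on' with
  | add p q hp hq => rw [mul_add, map_add, hp, hq, map_add, mul_add]
  | monomial α c =>
    have h1 : monomial α c ∈ weightedHomogeneousSubmodule k wt (Finsupp.weight wt α) :=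
      isWeightedHomogeneous_monomial wt α c rfl
    have h2 : X a * monomial α c ∈
        weightedHomogeneousSubmodule k wt (Finsupp.weight wt α + wt a) := by
      rw [add_comm]
      exact (isWeightedHomogeneous_X k wt a).mul h1
    rw [weightedHomogeneousComponent_of_mem h1, weightedHomogeneousComponent_of_mem h2]
    simp only [add_left_inj]
    split_ifs <;> simp

theorem iSupIndep_weightedHomogeneousSubmodule :
    iSupIndep (weightedHomogeneousSubmodule k wt) := by
  classical
  let _ := weightedDecomposition k wt
  exact (DirectSum.Decomposition.isInternal (weightedHomogeneousSubmodule k wt)).submodule_iSupIndep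

theorem iSup_weightedHomogeneousSubmodule : ⨆ i, weightedHomogeneousSubmodule k wt i = ⊤ := by
  classical
  let _ := weightedDecomposition k wt
  exact (DirectSum.Decomposition.isInternal
    (weightedHomogeneousSubmodule k wt)).submodule_iSup_eq_top

theorem weight_one_eq_degree (α : ι →₀ ℕ) :
    Finsupp.weight (fun _ => (1 : ℤ)) α = (α.degree : ℤ) := by
  simp [Finsupp.weight_apply, Finsupp.degree_apply, Finsupp.sum]

/-- The standard grading is the one for which all variables have weight `1`. -/
theorem polyGrading_eq (d : ℤ) :
    polyGrading k ι d = weightedHomogeneousSubmodule k (fun _ : ι => (1 : ℤ)) d := by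
  ext p
  rw [polyGrading, mem_weightedHomogeneousSubmodule]
  split_ifs with h
  · rw [mem_homogeneousSubmodule]
    refine forall_congr' fun α => imp_congr_right fun _ => ?_
    have hα : Finsupp.weight (1 : ι → ℕ) α = α.degree :=
      (DFunLike.congr_fun Finsupp.degree_eq_weight_one α).symm
    rw [weight_one_eq_degree, hα]
    omega
  · rw [Submodule.mem_bot]
    refine ⟨fun hp => hp ▸ isWeightedHomogeneous_zero k _ d, fun hp => ?_⟩
    by_contra h0
    obtain ⟨α, hα⟩ := MvPolynomial.ne_zero_iff.1 h0
    have := hp hα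
    rw [weight_one_eq_degree] at this
    omega

theorem iSupIndep_polyGrading : iSupIndep (polyGrading k ι) := by
  rw [funext polyGrading_eq]
  exact iSupIndep_weightedHomogeneousSubmodule

theorem iSup_polyGrading : ⨆ d, polyGrading k ι d = ⊤ := by
  simp only [polyGrading_eq]
  exact iSup_weightedHomogeneousSubmodule

theorem one_mem_polyGrading : (1 : MvPolynomial ι k) ∈ polyGrading k ι 0 := by
  rw [polyGrading_eq]
  exact isWeightedHomogeneous_one k _

theorem mul_mem_polyGrading (i j : ℤ) (p : MvPolynomial ι k) (hp : p ∈ polyGrading k ι i)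
    (q : MvPolynomial ι k) (hq : q ∈ polyGrading k ι j) : p * q ∈ polyGrading k ι (i + j) := by
  rw [polyGrading_eq] at *
  exact hp.mul hq

theorem constantCoeff_eq_zero_of_mem_polyGrading (d : ℤ) (hd : d ≠ 0) (p : MvPolynomial ι k)
    (hp : p ∈ polyGrading k ι d) : (constantCoeff : MvPolynomial ι k →+* k) p = 0 := by
  rw [polyGrading_eq] at hp
  rw [constantCoeff_eq]
  by_contra h
  exact hd (by simpa using (hp h).symm)

/-- The homogeneous polynomials of degree zero are the constants. -/
theorem eq_C_of_mem_polyGrading {p : MvPolynomial ι k} (hp : p ∈ polyGrading k ι 0) :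
    p = C (constantCoeff p) := by
  rw [polyGrading, if_pos le_rfl, mem_homogeneousSubmodule, Int.toNat_zero] at hp
  rw [constantCoeff_eq, ← totalDegree_eq_zero_iff_eq_C]
  exact Nat.le_zero.1 hp.totalDegree_le

/-- A homogeneous polynomial without constant term lies in the irrelevant ideal. -/
theorem mem_irrelevant_of_mem_polyGrading {d : ℤ} {p : MvPolynomial ι k}
    (hp : p ∈ polyGrading k ι d) (h0 : constantCoeff p = 0) : p ∈ irrelevant (polyGrading k ι) := by
  rcases lt_trichotomy d 0 with h | rfl | h
  · rw [polyGrading, if_neg (by omega), Submodule.mem_bot] at hp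
    rw [hp]
    exact zero_mem _
  · rw [eq_C_of_mem_polyGrading hp, h0, map_zero]
    exact zero_mem _
  · exact Ideal.subset_span ⟨d, h, hp⟩

end Weights

/-! ### Algebras with a polynomial symbol map, and associated graded free modules -/

section SymbolMap

variable {k : Type*} [Field k] {A : Type*} [Ring A] [Algebra k A] {ι : Type*}
  {gen : ι → A} {wt : ι → ℤ}

/-- A `k`-linear identification of a filtered algebra with the polynomial ring in its generators
(a full symbol, or normal ordering), which turns the filtration into the filtration by weight and
the multiplication by a generator into the multiplication by the variable, up to terms of lower
weight. -/
structure SymbolMap (F : Filtr k gen wt A) where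
  /-- The full symbol. -/
  σ : A ≃ₗ[k] MvPolynomial ι k
  map_one : σ 1 = 1
  mem_step : ∀ i P, P ∈ F.step i ↔ σ P ∈ weightLE k wt i
  gen_mul : ∀ a i P, P ∈ F.step i → σ (gen a * P) - X a * σ P ∈ weightLE k wt (i + wt a - 1)

namespace SymbolMap

variable {F : Filtr k gen wt A} (N : SymbolMap F)

include N in
theorem one_mem : (1 : A) ∈ F.step 0 := by
  rw [N.mem_step, N.map_one]
  exact weightedHomogeneousSubmodule_le_weightLE 0 (isWeightedHomogeneous_one k wt)

include N in
theorem single_mem {r : ℕ} (m : Fin r → ℤ) (l : Fin r) :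
    Pi.single l 1 ∈ (F.free m).step (m l) := by
  intro l' _
  by_cases h : l' = l
  · subst h
    simpa using N.one_mem
  · simp [Pi.single_eq_of_ne h]

/-- The vector of leading forms of an element of the `i`-th step of `A^r[m]`. -/
noncomputable def leading {r : ℕ} (m : Fin r → ℤ) (i : ℤ) :
    (Fin r → A) →ₗ[k] (Fin r → MvPolynomial ι k) :=
  LinearMap.pi fun l => weightedHomogeneousComponent wt (i - m l) ∘ₗ N.σ.toLinearMap ∘ₗ
    LinearMap.proj l

theorem leading_apply {r : ℕ} (m : Fin r → ℤ) (i : ℤ) (v : Fin r → A) (l : Fin r) :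
    N.leading m i v l = weightedHomogeneousComponent wt (i - m l) (N.σ (v l)) := rfl

theorem leading_eq_zero_iff {r : ℕ} (m : Fin r → ℤ) (i : ℤ) (v : Fin r → A)
    (hv : v ∈ (F.free m).step i) : N.leading m i v = 0 ↔ v ∈ (F.free m).step (i - 1) := by
  rw [funext_iff]
  refine ⟨fun h l _ => ?_, fun h l => ?_⟩
  · have := (mem_weightLE_sub_one_iff ((N.mem_step _ _).1 (hv l trivial))).2 (h l)
    change v l ∈ F.step (i - 1 - m l)
    rwa [N.mem_step, sub_right_comm]
  · have := (N.mem_step _ _).1 (h l trivial)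
    exact weightedHomogeneousComponent_eq_zero_of_mem_weightLE (by omega) this

/-- The isomorphism of the next definition, as a `k`-linear map. -/
noncomputable def grFreeAux {r : ℕ} (m : Fin r → ℤ) :
    Gr (F.free m) →ₗ[k] (Fin r → MvPolynomial ι k) :=
  Gr.desc (F.free m) (fun i => N.leading m i ∘ₗ ((F.free m).step i).subtype)
    fun i v hv => (N.leading_eq_zero_iff m i v v.2).2 hv

theorem grFreeAux_symb {r : ℕ} (m : Fin r → ℤ) (i : ℤ) (v : (F.free m).step i) :
    N.grFreeAux m (Gr.symb (F.free m) i v) = N.leading m i v :=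
  Gr.desc_symb _ _ _ _ _

theorem grFreeAux_op {r : ℕ} (m : Fin r → ℤ) (a : ι) (z : Gr (F.free m)) :
    N.grFreeAux m (Gr.op (F.free m) a z) =
      (X a : MvPolynomial ι k) • N.grFreeAux m z := by
  suffices h : N.grFreeAux m ∘ₗ Gr.op (F.free m) a =
      (LinearMap.pi fun l => LinearMap.mulLeft k (X a) ∘ₗ LinearMap.proj l) ∘ₗ N.grFreeAux m from
    LinearMap.congr_fun h z
  apply Gr.hom_ext
  intro i v
  rw [LinearMap.comp_apply, LinearMap.comp_apply, Gr.op_symb, grFreeAux_symb, grFreeAux_symb]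
  funext l
  have h1 := N.gen_mul a _ _ (v.2 l trivial)
  have h2 := weightedHomogeneousComponent_eq_zero_of_mem_weightLE
    (show i - m l + wt a - 1 < i - m l + wt a by omega) h1
  rw [map_sub, sub_eq_zero, weightedHomogeneousComponent_X_mul] at h2
  simp only [leading_apply, LinearMap.pi_apply, LinearMap.comp_apply, LinearMap.proj_apply,
    LinearMap.mulLeft_apply]
  rw [show i + wt a - m l = i - m l + wt a by ring]
  exact h2

/-- The associated graded module of `A^r[m]` is a free module over the polynomial ring: the class of
a vector is sent to its vector of leading forms. -/
noncomputable def grFree {r : ℕ} (m : Fin r → ℤ) :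
    Gr (F.free m) →ₗ[MvPolynomial ι k] (Fin r → MvPolynomial ι k) where
  __ := N.grFreeAux m
  map_smul' p z := by
    change N.grFreeAux m (p • z) = p • N.grFreeAux m z
    induction p using MvPolynomial.induction_on generalizing z with
    | C c =>
      rw [Gr.C_smul, map_smul]
      funext l
      simp [MvPolynomial.smul_eq_C_mul]
    | add p q hp hq => rw [add_smul, map_add, hp, hq, add_smul]
    | mul_X p a hp => rw [mul_smul, hp, Gr.X_smul, grFreeAux_op, mul_smul]

theorem grFree_symb {r : ℕ} (m : Fin r → ℤ) (i : ℤ) (v : (F.free m).step i) :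
    N.grFree m (Gr.symb (F.free m) i v) = N.leading m i v :=
  N.grFreeAux_symb m i v

theorem leading_single {r : ℕ} (m : Fin r → ℤ) (l : Fin r) :
    N.leading m (m l) (Pi.single l 1) = Pi.single l 1 := by
  funext l'
  rw [leading_apply]
  by_cases h : l' = l
  · subst h
    rw [Pi.single_eq_same, Pi.single_eq_same, N.map_one, sub_self]
    exact weightedHomogeneousComponent_eq_self (isWeightedHomogeneous_one k wt)
  · rw [Pi.single_eq_of_ne h, Pi.single_eq_of_ne h, map_zero, map_zero]

theorem grFree_mem {r : ℕ} (m : Fin r → ℤ) (j : ℤ) (z : Gr (F.free m))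
    (hz : z ∈ Gr.grading (F.free m) j) :
    N.grFree m z ∈ freeGrading (weightedHomogeneousSubmodule k wt) m j := by
  obtain ⟨v, rfl⟩ := hz
  rw [grFree_symb]
  exact fun l _ => weightedHomogeneousComponent_mem wt _ _

theorem grFree_injective {r : ℕ} (m : Fin r → ℤ) : Function.Injective (N.grFree m) := by
  refine LinearMap.ker_eq_bot (f := (N.grFree m).restrictScalars k).1 (eq_bot_iff.2 ?_)
  refine (ker_le_iSup_inf (Gr.iSup_grading (F.free m))
    (freeGrading_iSupIndep iSupIndep_weightedHomogeneousSubmodule m) _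
    (N.grFree_mem m)).trans (iSup_le fun j => ?_)
  rintro _ ⟨⟨v, rfl⟩, hv⟩
  replace hv : N.grFree m (Gr.symb (F.free m) j v) = 0 := hv
  rw [grFree_symb, N.leading_eq_zero_iff m j v v.2] at hv
  exact Gr.symb_eq_zero _ hv

theorem grFree_surjective {r : ℕ} (m : Fin r → ℤ) : Function.Surjective (N.grFree m) := by
  rw [← LinearMap.range_eq_top, eq_top_iff, ← (Pi.basisFun (MvPolynomial ι k) (Fin r)).span_eq,
    Submodule.span_le]
  rintro _ ⟨l, rfl⟩
  refine ⟨Gr.symb (F.free m) (m l) ⟨_, N.single_mem m l⟩, ?_⟩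
  rw [grFree_symb, Pi.basisFun_apply]
  exact N.leading_single m l

/-- The basis of `gr A^r[m]` formed by the classes of the basis vectors. -/
noncomputable def grBasis {r : ℕ} (m : Fin r → ℤ) :
    Module.Basis (Fin r) (MvPolynomial ι k) (Gr (F.free m)) :=
  Module.Basis.ofEquivFun
    (LinearEquiv.ofBijective (N.grFree m) ⟨N.grFree_injective m, N.grFree_surjective m⟩)

theorem grBasis_equivFun {r : ℕ} (m : Fin r → ℤ) (z : Gr (F.free m)) :
    (N.grBasis m).equivFun z = N.grFree m z := by
  rw [grBasis, Module.Basis.equivFun_ofEquivFun]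
  rfl

theorem grBasis_repr {r : ℕ} (m : Fin r → ℤ) (z : Gr (F.free m)) (l : Fin r) :
    (N.grBasis m).repr z l = N.grFree m z l := by
  rw [← grBasis_equivFun]; rfl

theorem grBasis_apply {r : ℕ} (m : Fin r → ℤ) (l : Fin r)
    (hl : Pi.single l 1 ∈ (F.free m).step (m l)) :
    N.grBasis m l = Gr.symb (F.free m) (m l) ⟨Pi.single l 1, hl⟩ := by
  apply N.grFree_injective m
  rw [grFree_symb, leading_single, ← grBasis_equivFun]
  funext l'
  rw [Module.Basis.equivFun_self, Pi.single_apply]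
  simp only [eq_comm]

/-- The grading of `gr A^r[m]` in coordinates. -/
theorem mem_grading_free_iff {r : ℕ} (m : Fin r → ℤ) (j : ℤ) (z : Gr (F.free m)) :
    z ∈ Gr.grading (F.free m) j ↔
      N.grFree m z ∈ freeGrading (weightedHomogeneousSubmodule k wt) m j := by
  refine ⟨N.grFree_mem m j z, fun h => ?_⟩
  have hv : (fun l => N.σ.symm (N.grFree m z l)) ∈ (F.free m).step j := by
    intro l _
    change _ ∈ F.step (j - m l)
    rw [N.mem_step, LinearEquiv.apply_symm_apply]
    exact weightedHomogeneousSubmodule_le_weightLE _ (h l trivial)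
  refine ⟨⟨_, hv⟩, N.grFree_injective m ?_⟩
  rw [grFree_symb]
  funext l
  rw [leading_apply, LinearEquiv.apply_symm_apply]
  exact weightedHomogeneousComponent_eq_self (h l trivial)

include N in
theorem gr_free_finite {r : ℕ} (m : Fin r → ℤ) :
    Module.Finite (MvPolynomial ι k) (Gr (F.free m)) :=
  Module.Finite.of_basis (N.grBasis m)

/-- Expansion of a symbol in the standard basis of `gr A^r[m]`. -/
theorem symb_eq_sum {r : ℕ} (m : Fin r → ℤ) (j : ℤ) (u : (F.free m).step j) :
    Gr.symb (F.free m) j u = ∑ l, N.leading m j u l • N.grBasis m l := by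
  conv_lhs => rw [← (N.grBasis m).sum_repr (Gr.symb _ j u)]
  simp only [grBasis_repr, grFree_symb]

include N in
theorem exists_mem_step (P : A) : ∃ i, P ∈ F.step i := by
  simp only [N.mem_step, mem_weightLE]
  obtain ⟨M, hM⟩ := ((Finset.image (Finsupp.weight wt) (N.σ P).support)).bddAbove
  exact ⟨M, fun α hα => hM (by simpa using ⟨α, by simpa using hα, rfl⟩)⟩

include N in
theorem exists_mem_free_step {r : ℕ} (m : Fin r → ℤ) (v : Fin r → A) :
    ∃ j, v ∈ (F.free m).step j := by
  choose i hi using fun l => N.exists_mem_step (v l)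
  obtain ⟨M, hM⟩ := (Set.finite_range fun l => i l + m l).bddAbove
  refine ⟨M, fun l _ => ?_⟩
  have : i l + m l ≤ M := hM ⟨l, rfl⟩
  exact F.mono (by omega) (hi l)

end SymbolMap

end SymbolMap

end GradedBetti

/-! ### Normal ordering in the Weyl algebras -/

namespace GradedBetti

open MvPolynomial

section NormalOrdering

/-- A linear map which sends a spanning family to monomials, such that members of the family with
the same monomial are equal and all monomials occur, is bijective. -/
theorem bijective_of_monomial {k A J ι : Type*} [Field k] [AddCommGroup A] [Module k A]
    (f : A →ₗ[k] MvPolynomial ι k) (mon : J → A) (ex : J → ι →₀ ℕ)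
    (hex : Function.Surjective ex) (hmon : ∀ i j, ex i = ex j → mon i = mon j)
    (hspan : Submodule.span k (Set.range mon) = ⊤) (hf : ∀ j, f (mon j) = monomial (ex j) 1) :
    Function.Bijective f := by
  let g : MvPolynomial ι k →ₗ[k] A :=
    (basisMonomials ι k).constr ℕ fun α => mon (Function.surjInv hex α)
  have hg : ∀ α, g (monomial α 1) = mon (Function.surjInv hex α) := fun α => by
    have := (basisMonomials ι k).constr_basis ℕ (fun α => mon (Function.surjInv hex α)) α
    rwa [coe_basisMonomials] at this
  have hgf : g ∘ₗ f = LinearMap.id := by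
    refine LinearMap.ext_on_range hspan fun j => ?_
    rw [LinearMap.comp_apply, hf, hg, LinearMap.id_apply]
    exact hmon _ _ (Function.surjInv_eq hex _)
  have hfg : f ∘ₗ g = LinearMap.id := by
    refine (basisMonomials ι k).ext fun α => ?_
    rw [coe_basisMonomials, LinearMap.comp_apply, hg, hf, Function.surjInv_eq hex,
      LinearMap.id_apply]
  exact ⟨Function.LeftInverse.injective (g := g) (LinearMap.congr_fun hgf),
    Function.RightInverse.surjective (g := g) (LinearMap.congr_fun hfg)⟩

/-- Under a map as in `bijective_of_monomial`, the span of a part of the family corresponds to the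
polynomials with the corresponding monomials. -/
theorem mem_span_iff_of_monomial {k A J ι : Type*} [Field k] [AddCommGroup A] [Module k A]
    (f : A ≃ₗ[k] MvPolynomial ι k) (mon : J → A) (ex : J → ι →₀ ℕ)
    (hex : Function.Surjective ex) (hf : ∀ j, f (mon j) = monomial (ex j) 1)
    (s : Set (ι →₀ ℕ)) (P : A) :
    P ∈ Submodule.span k (mon '' (ex ⁻¹' s)) ↔ f P ∈ restrictSupport k s := by
  have h : restrictSupport k s =
      (Submodule.span k (mon '' (ex ⁻¹' s))).map f.toLinearMap := by
    rw [restrictSupport_eq_span, Submodule.map_span, ← Set.image_comp]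
    congr 1
    ext p
    constructor
    · rintro ⟨α, hα, rfl⟩
      obtain ⟨j, rfl⟩ := hex α
      exact ⟨j, hα, hf j⟩
    · rintro ⟨j, hj, rfl⟩
      exact ⟨ex j, hj, (hf j).symm⟩
  rw [h]
  exact ⟨fun hP => ⟨P, hP, rfl⟩, fun ⟨Q, hQ, e⟩ => f.injective e ▸ hQ⟩

variable {κ : Type*}

/-- The exponent of the monomial `∏ x_{c i}` for the word `u` in the letters `i`. -/
noncomputable def wordExp {ρ : Type*} (c : ρ → κ) (u : List ρ) : κ →₀ ℕ :=
  (u.map fun i => Finsupp.single (c i) 1).sum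

theorem weight_wordExp {ρ : Type*} (wt : κ → ℤ) (c : ρ → κ) (hc : ∀ i, wt (c i) = 1)
    (u : List ρ) : Finsupp.weight wt (wordExp c u) = u.length := by
  induction u with
  | nil => simp [wordExp]
  | cons i u ih =>
    have : wordExp c (i :: u) = Finsupp.single (c i) 1 + wordExp c u := by simp [wordExp]
    rw [this, map_add, ih, Finsupp.weight_single, hc]
    simp [add_comm]

theorem wordExp_append {ρ : Type*} (c : ρ → κ) (u v : List ρ) :
    wordExp c (u ++ v) = wordExp c u + wordExp c v := by
  simp [wordExp]

theorem wordExp_apply {ρ : Type*} [DecidableEq ρ] {c : ρ → κ} (hc : Function.Injective c)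
    (u : List ρ) (i : ρ) : wordExp c u (c i) = u.count i := by
  classical
  induction u with
  | nil => simp [wordExp]
  | cons j u ih =>
    have : wordExp c (j :: u) = Finsupp.single (c j) 1 + wordExp c u := by simp [wordExp]
    rw [this, Finsupp.add_apply, ih, Finsupp.single_apply, List.count_cons, add_comm]
    simp [hc.eq_iff]

theorem wordExp_apply_of_ne {ρ : Type*} {c : ρ → κ} (u : List ρ) (a : κ) (h : ∀ i, c i ≠ a) :
    wordExp c u a = 0 := by
  induction u with
  | nil => simp [wordExp]
  | cons j u ih =>
    have : wordExp c (j :: u) = Finsupp.single (c j) 1 + wordExp c u := by simp [wordExp]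
    rw [this, Finsupp.add_apply, ih, Finsupp.single_eq_of_ne' (h j)]

/-- Words with the same letters in commuting elements have the same product. -/
theorem prod_map_eq_of_count {A ρ : Type*} [Monoid A] [DecidableEq ρ] (x : ρ → A)
    (hx : ∀ i j, x i * x j = x j * x i) {u v : List ρ} (h : ∀ i, u.count i = v.count i) :
    (u.map x).prod = (v.map x).prod := by
  refine ((List.perm_iff_count.2 h).map x).prod_eq' ?_
  rw [List.pairwise_map]
  exact List.pairwise_of_forall fun i j => hx i j

end NormalOrdering

section Weyl

variable (k : Type u) [Field k] (n : ℕ)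

/-- The normally ordered monomial `x_{u₁} ⋯ x_{uₐ} ∂_{v₁} ⋯ ∂_{v_b}` of the Weyl algebra. -/
noncomputable def Weyl.mon (j : List (Fin n) × List (Fin n)) : Weyl k n :=
  (j.1.map fun i => Weyl.gen k n (Sum.inl i)).prod *
    (j.2.map fun i => Weyl.gen k n (Sum.inr i)).prod

/-- The exponent of a normally ordered monomial. -/
noncomputable def Weyl.ex (j : List (Fin n) × List (Fin n)) : (Fin n ⊕ Fin n) →₀ ℕ :=
  wordExp Sum.inl j.1 + wordExp Sum.inr j.2

/-- The normally ordered monomial `h^l x_{u₁} ⋯ x_{uₐ} ∂_{v₁} ⋯ ∂_{v_b}`. -/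
noncomputable def HWeyl.mon (j : ℕ × List (Fin n) × List (Fin n)) : HWeyl k n :=
  HWeyl.gen k n none ^ j.1 * ((j.2.1.map fun i => HWeyl.gen k n (some (Sum.inl i))).prod *
    (j.2.2.map fun i => HWeyl.gen k n (some (Sum.inr i))).prod)

/-- The exponent of a normally ordered monomial with a power of `h`. -/
noncomputable def HWeyl.ex (j : ℕ × List (Fin n) × List (Fin n)) :
    Option (Fin n ⊕ Fin n) →₀ ℕ :=
  Finsupp.single none j.1 +
    (wordExp (fun i => some (Sum.inl i)) j.2.1 + wordExp (fun i => some (Sum.inr i)) j.2.2)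

theorem Weyl.ex_surjective : Function.Surjective (Weyl.ex n) := by
  intro α
  induction α using Finsupp.induction_linear with
  | zero => exact ⟨([], []), by simp [Weyl.ex, wordExp]⟩
  | add f g hf hg =>
    obtain ⟨⟨u, v⟩, rfl⟩ := hf
    obtain ⟨⟨u', v'⟩, rfl⟩ := hg
    exact ⟨(u ++ u', v ++ v'), by simp only [Weyl.ex, wordExp_append]; abel⟩
  | single a l =>
    cases a with
    | inl i => exact ⟨(List.replicate l i, []), by simp [Weyl.ex, wordExp]⟩
    | inr i => exact ⟨([], List.replicate l i), by simp [Weyl.ex, wordExp]⟩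

theorem HWeyl.ex_surjective : Function.Surjective (HWeyl.ex n) := by
  intro α
  induction α using Finsupp.induction_linear with
  | zero => exact ⟨(0, [], []), by simp [HWeyl.ex, wordExp]⟩
  | add f g hf hg =>
    obtain ⟨⟨l, u, v⟩, rfl⟩ := hf
    obtain ⟨⟨l', u', v'⟩, rfl⟩ := hg
    exact ⟨(l + l', u ++ u', v ++ v'), by
      simp only [HWeyl.ex, wordExp_append, Finsupp.single_add]; abel⟩
  | single a l =>
    rcases a with _ | i | i
    · exact ⟨(l, [], []), by simp [HWeyl.ex, wordExp]⟩
    · exact ⟨(0, List.replicate l i, []), by simp [HWeyl.ex, wordExp]⟩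
    · exact ⟨(0, [], List.replicate l i), by simp [HWeyl.ex, wordExp]⟩

theorem Weyl.mon_eq (i j : List (Fin n) × List (Fin n)) (h : Weyl.ex n i = Weyl.ex n j) :
    Weyl.mon k n i = Weyl.mon k n j := by
  have key : ∀ (j : List (Fin n) × List (Fin n)) a, Weyl.ex n j (Sum.inl a) = j.1.count a ∧
      Weyl.ex n j (Sum.inr a) = j.2.count a := by
    intro j a
    simp only [Weyl.ex, Finsupp.add_apply]
    rw [wordExp_apply Sum.inl_injective, wordExp_apply Sum.inr_injective,
      wordExp_apply_of_ne _ _ (by simp), wordExp_apply_of_ne _ _ (by simp)]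
    simp
  rw [Weyl.mon, Weyl.mon, prod_map_eq_of_count _ Weyl.gen_xx (v := j.1) fun a => by
      rw [← (key i a).1, ← (key j a).1, h],
    prod_map_eq_of_count _ Weyl.gen_dd (v := j.2) fun a => by
      rw [← (key i a).2, ← (key j a).2, h]]

theorem HWeyl.mon_eq (i j : ℕ × List (Fin n) × List (Fin n)) (h : HWeyl.ex n i = HWeyl.ex n j) :
    HWeyl.mon k n i = HWeyl.mon k n j := by
  have inj1 : Function.Injective fun i : Fin n => some (Sum.inl i : Fin n ⊕ Fin n) :=
    (Option.some_injective _).comp Sum.inl_injective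
  have inj2 : Function.Injective fun i : Fin n => some (Sum.inr i : Fin n ⊕ Fin n) :=
    (Option.some_injective _).comp Sum.inr_injective
  have key : ∀ (j : ℕ × List (Fin n) × List (Fin n)) a,
      HWeyl.ex n j (some (Sum.inl a)) = j.2.1.count a ∧
      HWeyl.ex n j (some (Sum.inr a)) = j.2.2.count a := by
    intro j a
    simp only [HWeyl.ex, Finsupp.add_apply]
    rw [wordExp_apply inj1, wordExp_apply inj2,
      wordExp_apply_of_ne _ _ (by simp), wordExp_apply_of_ne _ _ (by simp)]
    simp
  have key0 : ∀ j : ℕ × List (Fin n) × List (Fin n), HWeyl.ex n j none = j.1 := by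
    intro j
    simp only [HWeyl.ex, Finsupp.add_apply]
    rw [wordExp_apply_of_ne _ _ (by simp), wordExp_apply_of_ne _ _ (by simp)]
    simp
  rw [HWeyl.mon, HWeyl.mon, ← key0 i, ← key0 j, h,
    prod_map_eq_of_count _ HWeyl.gen_xx (v := j.2.1) fun a => by
      rw [← (key i a).1, ← (key j a).1, h],
    prod_map_eq_of_count _ HWeyl.gen_dd (v := j.2.2) fun a => by
      rw [← (key i a).2, ← (key j a).2, h]]

theorem Weyl.weight_ex (j : List (Fin n) × List (Fin n)) :
    Finsupp.weight (fun _ => (1 : ℤ)) (Weyl.ex n j) = j.1.length + j.2.length := by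
  rw [Weyl.ex, map_add, weight_wordExp _ _ (by simp), weight_wordExp _ _ (by simp)]

theorem HWeyl.weight_ex (j : ℕ × List (Fin n) × List (Fin n)) :
    Finsupp.weight (HWeyl.wt n) (HWeyl.ex n j) = j.2.1.length + j.2.2.length := by
  rw [HWeyl.ex, map_add, map_add, weight_wordExp _ _ (by simp [HWeyl.wt]),
    weight_wordExp _ _ (by simp [HWeyl.wt]), Finsupp.weight_single]
  simp [HWeyl.wt]

theorem HWeyl.weight_one_ex (j : ℕ × List (Fin n) × List (Fin n)) :
    Finsupp.weight (fun _ => (1 : ℤ)) (HWeyl.ex n j) = j.1 + j.2.1.length + j.2.2.length := by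
  rw [HWeyl.ex, map_add, map_add, weight_wordExp _ _ (by simp),
    weight_wordExp _ _ (by simp), Finsupp.weight_single]
  simp [add_assoc]

/-- The step `L_i D` in terms of exponents. -/
theorem Weyl.stepL_eq (i : ℤ) : Weyl.stepL k n i = Submodule.span k
    (Weyl.mon k n '' (Weyl.ex n ⁻¹' {α | Finsupp.weight (fun _ => (1 : ℤ)) α ≤ i})) := by
  rw [Weyl.stepL]
  congr 1
  ext P
  constructor
  · rintro ⟨u, v, h, rfl⟩
    exact ⟨(u, v), by simpa [Weyl.weight_ex] using h, rfl⟩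
  · rintro ⟨⟨u, v⟩, h, rfl⟩
    exact ⟨u, v, by simpa [Weyl.weight_ex] using h, rfl⟩

theorem HWeyl.stepL_eq (i : ℤ) : HWeyl.stepL k n i = Submodule.span k
    (HWeyl.mon k n '' (HWeyl.ex n ⁻¹' {α | Finsupp.weight (HWeyl.wt n) α ≤ i})) := by
  rw [HWeyl.stepL]
  congr 1
  ext P
  constructor
  · rintro ⟨l, u, v, h, rfl⟩
    exact ⟨(l, u, v), by simpa [HWeyl.weight_ex] using h, rfl⟩
  · rintro ⟨⟨l, u, v⟩, h, rfl⟩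
    exact ⟨l, u, v, by simpa [HWeyl.weight_ex] using h, rfl⟩

theorem HWeyl.grading_eq (d : ℤ) : HWeyl.grading k n d = Submodule.span k
    (HWeyl.mon k n '' (HWeyl.ex n ⁻¹' {α | Finsupp.weight (fun _ => (1 : ℤ)) α = d})) := by
  rw [HWeyl.grading]
  congr 1
  ext P
  constructor
  · rintro ⟨l, u, v, h, rfl⟩
    exact ⟨(l, u, v), by simpa [HWeyl.weight_one_ex] using h, rfl⟩
  · rintro ⟨⟨l, u, v⟩, h, rfl⟩
    exact ⟨l, u, v, by simpa [HWeyl.weight_one_ex] using h, rfl⟩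

theorem Weyl.adjoin_eq_top : Algebra.adjoin k (Set.range (Weyl.gen k n)) = ⊤ := by
  have h := FreeAlgebra.adjoin_range_ι k (Fin n ⊕ Fin n)
  have h2 := congrArg (Subalgebra.map (RingQuot.mkAlgHom k (WeylRel k n))) h
  rw [AlgHom.map_adjoin, ← Set.range_comp, Algebra.map_top,
    (AlgHom.range_eq_top _).2 (RingQuot.mkAlgHom_surjective k _)] at h2
  exact h2

theorem HWeyl.adjoin_eq_top : Algebra.adjoin k (Set.range (HWeyl.gen k n)) = ⊤ := by
  have h := FreeAlgebra.adjoin_range_ι k (Option (Fin n ⊕ Fin n))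
  have h2 := congrArg (Subalgebra.map (RingQuot.mkAlgHom k (HWeylRel k n))) h
  rw [AlgHom.map_adjoin, ← Set.range_comp, Algebra.map_top,
    (AlgHom.range_eq_top _).2 (RingQuot.mkAlgHom_surjective k _)] at h2
  exact h2

/-- A subspace that contains `1` and is stable under left multiplication by a set of algebra
generators is everything. -/
theorem eq_top_of_mul_mem {A ι : Type*} [Ring A] [Algebra k A] {gen : ι → A}
    (hgen : Algebra.adjoin k (Set.range gen) = ⊤) (T : Submodule k A) (h1 : (1 : A) ∈ T)
    (hT : ∀ a, ∀ P ∈ T, gen a * P ∈ T) : T = ⊤ := by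
  rw [eq_top_iff]
  have : ∀ P ∈ Algebra.adjoin k (Set.range gen), ∀ Q ∈ T, P * Q ∈ T := by
    intro P hP
    induction hP using Algebra.adjoin_induction with
    | mem P hP =>
      obtain ⟨a, rfl⟩ := hP
      exact hT a
    | algebraMap c =>
      intro Q hQ
      rw [← Algebra.smul_def]
      exact T.smul_mem c hQ
    | add P P' _ _ h h' =>
      intro Q hQ
      rw [add_mul]
      exact add_mem (h Q hQ) (h' Q hQ)
    | mul P P' _ _ h h' =>
      intro Q hQ
      rw [mul_assoc]
      exact h _ (h' Q hQ)
  intro P _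
  rw [← mul_one P]
  exact this P (hgen ▸ Algebra.mem_top) 1 h1

theorem Weyl.span_mon : Submodule.span k (Set.range (Weyl.mon k n)) = ⊤ := by
  have hT : Submodule.span k (Set.range (Weyl.mon k n)) = ⨆ i, Weyl.stepL k n i := by
    simp_rw [Weyl.stepL_eq, ← Submodule.span_iUnion, ← Set.image_iUnion, ← Set.preimage_iUnion]
    rw [← Set.image_univ]
    congr 2
    ext j
    simpa using ⟨_, le_rfl⟩
  rw [hT]
  refine eq_top_of_mul_mem k (Weyl.adjoin_eq_top k n) _
    (Submodule.mem_iSup_of_mem 0 (Submodule.subset_span ⟨[], [], by simp, by simp⟩)) ?_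
  intro a P hP
  rw [Submodule.mem_iSup_of_directed _ (Weyl.stepL_mono k n).directed_le] at hP
  obtain ⟨i, hi⟩ := hP
  exact Submodule.mem_iSup_of_mem (i + 1) (Weyl.gen_mul_mem k n a i P hi)

theorem HWeyl.span_mon : Submodule.span k (Set.range (HWeyl.mon k n)) = ⊤ := by
  have hT : Submodule.span k (Set.range (HWeyl.mon k n)) = ⨆ i, HWeyl.stepL k n i := by
    simp_rw [HWeyl.stepL_eq, ← Submodule.span_iUnion, ← Set.image_iUnion, ← Set.preimage_iUnion]
    rw [← Set.image_univ]
    congr 2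
    ext j
    simpa using ⟨_, le_rfl⟩
  rw [hT]
  refine eq_top_of_mul_mem k (HWeyl.adjoin_eq_top k n) _
    (Submodule.mem_iSup_of_mem 0 (Submodule.subset_span ⟨0, [], [], by simp, by simp⟩)) ?_
  intro a P hP
  rw [Submodule.mem_iSup_of_directed _ (HWeyl.stepL_mono k n).directed_le] at hP
  obtain ⟨i, hi⟩ := hP
  exact Submodule.mem_iSup_of_mem (i + HWeyl.wt n a) ((HWeyl.filtr k n).smul_mem a i P hi)

end Weyl

end GradedBetti

/-! ### The full symbols of the Weyl algebras -/

namespace GradedBetti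

open MvPolynomial

section Representation

variable {k : Type*} [Field k] {κ : Type*}

theorem X_mul_mem_weightLE {wt : κ → ℤ} (a : κ) {i : ℤ} {p : MvPolynomial κ k}
    (hp : p ∈ weightLE k wt i) : X a * p ∈ weightLE k wt (i + wt a) := by
  rw [weightLE, restrictSupport_eq_span] at hp
  induction hp using Submodule.span_induction with
  | mem p hp =>
    obtain ⟨α, hα, rfl⟩ := hp
    dsimp only
    rw [X, monomial_mul, weightLE, monomial_mem_restrictSupport]
    left
    have : Finsupp.weight wt α ≤ i := hα
    simp only [Set.mem_ofPred_eq, map_add, Finsupp.weight_single, one_smul]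
    omega
  | zero => simp
  | add p q _ _ hp hq => rw [mul_add]; exact add_mem hp hq
  | smul c p _ hp => rw [mul_smul_comm]; exact Submodule.smul_mem _ _ hp

theorem pderiv_mem_weightLE {wt : κ → ℤ} (a : κ) (ha : 0 ≤ wt a) {i : ℤ} {p : MvPolynomial κ k}
    (hp : p ∈ weightLE k wt i) : pderiv a p ∈ weightLE k wt i := by
  rw [weightLE, restrictSupport_eq_span] at hp
  induction hp using Submodule.span_induction with
  | mem p hp =>
    obtain ⟨α, hα, rfl⟩ := hp
    dsimp only
    rw [pderiv_monomial, weightLE, monomial_mem_restrictSupport]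
    by_cases h0 : α a = 0
    · right
      simp [h0]
    · left
      have h1 : Finsupp.weight wt α ≤ i := hα
      have h2 : α - Finsupp.single a 1 + Finsupp.single a 1 = α :=
        tsub_add_cancel_of_le (by simpa using Nat.one_le_iff_ne_zero.2 h0)
      rw [← h2, map_add, Finsupp.weight_single, one_smul] at h1
      simp only [Set.mem_ofPred_eq]
      omega
  | zero => simp
  | add p q _ _ hp hq => rw [map_add]; exact add_mem hp hq
  | smul c p _ hp => rw [Derivation.map_smul]; exact Submodule.smul_mem _ _ hp

theorem pderiv_comm (a b : κ) (p : MvPolynomial κ k) :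
    pderiv a (pderiv b p) = pderiv b (pderiv a p) := by
  classical
  let D : κ → Derivation k (MvPolynomial κ k) (MvPolynomial κ k) := pderiv
  have h : ⁅D a, D b⁆ = 0 := by
    refine derivation_ext fun c => ?_
    simp only [D, Derivation.commutator_apply, pderiv_X]
    by_cases hb : b = c <;> by_cases ha : a = c <;> simp [hb, ha]
  have := DFunLike.congr_fun h p
  rwa [Derivation.commutator_apply, Derivation.zero_apply, sub_eq_zero] at this

variable {n : ℕ} (e : Fin n ⊕ Fin n → κ) (c : MvPolynomial κ k)

/-- The operators on the polynomial ring in commuting variables `x_i`, `ξ_i` by which the Weyl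
algebra acts: `x_i` by multiplication and `∂_i` by `ξ_i + c ∂/∂x_i`. The embedding `e` names the
variables `x_i` and `ξ_i` among those of the ring. The case `c = 1` is used for the Weyl algebra, and
`c = h²` for the homogenized one. -/
noncomputable def weylOp : Fin n ⊕ Fin n → Module.End k (MvPolynomial κ k)
  | Sum.inl i => LinearMap.mulLeft k (X (e (Sum.inl i)))
  | Sum.inr i => LinearMap.mulLeft k (X (e (Sum.inr i))) +
      LinearMap.mulLeft k c ∘ₗ (pderiv (e (Sum.inl i))).toLinearMap

theorem weylOp_inl (i : Fin n) (p : MvPolynomial κ k) :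
    weylOp e c (Sum.inl i) p = X (e (Sum.inl i)) * p := rfl

theorem weylOp_inr (i : Fin n) (p : MvPolynomial κ k) :
    weylOp e c (Sum.inr i) p = X (e (Sum.inr i)) * p + c * pderiv (e (Sum.inl i)) p := rfl

theorem weylOp_xx (i j : Fin n) : weylOp e c (Sum.inl i) * weylOp e c (Sum.inl j) =
    weylOp e c (Sum.inl j) * weylOp e c (Sum.inl i) := by
  refine LinearMap.ext fun p => ?_
  simp only [Module.End.mul_apply, weylOp_inl]
  ring

variable {e c}

theorem weylOp_dd (he : Function.Injective e) (hc : ∀ i, pderiv (e (Sum.inl i)) c = 0)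
    (i j : Fin n) : weylOp e c (Sum.inr i) * weylOp e c (Sum.inr j) =
    weylOp e c (Sum.inr j) * weylOp e c (Sum.inr i) := by
  refine LinearMap.ext fun p => ?_
  have h : ∀ i j : Fin n, pderiv (e (Sum.inl i)) (X (e (Sum.inr j)) : MvPolynomial κ k) = 0 :=
    fun i j => pderiv_X_of_ne fun h => by simpa using he h
  simp only [Module.End.mul_apply, weylOp_inr, map_add, Derivation.leibniz, hc, h, smul_eq_mul]
  rw [pderiv_comm]
  ring

theorem weylOp_dx (he : Function.Injective e) (i j : Fin n) :
    weylOp e c (Sum.inr i) * weylOp e c (Sum.inl j) -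
      weylOp e c (Sum.inl j) * weylOp e c (Sum.inr i) =
    if i = j then LinearMap.mulLeft k c else 0 := by
  refine LinearMap.ext fun p => ?_
  simp only [LinearMap.sub_apply, Module.End.mul_apply, weylOp_inr, weylOp_inl,
    Derivation.leibniz, smul_eq_mul]
  split_ifs with h
  · subst h
    rw [pderiv_X_self, LinearMap.mulLeft_apply]
    ring
  · rw [pderiv_X_of_ne fun h' => h (by simpa using (he h').symm), LinearMap.zero_apply]
    ring

/-- Normally ordered words applied to `1` are monomials, because no `∂/∂x_i` ever meets an
`x_i`. -/
theorem weylOp_word (he : Function.Injective e) (u v : List (Fin n)) :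
    ((u.map fun i => weylOp e c (Sum.inl i)).prod * (v.map fun i => weylOp e c (Sum.inr i)).prod)
      1 = monomial (wordExp (fun i => e (Sum.inl i)) u + wordExp (fun i => e (Sum.inr i)) v) 1 := by
  have hv : (v.map fun i => weylOp e c (Sum.inr i)).prod 1 =
      monomial (wordExp (fun i => e (Sum.inr i)) v) 1 := by
    induction v with
    | nil => simp [wordExp]
    | cons j v ih =>
      rw [List.map_cons, List.prod_cons, Module.End.mul_apply, ih, weylOp_inr, pderiv_monomial,
        wordExp_apply_of_ne _ _ fun i h => by simpa using he h]
      simp [wordExp, X, monomial_mul]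
  rw [Module.End.mul_apply, hv]
  induction u with
  | nil => simp [wordExp]
  | cons j u ih =>
    rw [List.map_cons, List.prod_cons, Module.End.mul_apply, ih, weylOp_inl]
    simp [wordExp, X, monomial_mul, add_assoc]

/-- Up to terms of lower weight, the operators are multiplications by the variables. -/
theorem weylOp_sub_mem {wt : κ → ℤ} (hwt : ∀ a, wt (e a) = 1)
    (hc : ∀ i p, p ∈ weightLE k wt i → c * p ∈ weightLE k wt i)
    (a : Fin n ⊕ Fin n) (i : ℤ) {p : MvPolynomial κ k} (hp : p ∈ weightLE k wt i) :
    weylOp e c a p - X (e a) * p ∈ weightLE k wt (i + wt (e a) - 1) := by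
  cases a with
  | inl j => simp [weylOp_inl]
  | inr j =>
    rw [weylOp_inr, add_sub_cancel_left, hwt, add_sub_cancel_right]
    exact hc i _ (pderiv_mem_weightLE _ (by rw [hwt]; omega) hp)

end Representation

section SymbolMaps

variable (k : Type u) [Field k] (n : ℕ)

/-- The action of the Weyl algebra on polynomials in `x` and `ξ`. -/
noncomputable def Weyl.rep : Weyl k n →ₐ[k] Module.End k (S k n) :=
  RingQuot.liftAlgHom k ⟨FreeAlgebra.lift k (weylOp id 1), by
    rintro _ _ (⟨i, j⟩ | ⟨i, j⟩ | ⟨i, j⟩)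
    · simpa using weylOp_xx id 1 i j
    · simpa using weylOp_dd (c := 1) Function.injective_id (by simp) i j
    · rw [map_sub, map_mul, map_mul, apply_ite (FreeAlgebra.lift k _), map_one, map_zero]
      simpa [Module.End.one_eq_id] using
        weylOp_dx (k := k) (c := 1) (Function.injective_id (α := Fin n ⊕ Fin n)) i j⟩

theorem Weyl.rep_gen (a : Fin n ⊕ Fin n) : Weyl.rep k n (Weyl.gen k n a) = weylOp id 1 a := by
  refine (RingQuot.liftAlgHom_mkAlgHom_apply k _ _ _).trans ?_
  simp

/-- The operators by which the generators of the homogenized Weyl algebra act on polynomials in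
`h`, `x` and `ξ`. -/
noncomputable def hweylOp : Option (Fin n ⊕ Fin n) → Module.End k (Sh k n)
  | none => LinearMap.mulLeft k (X none)
  | some a => weylOp some (X none ^ 2) a

/-- The action of the homogenized Weyl algebra on polynomials in `h`, `x` and `ξ`. -/
noncomputable def HWeyl.rep : HWeyl k n →ₐ[k] Module.End k (Sh k n) :=
  RingQuot.liftAlgHom k ⟨FreeAlgebra.lift k (hweylOp k n), by
    have hd : ∀ i : Fin n, pderiv (some (Sum.inl i)) (X none ^ 2 : Sh k n) = 0 := fun i => by
      rw [Derivation.leibniz_pow, pderiv_X_of_ne (by simp)]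
      simp
    rintro _ _ (⟨i, j⟩ | ⟨i, j⟩ | ⟨i, j⟩ | a)
    · simpa [hweylOp] using weylOp_xx some (X none ^ 2) i j
    · simpa [hweylOp] using weylOp_dd (Option.some_injective _) hd i j
    · rw [map_sub, map_mul, map_mul, apply_ite (FreeAlgebra.lift k _), map_pow, map_zero]
      simp only [FreeAlgebra.lift_ι_apply, hweylOp]
      refine (weylOp_dx (Option.some_injective _) i j).trans ?_
      rw [LinearMap.pow_mulLeft]
    · simp only [map_mul, FreeAlgebra.lift_ι_apply, hweylOp]
      refine LinearMap.ext fun p => ?_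
      rw [Module.End.mul_apply, Module.End.mul_apply]
      rcases a with i | i
      · simp only [weylOp_inl, LinearMap.mulLeft_apply]
        ring
      · simp only [weylOp_inr, LinearMap.mulLeft_apply, Derivation.leibniz]
        rw [pderiv_X_of_ne (by simp)]
        simp only [smul_eq_mul]
        ring⟩

theorem HWeyl.rep_gen (a : Option (Fin n ⊕ Fin n)) :
    HWeyl.rep k n (HWeyl.gen k n a) = hweylOp k n a := by
  refine (RingQuot.liftAlgHom_mkAlgHom_apply k _ _ _).trans ?_
  simp

theorem Weyl.rep_mon (j : List (Fin n) × List (Fin n)) :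
    Weyl.rep k n (Weyl.mon k n j) 1 = monomial (Weyl.ex n j) 1 := by
  rw [Weyl.mon, map_mul, map_list_prod, map_list_prod, List.map_map, List.map_map]
  simp only [Function.comp_def, Weyl.rep_gen]
  exact weylOp_word Function.injective_id _ _

theorem HWeyl.rep_mon (j : ℕ × List (Fin n) × List (Fin n)) :
    HWeyl.rep k n (HWeyl.mon k n j) 1 = monomial (HWeyl.ex n j) 1 := by
  rw [HWeyl.mon, map_mul, map_pow, map_mul, map_list_prod, map_list_prod, List.map_map,
    List.map_map]
  simp only [Function.comp_def, HWeyl.rep_gen]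
  rw [Module.End.mul_apply]
  refine (congrArg _ (weylOp_word (Option.some_injective _) _ _)).trans ?_
  rw [hweylOp, LinearMap.pow_mulLeft, LinearMap.mulLeft_apply, X_pow_eq_monomial, monomial_mul,
    one_mul]
  rfl

/-- The full symbol of a differential operator. -/
noncomputable def Weyl.symbolMap : SymbolMap (Weyl.filtr k n) where
  σ := LinearEquiv.ofBijective
    (LinearMap.applyₗ (1 : S k n) ∘ₗ (Weyl.rep k n).toLinearMap)
    (bijective_of_monomial _ (Weyl.mon k n) (Weyl.ex n) (Weyl.ex_surjective n) (Weyl.mon_eq k n)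
      (Weyl.span_mon k n) (Weyl.rep_mon k n))
  map_one := by simp
  mem_step i P := by
    change P ∈ Weyl.stepL k n i ↔ _
    rw [Weyl.stepL_eq]
    exact mem_span_iff_of_monomial _ _ _ (Weyl.ex_surjective n) (Weyl.rep_mon k n) _ P
  gen_mul a i P hP := by
    change P ∈ Weyl.stepL k n i at hP
    rw [Weyl.stepL_eq] at hP
    have := (mem_span_iff_of_monomial (LinearEquiv.ofBijective _ (bijective_of_monomial
      (LinearMap.applyₗ (1 : S k n) ∘ₗ (Weyl.rep k n).toLinearMap) (Weyl.mon k n) (Weyl.ex n)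
      (Weyl.ex_surjective n) (Weyl.mon_eq k n) (Weyl.span_mon k n) (Weyl.rep_mon k n)))
      _ _ (Weyl.ex_surjective n) (Weyl.rep_mon k n) _ P).1 hP
    have h := weylOp_sub_mem (e := id) (c := (1 : S k n)) (wt := fun _ => 1) (fun _ => rfl)
      (by simp) a i this
    simpa [Weyl.rep_gen] using h

theorem Weyl.symbolMap_mon (j : List (Fin n) × List (Fin n)) :
    (Weyl.symbolMap k n).σ (Weyl.mon k n j) = monomial (Weyl.ex n j) 1 :=
  Weyl.rep_mon k n j

/-- The full symbol of an element of the homogenized Weyl algebra. -/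
noncomputable def HWeyl.symbolMap : SymbolMap (HWeyl.filtr k n) where
  σ := LinearEquiv.ofBijective
    (LinearMap.applyₗ (1 : Sh k n) ∘ₗ (HWeyl.rep k n).toLinearMap)
    (bijective_of_monomial _ (HWeyl.mon k n) (HWeyl.ex n) (HWeyl.ex_surjective n)
      (HWeyl.mon_eq k n) (HWeyl.span_mon k n) (HWeyl.rep_mon k n))
  map_one := by simp
  mem_step i P := by
    change P ∈ HWeyl.stepL k n i ↔ _
    rw [HWeyl.stepL_eq]
    exact mem_span_iff_of_monomial _ _ _ (HWeyl.ex_surjective n) (HWeyl.rep_mon k n) _ P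
  gen_mul a i P hP := by
    change P ∈ HWeyl.stepL k n i at hP
    rw [HWeyl.stepL_eq] at hP
    have := (mem_span_iff_of_monomial (LinearEquiv.ofBijective _ (bijective_of_monomial
      (LinearMap.applyₗ (1 : Sh k n) ∘ₗ (HWeyl.rep k n).toLinearMap) (HWeyl.mon k n) (HWeyl.ex n)
      (HWeyl.ex_surjective n) (HWeyl.mon_eq k n) (HWeyl.span_mon k n) (HWeyl.rep_mon k n)))
      _ _ (HWeyl.ex_surjective n) (HWeyl.rep_mon k n) _ P).1 hP
    cases a with
    | none => simp [HWeyl.rep_gen, hweylOp]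
    | some a =>
      have h := weylOp_sub_mem (e := some) (c := (X none ^ 2 : Sh k n)) (wt := HWeyl.wt n)
        (fun _ => rfl) (fun i p hp => by
          rw [pow_two, mul_assoc]
          have := X_mul_mem_weightLE none (X_mul_mem_weightLE none hp)
          simpa [HWeyl.wt] using this) a i this
      simpa [HWeyl.rep_gen, hweylOp] using h

theorem HWeyl.symbolMap_mon (j : ℕ × List (Fin n) × List (Fin n)) :
    (HWeyl.symbolMap k n).σ (HWeyl.mon k n j) = monomial (HWeyl.ex n j) 1 :=
  HWeyl.rep_mon k n j

/-- The grading of the homogenized Weyl algebra corresponds to the standard grading under the full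
symbol. -/
theorem HWeyl.mem_grading_iff (d : ℤ) (P : HWeyl k n) :
    P ∈ HWeyl.grading k n d ↔
      (HWeyl.symbolMap k n).σ P ∈ polyGrading k (Option (Fin n ⊕ Fin n)) d := by
  rw [HWeyl.grading_eq, polyGrading_eq]
  rw [mem_span_iff_of_monomial (HWeyl.symbolMap k n).σ _ _ (HWeyl.ex_surjective n)
    (HWeyl.symbolMap_mon k n), mem_restrictSupport_iff]
  exact ⟨fun h α hα => h (by simpa using hα), fun h α hα => h (by simpa using hα)⟩

end SymbolMaps

end GradedBetti

/-! ### The grading of the homogenized Weyl algebra -/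

namespace GradedBetti

open MvPolynomial

section Words

variable {k : Type*} [Field k] {A : Type*} [Ring A] {ι : Type*} {gen : ι → A} {wt : ι → ℤ}
  {V : Type*} [AddCommGroup V] [Module k V] [Module A V]

theorem prod_map_smul_mem (T : ℤ → Submodule k V)
    (hT : ∀ a i, ∀ v ∈ T i, gen a • v ∈ T (i + wt a)) (w : List ι) (i : ℤ) (v : V)
    (hv : v ∈ T i) : (w.map gen).prod • v ∈ T (i + (w.map wt).sum) := by
  induction w with
  | nil => simpa using hv
  | cons a w ih =>
    rw [List.map_cons (f := gen), List.prod_cons, mul_smul, List.map_cons, List.sum_cons,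
      add_comm (wt a), ← add_assoc]
    exact hT a _ _ ih

end Words

section Weyl

variable {k : Type u} [Field k] {n : ℕ}

/-- The word of generators whose product is a normally ordered monomial. -/
def HWeyl.word (j : ℕ × List (Fin n) × List (Fin n)) : List (Option (Fin n ⊕ Fin n)) :=
  List.replicate j.1 none ++ (j.2.1.map (fun i => some (Sum.inl i)) ++
    j.2.2.map (fun i => some (Sum.inr i)))

theorem HWeyl.mon_eq_prod (j : ℕ × List (Fin n) × List (Fin n)) :
    HWeyl.mon k n j = ((HWeyl.word j).map (HWeyl.gen k n)).prod := by
  simp [HWeyl.mon, HWeyl.word, Function.comp_def]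

theorem Weyl.mon_eq_prod (j : List (Fin n) × List (Fin n)) :
    Weyl.mon k n j = ((j.1.map Sum.inl ++ j.2.map Sum.inr).map (Weyl.gen k n)).prod := by
  simp [Weyl.mon, Function.comp_def]

theorem HWeyl.sum_map_wt_word (j : ℕ × List (Fin n) × List (Fin n)) :
    ((HWeyl.word j).map (HWeyl.wt n)).sum = j.2.1.length + j.2.2.length := by
  simp [HWeyl.word, HWeyl.wt, Function.comp_def]

/-- A filtration is required to be compatible with the generators only; this extends to the whole
filtration of the algebra. -/
theorem Weyl.smul_mem {V : Type*} [AddCommGroup V] [Module k V] [Module (Weyl k n) V]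
    [IsScalarTower k (Weyl k n) V] (G : Filtr k (Weyl.gen k n) (fun _ => 1) V) {i j : ℤ}
    {P : Weyl k n} (hP : P ∈ (Weyl.filtr k n).step i) {v : V} (hv : v ∈ G.step j) :
    P • v ∈ G.step (i + j) := by
  change P ∈ Weyl.stepL k n i at hP
  rw [Weyl.stepL_eq] at hP
  induction hP using Submodule.span_induction with
  | mem P hP =>
    obtain ⟨w, hw, rfl⟩ := hP
    rw [Weyl.mon_eq_prod]
    refine G.mono ?_ (prod_map_smul_mem G.step G.smul_mem _ j v hv)
    simp only [Set.mem_preimage, Set.mem_ofPred_eq, Weyl.weight_ex] at hw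
    simp only [List.map_const', List.sum_replicate, List.length_append, List.length_map]
    simp
    omega
  | zero => simp
  | add P Q _ _ hP hQ => rw [add_smul]; exact add_mem hP hQ
  | smul c P _ hP => rw [smul_assoc]; exact Submodule.smul_mem _ _ hP

theorem HWeyl.smul_mem {V : Type*} [AddCommGroup V] [Module k V] [Module (HWeyl k n) V]
    [IsScalarTower k (HWeyl k n) V] (G : Filtr k (HWeyl.gen k n) (HWeyl.wt n) V) {i j : ℤ}
    {P : HWeyl k n} (hP : P ∈ (HWeyl.filtr k n).step i) {v : V} (hv : v ∈ G.step j) :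
    P • v ∈ G.step (i + j) := by
  change P ∈ HWeyl.stepL k n i at hP
  rw [HWeyl.stepL_eq] at hP
  induction hP using Submodule.span_induction with
  | mem P hP =>
    obtain ⟨w, hw, rfl⟩ := hP
    rw [HWeyl.mon_eq_prod]
    refine G.mono ?_ (prod_map_smul_mem G.step G.smul_mem _ j v hv)
    simp only [Set.mem_preimage, Set.mem_ofPred_eq, HWeyl.weight_ex] at hw
    rw [HWeyl.sum_map_wt_word]
    omega
  | zero => simp
  | add P Q _ _ hP hQ => rw [add_smul]; exact add_mem hP hQ
  | smul c P _ hP => rw [smul_assoc]; exact Submodule.smul_mem _ _ hP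

theorem Weyl.filtr_step_eq_bot {i : ℤ} (hi : i < 0) : (Weyl.filtr k n).step i = ⊥ := by
  change Weyl.stepL k n i = ⊥
  rw [Weyl.stepL, Submodule.span_eq_bot]
  rintro _ ⟨u, v, h, _⟩
  omega

theorem Weyl.free_step_eq_bot {r : ℕ} (m : Fin r → ℤ) :
    ∃ c, ((Weyl.filtr k n).free m).step c = ⊥ := by
  obtain ⟨c, hc⟩ := (Set.finite_range m).bddBelow
  refine ⟨c - 1, eq_bot_iff.2 fun v hv => ?_⟩
  funext l
  have h1 := hv l trivial
  have h2 : c ≤ m l := hc ⟨l, rfl⟩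
  have h3 : (Weyl.filtr k n).step (c - 1 - m l) = ⊥ := Weyl.filtr_step_eq_bot (by omega)
  change v l ∈ (Weyl.filtr k n).step (c - 1 - m l) at h1
  rw [h3] at h1
  exact h1

theorem HWeyl.iSupIndep_grading : iSupIndep (HWeyl.grading k n) := by
  have h := iSupIndep_comap_of_injective (iSupIndep_polyGrading (k := k))
    (HWeyl.symbolMap k n).σ.toLinearMap (HWeyl.symbolMap k n).σ.injective
  refine (congrArg iSupIndep (funext fun d => ?_)).mp h
  ext P
  exact (HWeyl.mem_grading_iff k n d P).symm

theorem HWeyl.mon_mem_grading (j : ℕ × List (Fin n) × List (Fin n)) :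
    HWeyl.mon k n j ∈ HWeyl.grading k n (j.1 + j.2.1.length + j.2.2.length) :=
  Submodule.subset_span ⟨j.1, j.2.1, j.2.2, rfl, rfl⟩

theorem HWeyl.iSup_grading : ⨆ d, HWeyl.grading k n d = ⊤ := by
  rw [eq_top_iff, ← HWeyl.span_mon, Submodule.span_le]
  rintro _ ⟨j, rfl⟩
  exact Submodule.mem_iSup_of_mem _ (HWeyl.mon_mem_grading j)

theorem HWeyl.stepL_le_iSup (i : ℤ) :
    HWeyl.stepL k n i ≤ ⨆ d, HWeyl.grading k n d ⊓ HWeyl.stepL k n i := by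
  conv_lhs => rw [HWeyl.stepL]
  refine Submodule.span_le.2 ?_
  rintro _ ⟨l, u, v, h, rfl⟩
  exact Submodule.mem_iSup_of_mem _
    ⟨HWeyl.mon_mem_grading (l, u, v), Submodule.subset_span ⟨l, u, v, h, rfl⟩⟩

theorem HWeyl.grading_le_stepL (d : ℤ) : HWeyl.grading k n d ≤ HWeyl.stepL k n d := by
  refine Submodule.span_mono ?_
  rintro _ ⟨l, u, v, h, rfl⟩
  exact ⟨l, u, v, by omega, rfl⟩

theorem HWeyl.one_mem_grading : (1 : HWeyl k n) ∈ HWeyl.grading k n 0 :=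
  Submodule.subset_span ⟨0, [], [], by simp, by simp⟩

theorem HWeyl.symbolMap_gen_mul (a : Option (Fin n ⊕ Fin n)) (P : HWeyl k n) :
    (HWeyl.symbolMap k n).σ (HWeyl.gen k n a * P) =
      hweylOp k n a ((HWeyl.symbolMap k n).σ P) := by
  change HWeyl.rep k n (HWeyl.gen k n a * P) 1 = hweylOp k n a (HWeyl.rep k n P 1)
  rw [map_mul, HWeyl.rep_gen]
  rfl

theorem HWeyl.gen_mul_mem_grading (a : Option (Fin n ⊕ Fin n)) (d : ℤ) (P : HWeyl k n)
    (hP : P ∈ HWeyl.grading k n d) : HWeyl.gen k n a * P ∈ HWeyl.grading k n (d + 1) := by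
  rw [HWeyl.mem_grading_iff, polyGrading_eq, mem_weightedHomogeneousSubmodule] at hP ⊢
  rw [HWeyl.symbolMap_gen_mul]
  have hX : ∀ a : Option (Fin n ⊕ Fin n),
      (X a * (HWeyl.symbolMap k n).σ P).IsWeightedHomogeneous (fun _ => (1 : ℤ)) (d + 1) :=
    fun a => by
      rw [add_comm]
      exact (isWeightedHomogeneous_X k _ a).mul hP
  rcases a with _ | i | i
  · exact hX none
  · exact hX _
  · rw [hweylOp, weylOp_inr]
    refine (hX _).add ?_
    have h1 := hP.pderiv (n' := d - 1) (i := some (Sum.inl i)) (by ring)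
    have h2 := ((isWeightedHomogeneous_X k (fun _ => (1 : ℤ))
      (none : Option (Fin n ⊕ Fin n))).pow 2).mul h1
    rwa [show (2 : ℕ) • (1 : ℤ) + (d - 1) = d + 1 by simp; ring] at h2

theorem HWeyl.mul_mem_grading (i j : ℤ) (P : HWeyl k n) (hP : P ∈ HWeyl.grading k n i)
    (Q : HWeyl k n) (hQ : Q ∈ HWeyl.grading k n j) : P * Q ∈ HWeyl.grading k n (i + j) := by
  rw [HWeyl.grading_eq] at hP
  induction hP using Submodule.span_induction with
  | mem P hP =>
    obtain ⟨w, hw, rfl⟩ := hP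
    rw [HWeyl.mon_eq_prod]
    have := prod_map_smul_mem (gen := HWeyl.gen k n) (wt := fun _ => 1) (HWeyl.grading k n)
      HWeyl.gen_mul_mem_grading (HWeyl.word w) j Q hQ
    rw [Set.mem_preimage, Set.mem_ofPred_eq, HWeyl.weight_one_ex] at hw
    rw [← hw, add_comm]
    simpa [HWeyl.word, List.map_const', List.sum_replicate, -List.map_append, add_assoc] using this
  | zero => simp
  | add P Q _ _ hP hQ => rw [add_mul]; exact add_mem hP hQ
  | smul c P _ hP => rw [smul_mul_assoc]; exact Submodule.smul_mem _ _ hP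

/-- The augmentation of the homogenized Weyl algebra, which sends all generators to zero. -/
noncomputable def HWeyl.aug (k : Type u) [Field k] (n : ℕ) : HWeyl k n →ₐ[k] k :=
  RingQuot.liftAlgHom k ⟨FreeAlgebra.lift k fun _ => 0, by
    rintro _ _ (⟨i, j⟩ | ⟨i, j⟩ | ⟨i, j⟩ | a)
    · simp
    · simp
    · rw [map_sub, map_mul, map_mul, apply_ite (FreeAlgebra.lift k _)]
      simp
    · simp⟩

theorem HWeyl.aug_gen (a : Option (Fin n ⊕ Fin n)) : HWeyl.aug k n (HWeyl.gen k n a) = 0 := by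
  refine (RingQuot.liftAlgHom_mkAlgHom_apply k _ _ _).trans ?_
  simp

theorem HWeyl.aug_eq_zero (d : ℤ) (hd : d ≠ 0) (P : HWeyl k n) (hP : P ∈ HWeyl.grading k n d) :
    (HWeyl.aug k n : HWeyl k n →+* k) P = 0 := by
  change HWeyl.aug k n P = 0
  induction hP using Submodule.span_induction with
  | mem P hP =>
    obtain ⟨l, u, v, h, rfl⟩ := hP
    rw [map_mul, map_pow, map_mul, map_list_prod, map_list_prod, List.map_map, List.map_map]
    simp only [Function.comp_def, HWeyl.aug_gen, List.map_const', List.prod_replicate]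
    rw [← pow_add, ← pow_add]
    exact zero_pow (by omega)
  | zero => simp
  | add P Q _ _ hP hQ => rw [map_add, hP, hQ, add_zero]
  | smul c P _ hP => rw [map_smul, hP, smul_zero]

theorem SymbolMap.σ_algebraMap {A ι : Type*} [Ring A] [Algebra k A] {gen : ι → A} {wt : ι → ℤ}
    {F : Filtr k gen wt A} (N : SymbolMap F) (c : k) : N.σ (algebraMap k A c) = C c := by
  rw [Algebra.algebraMap_eq_smul_one, map_smul, N.map_one, MvPolynomial.smul_eq_C_mul, mul_one]

/-- The elements of degree zero are the scalars. -/
theorem HWeyl.eq_algebraMap_of_mem_grading {P : HWeyl k n} (hP : P ∈ HWeyl.grading k n 0) :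
    ∃ c, P = algebraMap k (HWeyl k n) c := by
  rw [HWeyl.mem_grading_iff] at hP
  refine ⟨constantCoeff ((HWeyl.symbolMap k n).σ P), (HWeyl.symbolMap k n).σ.injective ?_⟩
  rw [SymbolMap.σ_algebraMap]
  exact eq_C_of_mem_polyGrading hP

theorem HWeyl.eq_zero_of_mem_grading {d : ℤ} (hd : d < 0) {P : HWeyl k n}
    (hP : P ∈ HWeyl.grading k n d) : P = 0 := by
  rw [HWeyl.mem_grading_iff, polyGrading, if_neg (by omega), Submodule.mem_bot] at hP
  simpa using hP

/-! ### Dehomogenization -/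

theorem dehom_gen (a : Option (Fin n ⊕ Fin n)) :
    dehom k n (HWeyl.gen k n a) = a.elim 1 (Weyl.gen k n) := by
  refine (RingQuot.liftAlgHom_mkAlgHom_apply k _ _ _).trans ?_
  simp

theorem dehom_mon (j : ℕ × List (Fin n) × List (Fin n)) :
    dehom k n (HWeyl.mon k n j) = Weyl.mon k n j.2 := by
  rw [HWeyl.mon, map_mul, map_pow, map_mul, map_list_prod, map_list_prod, List.map_map,
    List.map_map]
  simp [Function.comp_def, dehom_gen, Weyl.mon]

theorem HWeyl.ex_eq (j : ℕ × List (Fin n) × List (Fin n)) :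
    HWeyl.ex n j = Finsupp.single none j.1 + (Weyl.ex n j.2).mapDomain some := by
  have h : ∀ (c : Fin n → Fin n ⊕ Fin n) (u : List (Fin n)),
      (wordExp c u).mapDomain some = wordExp (fun i => some (c i)) u := by
    intro c u
    induction u with
    | nil => simp [wordExp]
    | cons i u ih =>
      have : wordExp c (i :: u) = Finsupp.single (c i) 1 + wordExp c u := by simp [wordExp]
      rw [this, Finsupp.mapDomain_add, ih, Finsupp.mapDomain_single]
      simp [wordExp]
  rw [HWeyl.ex, Weyl.ex, Finsupp.mapDomain_add, h, h]

/-- The homogenization of polynomials to degree `d`; monomials of degree larger than `d` are not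
multiplied by a power of `h`. -/
noncomputable def homogenizePoly (k : Type u) [Field k] (n : ℕ) (d : ℤ) : S k n →ₗ[k] Sh k n :=
  (basisMonomials (Fin n ⊕ Fin n) k).constr ℕ fun α =>
    monomial (Finsupp.single none (d - Finsupp.weight (fun _ => (1 : ℤ)) α).toNat +
      α.mapDomain some) 1

theorem homogenizePoly_monomial (d : ℤ) (α : (Fin n ⊕ Fin n) →₀ ℕ) :
    homogenizePoly k n d (monomial α 1) =
      monomial (Finsupp.single none (d - Finsupp.weight (fun _ => (1 : ℤ)) α).toNat +
        α.mapDomain some) 1 := by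
  have := (basisMonomials (Fin n ⊕ Fin n) k).constr_basis ℕ (fun α =>
    (monomial (Finsupp.single none (d - Finsupp.weight (fun _ => (1 : ℤ)) α).toNat +
      α.mapDomain some) 1 : Sh k n)) α
  rwa [coe_basisMonomials] at this

theorem homogenizePoly_dehom {d : ℤ} {P : HWeyl k n} (hP : P ∈ HWeyl.grading k n d) :
    homogenizePoly k n d ((Weyl.symbolMap k n).σ (dehom k n P)) = (HWeyl.symbolMap k n).σ P := by
  rw [HWeyl.grading_eq] at hP
  induction hP using Submodule.span_induction with
  | mem P hP =>
    obtain ⟨j, hj, rfl⟩ := hP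
    rw [Set.mem_preimage, Set.mem_ofPred_eq, HWeyl.weight_one_ex] at hj
    rw [dehom_mon, Weyl.symbolMap_mon, homogenizePoly_monomial, HWeyl.symbolMap_mon, HWeyl.ex_eq,
      Weyl.weight_ex]
    congr
    omega
  | zero => simp
  | add P Q _ _ hP hQ => simp only [map_add, hP, hQ]
  | smul c P _ hP => simp only [map_smul, hP]

/-- A homogeneous element is determined by its degree and its dehomogenization. -/
theorem dehom_injOn {d : ℤ} {P : HWeyl k n} (hP : P ∈ HWeyl.grading k n d)
    (h : dehom k n P = 0) : P = 0 := by
  have := homogenizePoly_dehom hP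
  rw [h, map_zero, map_zero] at this
  simpa using this.symm

/-- The elements of degree `d` dehomogenize to the elements of `L_d D`. -/
theorem map_dehom_grading (d : ℤ) :
    (HWeyl.grading k n d).map (dehom k n).toLinearMap = (Weyl.filtr k n).step d := by
  change _ = Weyl.stepL k n d
  rw [HWeyl.grading_eq, Weyl.stepL_eq, Submodule.map_span, ← Set.image_comp]
  congr 1
  ext P
  constructor
  · rintro ⟨j, hj, rfl⟩
    rw [Set.mem_preimage, Set.mem_ofPred_eq, HWeyl.weight_one_ex] at hj
    refine ⟨j.2, ?_, (dehom_mon j).symm⟩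
    rw [Set.mem_preimage, Set.mem_ofPred_eq, Weyl.weight_ex]
    omega
  · rintro ⟨j, hj, rfl⟩
    rw [Set.mem_preimage, Set.mem_ofPred_eq, Weyl.weight_ex] at hj
    refine ⟨((d - (j.1.length + j.2.length)).toNat, j), ?_, dehom_mon _⟩
    rw [Set.mem_preimage, Set.mem_ofPred_eq, HWeyl.weight_one_ex]
    dsimp only
    omega

theorem dehom_mem {d : ℤ} {P : HWeyl k n} (hP : P ∈ HWeyl.grading k n d) :
    dehom k n P ∈ (Weyl.filtr k n).step d :=
  map_dehom_grading (k := k) (n := n) d ▸ ⟨P, hP, rfl⟩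

theorem exists_dehom_eq {d : ℤ} {P : Weyl k n} (hP : P ∈ (Weyl.filtr k n).step d) :
    ∃ Q ∈ HWeyl.grading k n d, dehom k n Q = P := by
  rw [← map_dehom_grading] at hP
  exact hP

theorem dehom_surjective : Function.Surjective (dehom k n) := fun P => by
  obtain ⟨i, hi⟩ := (Weyl.symbolMap k n).exists_mem_step P
  obtain ⟨Q, _, hQ⟩ := exists_dehom_eq hi
  exact ⟨Q, hQ⟩

/-- Every element is congruent modulo `h - 1` to a homogeneous element, of any large degree. -/
theorem HWeyl.exists_sub_eq_mul (P : HWeyl k n) : ∃ M : ℤ, ∀ d ≥ M, ∃ P' ∈ HWeyl.grading k n d,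
    ∃ Q, P - P' = (HWeyl.gen k n none - 1) * Q := by
  have hP : P ∈ Submodule.span k (Set.range (HWeyl.mon k n)) := by
    rw [HWeyl.span_mon]; trivial
  induction hP using Submodule.span_induction with
  | mem P hP =>
    obtain ⟨j, rfl⟩ := hP
    refine ⟨j.1 + j.2.1.length + j.2.2.length, fun d hd => ?_⟩
    obtain ⟨e, rfl⟩ := Int.le.dest hd
    refine ⟨HWeyl.gen k n none ^ e * HWeyl.mon k n j, ?_,
      -(∑ i ∈ Finset.range e, HWeyl.gen k n none ^ i) * HWeyl.mon k n j, ?_⟩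
    · have : HWeyl.gen k n none ^ e * HWeyl.mon k n j = HWeyl.mon k n (j.1 + e, j.2) := by
        rw [HWeyl.mon, HWeyl.mon, add_comm j.1, pow_add, mul_assoc]
      rw [this]
      convert HWeyl.mon_mem_grading (k := k) (j.1 + e, j.2) using 2
      push_cast
      ring
    · rw [← mul_assoc, mul_neg, mul_geom_sum]
      noncomm_ring
  | zero => exact ⟨0, fun d _ => ⟨0, zero_mem _, 0, by simp⟩⟩
  | add P Q _ _ hP hQ =>
    obtain ⟨M, hM⟩ := hP
    obtain ⟨M', hM'⟩ := hQ
    refine ⟨max M M', fun d hd => ?_⟩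
    obtain ⟨P', hP', R, hR⟩ := hM d (le_of_max_le_left hd)
    obtain ⟨Q', hQ', R', hR'⟩ := hM' d (le_of_max_le_right hd)
    exact ⟨P' + Q', add_mem hP' hQ', R + R', by rw [mul_add, ← hR, ← hR']; abel⟩
  | smul c P _ hP =>
    obtain ⟨M, hM⟩ := hP
    refine ⟨M, fun d hd => ?_⟩
    obtain ⟨P', hP', R, hR⟩ := hM d hd
    exact ⟨c • P', Submodule.smul_mem _ _ hP', c • R, by rw [mul_smul_comm, ← hR, smul_sub]⟩

/-- The kernel of the dehomogenization is generated by `h - 1`, since modulo `h - 1` all elements are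
homogeneous. -/
theorem dehom_eq_zero_iff (P : HWeyl k n) :
    dehom k n P = 0 ↔ ∃ Q, P = (HWeyl.gen k n none - 1) * Q := by
  constructor
  · intro h
    obtain ⟨M, hM⟩ := HWeyl.exists_sub_eq_mul P
    obtain ⟨P', hP', Q, hQ⟩ := hM M le_rfl
    have h2 := congrArg (dehom k n) hQ
    rw [map_sub, map_mul, map_sub, dehom_gen, map_one, h, Option.elim_none, sub_self, zero_mul,
      zero_sub, neg_eq_zero] at h2
    exact ⟨Q, by rw [← hQ, dehom_injOn hP' h2, sub_zero]⟩
  · rintro ⟨Q, rfl⟩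
    rw [map_mul, map_sub, dehom_gen, map_one, Option.elim_none, sub_self, zero_mul]

/-- The leading form, for the weight with `h` of weight zero, of a homogeneous element does not
involve `h`: it is the leading form of the dehomogenization. -/
theorem leading_form_eq {d : ℤ} {P : HWeyl k n} (hP : P ∈ HWeyl.grading k n d) :
    weightedHomogeneousComponent (HWeyl.wt n) d ((HWeyl.symbolMap k n).σ P) =
      algebraMap (S k n) (Sh k n) (weightedHomogeneousComponent (fun _ => (1 : ℤ)) d
        ((Weyl.symbolMap k n).σ (dehom k n P))) := by
  classical
  change _ = rename some _
  rw [HWeyl.grading_eq] at hP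
  induction hP using Submodule.span_induction with
  | mem P hP =>
    obtain ⟨j, hj, rfl⟩ := hP
    rw [Set.mem_preimage, Set.mem_ofPred_eq, HWeyl.weight_one_ex] at hj
    rw [dehom_mon, Weyl.symbolMap_mon, HWeyl.symbolMap_mon,
      weightedHomogeneousComponent_of_mem (isWeightedHomogeneous_monomial _ _ _ rfl),
      weightedHomogeneousComponent_of_mem (isWeightedHomogeneous_monomial _ _ _ rfl),
      HWeyl.weight_ex, Weyl.weight_ex]
    split_ifs with h
    · have h0 : j.1 = 0 := by omega
      rw [rename_monomial, HWeyl.ex_eq, h0, Finsupp.single_zero, zero_add]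
    · rw [map_zero]
  | zero => simp
  | add P Q _ _ hP hQ => simp only [map_add, hP, hQ]
  | smul c P _ hP => simp only [map_smul, hP]

end Weyl

end GradedBetti

/-! ### Existence of filtered free resolutions -/

namespace GradedBetti

open MvPolynomial

section Existence

variable {k : Type u} [Field k] {n : ℕ}

theorem Weyl.leading_mem {r : ℕ} (m : Fin r → ℤ) (j : ℤ) (u : Fin r → Weyl k n) (l : Fin r) :
    (Weyl.symbolMap k n).leading m j u l ∈ polyGrading k (Fin n ⊕ Fin n) (j - m l) := by
  rw [polyGrading_eq]
  exact weightedHomogeneousComponent_mem _ _ _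

/-- A finitely generated module with a graded generating family has a smallest one: a finite set of
homogeneous generators none of which is redundant. -/
theorem exists_minimal_generators {R N : Type*} [Ring R] [AddCommGroup N] [Module R N]
    [Module.Finite R N] (T : Set N) (hT : Submodule.span R T = ⊤) :
    ∃ (r : ℕ) (z : Fin r → N), (∀ l, z l ∈ T) ∧ Submodule.span R (Set.range z) = ⊤ ∧
      ∀ l, z l ∉ Submodule.span R (z '' {l}ᶜ) := by
  classical
  have hex : ∃ r, ∃ s : Finset N, s.card = r ∧ (s : Set N) ⊆ T ∧ Submodule.span R (s : Set N) = ⊤ := by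
    obtain ⟨s, hs, e⟩ := (Submodule.fg_span_iff_fg_span_finset_subset T).1
      (hT ▸ Module.Finite.fg_top)
    exact ⟨_, s, rfl, hs, by rw [← e, hT]⟩
  obtain ⟨s, hs, hsT, hspan⟩ := Nat.find_spec hex
  refine ⟨s.card, fun l => (s.equivFin.symm l : N), fun l => hsT (s.equivFin.symm l).2, ?_, ?_⟩
  · have : Set.range (fun l => (s.equivFin.symm l : N)) = s := by
      rw [Set.range_comp' Subtype.val, Equiv.range_eq_univ, Set.image_univ, Subtype.range_coe]
    rw [this, hspan]
  · intro l hl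
    set x := s.equivFin.symm l with hx
    have hlt : (s.erase x).card < Nat.find hex := by
      rw [← hs]
      exact Finset.card_erase_lt_of_mem x.2
    refine Nat.find_min hex hlt ⟨s.erase x, rfl, ?_, ?_⟩
    · exact fun y hy => hsT (Finset.mem_of_mem_erase hy)
    · have h1 : Submodule.span R ((fun l => (s.equivFin.symm l : N)) '' {l}ᶜ) ≤
          Submodule.span R (s.erase x : Set N) := by
        refine Submodule.span_mono ?_
        rintro _ ⟨l', hl', rfl⟩
        refine Finset.mem_erase.2 ⟨fun h => hl' ?_, (s.equivFin.symm l').2⟩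
        exact s.equivFin.symm.injective (Subtype.ext h)
      rw [eq_top_iff, ← hspan, Submodule.span_le]
      intro y hy
      by_cases hyx : y = x
      · rw [hyx]
        exact h1 hl
      · exact Submodule.subset_span (Finset.mem_erase.2 ⟨hyx, hy⟩)

variable {V : Type u} [AddCommGroup V] [Module k V] [Module (Weyl k n) V]
  [IsScalarTower k (Weyl k n) V]

theorem map_mem_step {r : ℕ} {m : Fin r → ℤ} (G : Filtr k (Weyl.gen k n) (fun _ => 1) V)
    (φ : (Fin r → Weyl k n) →ₗ[Weyl k n] V) (hφ : ∀ l, φ (Pi.single l 1) ∈ G.step (m l)) (j : ℤ)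
    (u : Fin r → Weyl k n) (hu : u ∈ ((Weyl.filtr k n).free m).step j) : φ u ∈ G.step j := by
  have : φ u = ∑ l, u l • φ (Pi.single l 1) := by
    conv_lhs => rw [← Finset.univ_sum_single u]
    rw [map_sum]
    refine Finset.sum_congr rfl fun l _ => ?_
    rw [← map_smul, ← Pi.single_smul, smul_eq_mul, mul_one]
  rw [this]
  refine Submodule.sum_mem _ fun l _ => ?_
  have := Weyl.smul_mem G (hu l trivial) (hφ l)
  rwa [sub_add_cancel] at this

/-- Minimal homogeneous generators of `gr V` lift to a strict surjection from a filtered free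
module, whose kernel consists of vectors with leading forms in the irrelevant ideal. -/
theorem exists_minimal_cover (G : Filtr k (Weyl.gen k n) (fun _ => 1) V)
    [Module.Finite (S k n) (Gr G)] {c : ℤ} (hc : G.step c = ⊥) :
    ∃ (r : ℕ) (m : Fin r → ℤ) (φ : (Fin r → Weyl k n) →ₗ[Weyl k n] V),
      (∀ j, ∀ u ∈ ((Weyl.filtr k n).free m).step j, φ u ∈ G.step j) ∧
      (∀ j, ∀ w ∈ G.step j, ∃ u ∈ ((Weyl.filtr k n).free m).step j, φ u = w) ∧
      ∀ j, ∀ u ∈ ((Weyl.filtr k n).free m).step j, φ u ∈ G.step (j - 1) →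
        ∀ l, constantCoeff ((Weyl.symbolMap k n).leading m j u l) = 0 := by
  have hT : Submodule.span (S k n) {z | ∃ i v, z = Gr.symb G i v} = ⊤ := by
    rw [← Submodule.restrictScalars_eq_top_iff (S := k), eq_top_iff, ← Gr.iSup_grading G]
    refine iSup_le fun i => ?_
    rintro _ ⟨v, rfl⟩
    exact Submodule.subset_span ⟨i, v, rfl⟩
  obtain ⟨r, z, hz, hspan, hmin⟩ := exists_minimal_generators _ hT
  choose m v hv using hz
  let φ : (Fin r → Weyl k n) →ₗ[Weyl k n] V :=
    (Pi.basisFun (Weyl k n) (Fin r)).constr ℕ fun l => (v l : V)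
  have hφ : ∀ l, φ (Pi.single l 1) = v l := fun l => by
    rw [← Pi.basisFun_apply]
    exact Module.Basis.constr_basis _ _ _ _
  have hφG := map_mem_step G φ (m := m) fun l => by rw [hφ]; exact (v l).2
  have hbasis : ∀ l, Gr.map _ G φ hφG ((Weyl.symbolMap k n).grBasis m l) = z l := by
    intro l
    rw [SymbolMap.grBasis_apply _ m l ((Weyl.symbolMap k n).single_mem m l), Gr.map_symb, hv]
    exact Gr.symb_congr G rfl _ _ (hφ l)
  refine ⟨r, m, φ, hφG, ?_, ?_⟩
  · refine Gr.exists_eq_of_surjective (hf := hφG) ?_ hc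
    rw [← LinearMap.range_eq_top, eq_top_iff, ← hspan, Submodule.span_le]
    rintro _ ⟨l, rfl⟩
    exact ⟨_, hbasis l⟩
  · intro j u hu hφu l
    by_contra h0
    apply hmin l
    -- The relation between the generators that is given by the leading forms of `u`.
    have hrel := congrArg (Gr.map _ G φ hφG) ((Weyl.symbolMap k n).symb_eq_sum m j ⟨u, hu⟩)
    rw [Gr.map_symb, Gr.symb_eq_zero G hφu, map_sum] at hrel
    simp only [map_smul, hbasis] at hrel
    have hlead := Weyl.leading_mem m j u l
    have hdeg : j - m l = 0 := by
      by_contra h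
      exact h0 (constantCoeff_eq_zero_of_mem_polyGrading _ h _ hlead)
    rw [hdeg] at hlead
    rw [← Finset.add_sum_erase _ _ (Finset.mem_univ l), eq_comm, add_eq_zero_iff_eq_neg,
      eq_C_of_mem_polyGrading hlead] at hrel
    have h1 : (C (constantCoeff ((Weyl.symbolMap k n).leading m j u l)) : S k n) • z l ∈
        Submodule.span (S k n) (z '' {l}ᶜ) := by
      rw [hrel]
      refine neg_mem (Submodule.sum_mem _ fun l' hl' => Submodule.smul_mem _ _
        (Submodule.subset_span ⟨l', ?_, rfl⟩))
      simpa using hl'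
    have h2 := Submodule.smul_mem _
      (C (constantCoeff ((Weyl.symbolMap k n).leading m j u l))⁻¹ : S k n) h1
    rwa [smul_smul, ← C_mul, inv_mul_cancel₀ h0, C_1, one_smul] at h2

variable (k n) in
/-- A syzygy module of a filtered free resolution: a submodule of a filtered free module all of
whose elements have leading forms without constant coefficients. -/
structure Syzygy where
  /-- The rank of the free module. -/
  r : ℕ
  /-- The shifts of the free module. -/
  m : Fin r → ℤ
  /-- The submodule. -/
  K : Submodule (Weyl k n) (Fin r → Weyl k n)
  minimal : ∀ j, ∀ u ∈ ((Weyl.filtr k n).free m).step j, u ∈ K →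
    ∀ l, constantCoeff ((Weyl.symbolMap k n).leading m j u l) = 0

/-- Every syzygy module is covered strictly by a filtered free module whose relations form a syzygy
module again. -/
theorem Syzygy.exists_next (s : Syzygy k n) : ∃ (t : Syzygy k n)
    (φ : (Fin t.r → Weyl k n) →ₗ[Weyl k n] (Fin s.r → Weyl k n)),
    LinearMap.range φ = s.K ∧ LinearMap.ker φ = t.K ∧
    (∀ j, ∀ u ∈ ((Weyl.filtr k n).free t.m).step j, φ u ∈ ((Weyl.filtr k n).free s.m).step j) ∧
    ∀ j, ∀ w ∈ ((Weyl.filtr k n).free s.m).step j, w ∈ s.K →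
      ∃ u ∈ ((Weyl.filtr k n).free t.m).step j, φ u = w := by
  let G := ((Weyl.filtr k n).free s.m).comap s.K.subtype
  have hinj := Gr.map_injective G ((Weyl.filtr k n).free s.m) s.K.subtype (fun _ _ h => h)
    fun _ _ _ h => h
  have := (Weyl.symbolMap k n).gr_free_finite s.m
  have : Module.Finite (S k n) (Gr G) := Module.Finite.of_injective _ hinj
  obtain ⟨c, hc⟩ := Weyl.free_step_eq_bot (k := k) (n := n) s.m
  have hcG : G.step c = ⊥ := by
    refine eq_bot_iff.2 fun v hv => ?_
    have : (v : Fin s.r → Weyl k n) ∈ ((Weyl.filtr k n).free s.m).step c := hv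
    rw [hc] at this
    exact Subtype.ext this
  obtain ⟨r, m, φ, hφ, hstrict, hmin⟩ := exists_minimal_cover G hcG
  refine ⟨⟨r, m, LinearMap.ker φ, fun j u hu hu0 => hmin j u hu ?_⟩, s.K.subtype ∘ₗ φ, ?_, ?_,
    hφ, ?_⟩
  · rw [LinearMap.mem_ker.1 hu0]
    exact zero_mem _
  · rw [LinearMap.range_comp, LinearMap.range_eq_top.2, Submodule.map_top, Submodule.range_subtype]
    intro w
    obtain ⟨j, hj⟩ := (Weyl.symbolMap k n).exists_mem_free_step s.m (w : Fin s.r → Weyl k n)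
    obtain ⟨u, _, hu⟩ := hstrict j w hj
    exact ⟨u, hu⟩
  · rw [LinearMap.ker_comp, Submodule.ker_subtype, Submodule.comap_bot]
  · intro j w hw hwK
    obtain ⟨u, hu, e⟩ := hstrict j ⟨w, hwK⟩ hw
    exact ⟨u, hu, congrArg Subtype.val e⟩

theorem Weyl.grading_free_eq_iSup {r : ℕ} (m : Fin r → ℤ) (j : ℤ) :
    Gr.grading ((Weyl.filtr k n).free m) j = ⨆ l, (polyGrading k (Fin n ⊕ Fin n) (j - m l)).map
      ((LinearMap.toSpanSingleton (S k n) (Gr ((Weyl.filtr k n).free m))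
        ((Weyl.symbolMap k n).grBasis m l)).restrictScalars k) := by
  rw [iSup_map_toSpanSingleton_eq]
  ext z
  rw [SymbolMap.mem_grading_free_iff (Weyl.symbolMap k n), Submodule.mem_comap, ← funext polyGrading_eq,
    ← SymbolMap.grBasis_equivFun]
  rfl

/-- The associated graded map is minimal if the leading forms of the values have no constant
coefficients. -/
theorem Weyl.range_gr_map_le {r s : ℕ} {m : Fin r → ℤ} {m' : Fin s → ℤ}
    (φ : (Fin r → Weyl k n) →ₗ[Weyl k n] (Fin s → Weyl k n))
    (hφ : ∀ j, ∀ u ∈ ((Weyl.filtr k n).free m).step j, φ u ∈ ((Weyl.filtr k n).free m').step j)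
    (h : ∀ j, ∀ u ∈ ((Weyl.filtr k n).free m).step j, ∀ l,
      constantCoeff ((Weyl.symbolMap k n).leading m' j (φ u) l) = 0) :
    LinearMap.range (Gr.map _ _ φ hφ) ≤ irrelevant (polyGrading k (Fin n ⊕ Fin n)) • ⊤ := by
  have key : ⊤ ≤ ((irrelevant (polyGrading k (Fin n ⊕ Fin n)) •
      (⊤ : Submodule (S k n) (Gr ((Weyl.filtr k n).free m')))).restrictScalars k).comap
        ((Gr.map _ _ φ hφ).restrictScalars k) := by
    rw [← Gr.iSup_grading ((Weyl.filtr k n).free m)]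
    refine iSup_le fun j => ?_
    rintro _ ⟨u, rfl⟩
    rw [Submodule.mem_comap, LinearMap.restrictScalars_apply, Submodule.restrictScalars_mem, Gr.map_symb,
      (Weyl.symbolMap k n).symb_eq_sum]
    refine Submodule.sum_mem _ fun l _ => Submodule.smul_mem_smul ?_ Submodule.mem_top
    exact mem_irrelevant_of_mem_polyGrading (Weyl.leading_mem m' j (φ u) l) (h j u u.2 l)
  rintro _ ⟨z, rfl⟩
  exact key (Submodule.mem_top (x := z))

/-- Minimal covers of the successive syzygy modules form a filtered free resolution. The covering is
started with the filtration of the module that comes from an arbitrary finite generating set. -/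
theorem nonempty_filteredFreeResolution [Module.Finite (Weyl k n) V] :
    Nonempty (FilteredFreeResolution k n V) := by
  obtain ⟨t, π, hπ⟩ := Module.Finite.exists_fin' (Weyl k n) V
  let G := ((Weyl.filtr k n).free (0 : Fin t → ℤ)).map π
  have : Module.Finite (S k n) (Gr ((Weyl.filtr k n).free (0 : Fin t → ℤ))) :=
    (Weyl.symbolMap k n).gr_free_finite 0
  have : Module.Finite (S k n) (Gr G) := Module.Finite.of_surjective _
    (Gr.map_surjective ((Weyl.filtr k n).free (0 : Fin t → ℤ)) G π (fun _ v hv => ⟨v, hv, rfl⟩)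
      fun _ _ h => h)
  obtain ⟨c, hc⟩ := Weyl.free_step_eq_bot (k := k) (n := n) (0 : Fin t → ℤ)
  obtain ⟨r, m, ε, hε, hstrict, hmin⟩ := exists_minimal_cover G (c := c)
    ((congrArg _ hc).trans (Submodule.map_bot _))
  have hsurj : Function.Surjective ε := by
    intro w
    obtain ⟨u, rfl⟩ := hπ w
    obtain ⟨j, hj⟩ := (Weyl.symbolMap k n).exists_mem_free_step 0 u
    obtain ⟨u', _, hu'⟩ := hstrict j (π u) ⟨u, hj, rfl⟩
    exact ⟨u', hu'⟩
  let s0 : Syzygy k n := ⟨r, m, LinearMap.ker ε, fun j u hu hu0 => hmin j u hu (by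
    rw [LinearMap.mem_ker.1 hu0]
    exact zero_mem _)⟩
  choose next φ hrange hker hφ hφstrict using Syzygy.exists_next (k := k) (n := n)
  let s : ℕ → Syzygy k n := fun i => Nat.rec s0 (fun _ => next) i
  have hcomp0 : ε ∘ₗ φ (s 0) = 0 := LinearMap.range_le_ker_iff.1 (hrange s0).le
  have hexact : ∀ i, LinearMap.ker (φ (s i)) = LinearMap.range (φ (s (i + 1))) := fun i =>
    (hker (s i)).trans (hrange (s (i + 1))).symm
  refine ⟨{ r := fun i => (s i).r, m := fun i => (s i).m, ε := ε, φ := fun i => φ (s i),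
            surjective := hsurj, exact_zero := (hrange s0).symm, exact_succ := hexact,
            filtered := fun i => hφ (s i), gr_minimal := ?_ }⟩
  constructor
  · exact fun i => ⟨_, Weyl.grading_free_eq_iSup _⟩
  · exact Gr.map_mem_grading _ _ _ _
  · exact fun i => Gr.map_mem_grading _ _ _ _
  · exact Gr.map_surjective _ _ _ _ fun _ _ h => h
  · exact Gr.ker_map_eq_range_map _ _ _ _ _ _ _ hcomp0 (fun j v _ h => h)
      fun j v hv hv0 => hφstrict s0 j v hv hv0
  · intro i
    refine Gr.ker_map_eq_range_map _ _ _ _ _ _ _ (LinearMap.range_le_ker_iff.1 (hexact i).ge) ?_ ?_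
    · intro j v _ h
      exact hφstrict (s i) (j - 1) _ h (hrange (s i) ▸ ⟨v, rfl⟩)
    · intro j v hv hv0
      exact hφstrict (s (i + 1)) j v hv (hker (s i) ▸ hv0)
  · exact fun i => Weyl.range_gr_map_le (φ (s i)) (hφ (s i)) fun j u hu l =>
      (s i).minimal j _ (hφ (s i) j u hu) (hrange (s i) ▸ ⟨u, rfl⟩) l

end Existence

end GradedBetti

/-! ### Homogenization of vectors and of maps -/

namespace GradedBetti

open MvPolynomial

section Homogenization

variable {k : Type u} [Field k] {n : ℕ}

variable (k n) in
/-- The dehomogenization of vectors, a map that is semilinear along `dehom`. -/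
noncomputable def dehomPi (r : ℕ) :
    (Fin r → HWeyl k n) →ₛₗ[(dehom k n : HWeyl k n →+* Weyl k n)] (Fin r → Weyl k n) where
  toFun P l := dehom k n (P l)
  map_add' P Q := by
    funext l
    exact map_add _ _ _
  map_smul' a P := by
    funext l
    exact map_mul _ _ _

theorem dehomPi_apply {r : ℕ} (P : Fin r → HWeyl k n) (l : Fin r) :
    dehomPi k n r P l = dehom k n (P l) := rfl

theorem dehomPi_mem {r : ℕ} {m : Fin r → ℤ} {d : ℤ} {P : Fin r → HWeyl k n}
    (hP : P ∈ freeGrading (HWeyl.grading k n) m d) :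
    dehomPi k n r P ∈ ((Weyl.filtr k n).free m).step d :=
  fun l hl => dehom_mem (hP l hl)

theorem exists_dehomPi_eq {r : ℕ} {m : Fin r → ℤ} {d : ℤ} {P : Fin r → Weyl k n}
    (hP : P ∈ ((Weyl.filtr k n).free m).step d) :
    ∃ Q ∈ freeGrading (HWeyl.grading k n) m d, dehomPi k n r Q = P := by
  choose Q hQ e using fun l => exists_dehom_eq (hP l trivial)
  exact ⟨Q, fun l _ => hQ l, funext e⟩

theorem dehomPi_injOn {r : ℕ} {m : Fin r → ℤ} {d : ℤ} {P : Fin r → HWeyl k n}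
    (hP : P ∈ freeGrading (HWeyl.grading k n) m d) (h : dehomPi k n r P = 0) : P = 0 :=
  funext fun l => dehom_injOn (hP l trivial) (congrFun h l)

theorem dehomPi_surjective (r : ℕ) : Function.Surjective (dehomPi k n r) := fun P => by
  choose Q hQ using fun l => dehom_surjective (P l)
  exact ⟨Q, funext hQ⟩

theorem dehomPi_eq_zero_iff {r : ℕ} (P : Fin r → HWeyl k n) :
    dehomPi k n r P = 0 ↔ ∃ Q, P = (HWeyl.gen k n none - 1) • Q := by
  constructor
  · intro h
    choose Q hQ using fun l => (dehom_eq_zero_iff (P l)).1 (congrFun h l)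
    exact ⟨Q, funext hQ⟩
  · rintro ⟨Q, rfl⟩
    exact funext fun l => (dehom_eq_zero_iff _).2 ⟨Q l, rfl⟩

namespace FilteredFreeResolution

variable {M : Type u} [AddCommGroup M] [Module k M] [Module (Weyl k n) M]
  [IsScalarTower k (Weyl k n) M] (F : FilteredFreeResolution k n M)

/-- A filtered free resolution is strictly exact at its free terms of positive index. -/
theorem exists_φ_succ_eq (i : ℕ) (j : ℤ) : ∀ v ∈ (F.freeFiltr (i + 1)).step j, F.φ i v = 0 →
    ∃ u ∈ (F.freeFiltr (i + 2)).step j, F.φ (i + 1) u = v := by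
  obtain ⟨c, hc⟩ := Weyl.free_step_eq_bot (k := k) (n := n) (F.m (i + 1))
  exact Gr.exists_eq_of_exact (F.gr_minimal.exact_succ i).le
    (LinearMap.range_le_ker_iff.1 (F.exact_succ i).ge) hc j

theorem φ_single_mem (i : ℕ) (a : Fin (F.r (i + 1))) (b : Fin (F.r i)) :
    F.φ i (Pi.single a 1) b ∈ (Weyl.filtr k n).step (F.m (i + 1) a - F.m i b) :=
  F.filtered i _ _ (Weyl.single_mem k n (F.m (i + 1)) a) b trivial

theorem existsUnique_isHomogenization : ∃! ψ, F.IsHomogenization ψ := by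
  choose Q hQ e using fun i a b => exists_dehom_eq (F.φ_single_mem i a b)
  let ψ : ∀ i, (Fin (F.r (i + 1)) → HWeyl k n) →ₗ[HWeyl k n] (Fin (F.r i) → HWeyl k n) :=
    fun i => (Pi.basisFun (HWeyl k n) (Fin (F.r (i + 1)))).constr ℕ fun a => Q i a
  have hψ : ∀ i a, ψ i (Pi.single a 1) = Q i a := fun i a => by
    rw [← Pi.basisFun_apply]
    exact Module.Basis.constr_basis _ _ _ _
  refine ⟨ψ, fun i a b => ?_, fun χ hχ => funext fun i => ?_⟩
  · rw [hψ]
    exact ⟨hQ i a b, e i a b⟩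
  · refine (Pi.basisFun _ _).ext fun a => funext fun b => ?_
    rw [Pi.basisFun_apply, hψ, ← sub_eq_zero]
    refine dehom_injOn (sub_mem (hχ i a b).1 (hQ i a b)) ?_
    rw [map_sub, (hχ i a b).2, e, sub_self]

namespace IsHomogenization

variable {F} {ψ : ∀ i, (Fin (F.r (i + 1)) → HWeyl k n) →ₗ[HWeyl k n] (Fin (F.r i) → HWeyl k n)}
  (hψ : F.IsHomogenization ψ)

include hψ

theorem dehomPi_map (i : ℕ) (P : Fin (F.r (i + 1)) → HWeyl k n) :
    dehomPi k n _ (ψ i P) = F.φ i (dehomPi k n _ P) := by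
  funext b
  rw [dehomPi_apply, map_apply_eq_sum (ψ i), map_apply_eq_sum (F.φ i), map_sum]
  exact Finset.sum_congr rfl fun a _ => by rw [map_mul, (hψ i a b).2, dehomPi_apply]

theorem map_mem_freeGradingh (i : ℕ) (j : ℤ) (P : Fin (F.r (i + 1)) → HWeyl k n)
    (hP : P ∈ F.freeGradingh (i + 1) j) : ψ i P ∈ F.freeGradingh i j := by
  intro b _
  change ψ i P b ∈ _
  rw [map_apply_eq_sum (ψ i)]
  refine Submodule.sum_mem _ fun a _ => ?_
  have := HWeyl.mul_mem_grading _ _ _ (hP a trivial) _ (hψ i a b).1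
  rwa [sub_add_sub_cancel] at this

theorem map_mem_step (i : ℕ) (j : ℤ) (P : Fin (F.r (i + 1)) → HWeyl k n)
    (hP : P ∈ (F.freeFiltrh (i + 1)).step j) : ψ i P ∈ (F.freeFiltrh i).step j := by
  intro b _
  change ψ i P b ∈ _
  rw [map_apply_eq_sum (ψ i)]
  refine Submodule.sum_mem _ fun a _ => ?_
  have := HWeyl.smul_mem (HWeyl.filtr k n) (hP a trivial)
    (HWeyl.grading_le_stepL _ (hψ i a b).1)
  rwa [sub_add_sub_cancel] at this

theorem comp_eq_zero (i : ℕ) : ψ i ∘ₗ ψ (i + 1) = 0 := by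
  refine (Pi.basisFun _ _).ext fun a => ?_
  have hmem : ψ i (ψ (i + 1) (Pi.single a 1)) ∈ F.freeGradingh i (F.m (i + 2) a) :=
    hψ.map_mem_freeGradingh i _ _ fun b _ => (hψ (i + 1) a b).1
  rw [Pi.basisFun_apply, LinearMap.comp_apply, LinearMap.zero_apply]
  refine dehomPi_injOn hmem ?_
  rw [hψ.dehomPi_map, hψ.dehomPi_map, ← LinearMap.comp_apply,
    LinearMap.range_le_ker_iff.1 (F.exact_succ i).ge, LinearMap.zero_apply]

/-- The cokernel `M^(h)` specializes to `M` for `h = 1`. -/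
theorem exists_dehom_equiv : ∃ π : F.Mh ψ →ₛₗ[(dehom k n : HWeyl k n →+* Weyl k n)] M,
    Function.Surjective π ∧ (∀ P, π (F.εh ψ P) = F.ε fun l => dehom k n (P l)) ∧
      ∀ z, π z = 0 ↔ ∃ y, z = (HWeyl.gen k n none - 1) • y := by
  have hle : LinearMap.range (ψ 0) ≤ LinearMap.ker (F.ε.comp (dehomPi k n (F.r 0))) := by
    rintro _ ⟨P, rfl⟩
    rw [LinearMap.mem_ker, LinearMap.comp_apply, hψ.dehomPi_map, ← LinearMap.mem_ker, F.exact_zero]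
    exact ⟨_, rfl⟩
  refine ⟨(LinearMap.range (ψ 0)).liftQ _ hle, ?_, fun P => rfl, ?_⟩
  · intro w
    obtain ⟨P, rfl⟩ := F.surjective w
    obtain ⟨Q, rfl⟩ := dehomPi_surjective _ P
    exact ⟨F.εh ψ Q, rfl⟩
  · intro z
    obtain ⟨P, rfl⟩ := Submodule.mkQ_surjective _ z
    change F.ε (dehomPi k n _ P) = 0 ↔ _
    constructor
    · intro h
      rw [← LinearMap.mem_ker, F.exact_zero] at h
      obtain ⟨u, hu⟩ := h
      obtain ⟨Q, rfl⟩ := dehomPi_surjective _ u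
      obtain ⟨R, hR⟩ := (dehomPi_eq_zero_iff (P - ψ 0 Q)).1 (by
        rw [map_sub, hψ.dehomPi_map, hu, sub_self])
      refine ⟨(LinearMap.range (ψ 0)).mkQ R, ?_⟩
      rw [← map_smul, ← hR, map_sub, (LinearMap.range (ψ 0)).mkQ_apply (ψ 0 Q),
        (Submodule.Quotient.mk_eq_zero _).2 (LinearMap.mem_range_self _ Q), sub_zero]
    · rintro ⟨y, hy⟩
      obtain ⟨R, rfl⟩ := Submodule.mkQ_surjective _ y
      rw [← map_smul, ← sub_eq_zero, ← map_sub, Submodule.mkQ_apply,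
        Submodule.Quotient.mk_eq_zero] at hy
      have h0 := hle hy
      rw [LinearMap.mem_ker, map_sub, LinearMap.comp_apply, LinearMap.comp_apply,
        (dehomPi_eq_zero_iff _).2 ⟨R, rfl⟩, map_zero, sub_zero] at h0
      exact h0

/-- In degree `j` the exactness of the homogenization is the strict exactness of the resolution in
the `j`-th step. -/
theorem ker_eq_range (i : ℕ) : LinearMap.ker (ψ i) = LinearMap.range (ψ (i + 1)) := by
  refine le_antisymm ?_ (LinearMap.range_le_ker_iff.2 (hψ.comp_eq_zero i))
  rw [← Submodule.restrictScalars_le (S := k)]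
  refine (ker_le_iSup_inf (iSup_freeGrading HWeyl.iSup_grading (F.m (i + 1)))
    (freeGrading_iSupIndep HWeyl.iSupIndep_grading (F.m i)) ((ψ i).restrictScalars k)
    (hψ.map_mem_freeGradingh i)).trans (iSup_le fun j => ?_)
  rintro P ⟨hP, hP0⟩
  replace hP0 : ψ i P = 0 := hP0
  have h0 := hψ.dehomPi_map i P
  rw [hP0, map_zero] at h0
  obtain ⟨u, hu, e⟩ := F.exists_φ_succ_eq i j _ (dehomPi_mem hP) h0.symm
  obtain ⟨Q, hQ, rfl⟩ := exists_dehomPi_eq hu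
  refine ⟨Q, ?_⟩
  rw [← sub_eq_zero]
  refine dehomPi_injOn (sub_mem (hψ.map_mem_freeGradingh (i + 1) j Q hQ) hP) ?_
  rw [map_sub, hψ.dehomPi_map, e, sub_self]

/-- On homogeneous vectors, the leading forms of the values of `ψ i` are free of `h`, and equal to
those of the corresponding values of `φ i`. -/
theorem leading_map (i : ℕ) (j : ℤ) (P : Fin (F.r (i + 1)) → HWeyl k n)
    (hP : P ∈ F.freeGradingh (i + 1) j) (b : Fin (F.r i)) :
    (HWeyl.symbolMap k n).leading (F.m i) j (ψ i P) b =
      algebraMap (S k n) (Sh k n)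
        ((Weyl.symbolMap k n).leading (F.m i) j (F.φ i (dehomPi k n _ P)) b) := by
  rw [SymbolMap.leading_apply, SymbolMap.leading_apply, ← hψ.dehomPi_map]
  exact leading_form_eq (hψ.map_mem_freeGradingh i j P hP b trivial)

omit hψ in
variable (F) in
/-- By minimality of `gr F`, its matrices have no entries that are nonzero constants. -/
theorem constantCoeff_leading_φ (i : ℕ) (a : Fin (F.r (i + 1))) (b : Fin (F.r i)) :
    constantCoeff ((Weyl.symbolMap k n).leading (F.m i) (F.m (i + 1) a)
      (F.φ i (Pi.single a 1)) b) = 0 := by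
  have h := repr_mem_of_mem_smul_top ((Weyl.symbolMap k n).grBasis (F.m i))
    constantCoeff_eq_zero_of_mem_polyGrading
    (F.gr_minimal.minimal i ⟨F.e (i + 1) a, rfl⟩) b
  rwa [SymbolMap.grBasis_repr, e, Gr.map_symb, SymbolMap.grFree_symb] at h

/-- An entry of degree zero is a constant, which also occurs in the matrix of `gr F`. -/
theorem entry_mem_irrelevant (i : ℕ) (a : Fin (F.r (i + 1))) (b : Fin (F.r i)) :
    ψ i (Pi.single a 1) b ∈ irrelevant (HWeyl.grading k n) := by
  obtain ⟨hP, hd⟩ := hψ i a b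
  rcases lt_trichotomy (F.m (i + 1) a - F.m i b) 0 with h | h | h
  · rw [HWeyl.eq_zero_of_mem_grading h hP]
    exact zero_mem _
  · have h1 := constantCoeff_leading_φ F i a b
    rw [h] at hP
    obtain ⟨c, hc⟩ := HWeyl.eq_algebraMap_of_mem_grading hP
    rw [SymbolMap.leading_apply, ← hd, hc, AlgHom.commutes, h, SymbolMap.σ_algebraMap,
      weightedHomogeneousComponent_eq_self (isWeightedHomogeneous_C _ c), constantCoeff_C] at h1
    rw [hc, h1, map_zero]
    exact zero_mem _
  · exact Ideal.subset_span ⟨_, h, hP⟩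

/-- The homogenization of a filtered free resolution is a graded minimal free resolution. -/
theorem isMinimalGradedFreeResolution :
    IsMinimalGradedFreeResolution (HWeyl.grading k n) (F.gradingMh ψ) F.freeGradingh
      F.r F.m (F.εh ψ) ψ where
  free i := ⟨_, freeGrading_eq_iSup (F.m i)⟩
  ε_homogeneous j P hP := ⟨P, hP, rfl⟩
  d_homogeneous := hψ.map_mem_freeGradingh
  surjective := Submodule.mkQ_surjective _
  exact_zero := Submodule.ker_mkQ _
  exact_succ := hψ.ker_eq_range
  minimal i := by
    rw [LinearMap.range_eq_map, ← (Pi.basisFun _ _).span_eq, Submodule.map_span,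
      Submodule.span_le]
    rintro _ ⟨_, ⟨a, rfl⟩, rfl⟩
    rw [Pi.basisFun_apply]
    exact mem_smul_top_of_repr_mem (Pi.basisFun _ _) fun b => hψ.entry_mem_irrelevant i a b

end IsHomogenization

end FilteredFreeResolution

end Homogenization

end GradedBetti

/-! ### The associated graded complex of the homogenization -/

namespace GradedBetti

open MvPolynomial TensorProduct

section InducedGrading

variable {k : Type*} [Field k] {ι : Type*}

theorem weightedHomogeneousComponent_mem_weightedHomogeneousSubmodule {wt wt' : ι → ℤ} {d : ℤ}
    {p : MvPolynomial ι k} (hp : p ∈ weightedHomogeneousSubmodule k wt' d) (i : ℤ) :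
    weightedHomogeneousComponent wt i p ∈ weightedHomogeneousSubmodule k wt' d := by
  classical
  intro α hα
  rw [coeff_weightedHomogeneousComponent] at hα
  exact hp fun h => hα (by simp [h])

/-- A monomial is homogeneous for any two weights. -/
theorem weightedHomogeneousSubmodule_le_iSup (wt wt' : ι → ℤ) (d : ℤ) :
    weightedHomogeneousSubmodule k wt' d ≤
      ⨆ i, weightedHomogeneousSubmodule k wt i ⊓ weightedHomogeneousSubmodule k wt' d := by
  intro p hp
  rw [p.as_sum]
  refine Submodule.sum_mem _ fun α hα => Submodule.mem_iSup_of_mem (Finsupp.weight wt α) ⟨?_, ?_⟩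
  · exact isWeightedHomogeneous_monomial _ _ _ rfl
  · exact isWeightedHomogeneous_monomial _ _ _ (hp (mem_support_iff.1 hα))

theorem rename_mem_polyGrading {κ : Type*} (f : ι → κ) {d : ℤ} {p : MvPolynomial ι k}
    (hp : p ∈ polyGrading k ι d) : rename f p ∈ polyGrading k κ d := by
  rw [polyGrading] at hp ⊢
  split_ifs at hp ⊢ with h
  · exact IsHomogeneous.rename_isHomogeneous hp
  · rw [Submodule.mem_bot] at hp ⊢
    rw [hp, map_zero]

end InducedGrading

section HomogenizedGradings

variable {k : Type u} [Field k] {n : ℕ}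

/-- The total degree on `gr (D^(h))^r[m]` in coordinates. -/
theorem HWeyl.mem_inducedGrading_free_iff {r : ℕ} (m : Fin r → ℤ) (j : ℤ)
    (z : Gr ((HWeyl.filtr k n).free m)) :
    z ∈ Gr.inducedGrading ((HWeyl.filtr k n).free m) (freeGrading (HWeyl.grading k n) m) j ↔
      (HWeyl.symbolMap k n).grFree m z ∈
        freeGrading (polyGrading k (Option (Fin n ⊕ Fin n))) m j := by
  constructor
  · intro hz
    suffices h : Gr.inducedGrading ((HWeyl.filtr k n).free m)
        (freeGrading (HWeyl.grading k n) m) j ≤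
        (freeGrading (polyGrading k (Option (Fin n ⊕ Fin n))) m j).comap
          (((HWeyl.symbolMap k n).grFree m).restrictScalars k) from h hz
    refine iSup_le fun i => ?_
    rintro _ ⟨v, hv, rfl⟩ l _
    rw [LinearMap.restrictScalars_apply, SymbolMap.grFree_symb, SymbolMap.leading_apply]
    change _ ∈ polyGrading k _ (j - m l)
    rw [polyGrading_eq]
    refine weightedHomogeneousComponent_mem_weightedHomogeneousSubmodule ?_ _
    rw [← polyGrading_eq, ← HWeyl.mem_grading_iff]
    exact hv l trivial
  · intro hz
    rw [← ((HWeyl.symbolMap k n).grBasis m).sum_repr z]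
    refine Submodule.sum_mem _ fun l _ => ?_
    rw [SymbolMap.grBasis_repr]
    have hl := hz l trivial
    generalize (HWeyl.symbolMap k n).grFree m z l = p at hl
    suffices h : polyGrading k (Option (Fin n ⊕ Fin n)) (j - m l) ≤
        (Gr.inducedGrading ((HWeyl.filtr k n).free m) (freeGrading (HWeyl.grading k n) m) j).comap
          ((LinearMap.toSpanSingleton (Sh k n) _
            ((HWeyl.symbolMap k n).grBasis m l)).restrictScalars k) from h hl
    rw [polyGrading_eq]
    refine (weightedHomogeneousSubmodule_le_iSup (HWeyl.wt n) _ _).trans (iSup_le fun i => ?_)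
    rintro q ⟨hq, hq'⟩
    rw [← polyGrading_eq] at hq'
    -- The vector with the single entry `Q` of full symbol `q` has the class `q • e_l`.
    set Q := (HWeyl.symbolMap k n).σ.symm q with hQ
    have hQq : (HWeyl.symbolMap k n).σ Q = q := LinearEquiv.apply_symm_apply _ _
    have hQ1 : Pi.single l Q ∈ ((HWeyl.filtr k n).free m).step (i + m l) := by
      intro l' _
      by_cases h : l' = l
      · subst h
        change (Pi.single l' Q : Fin r → HWeyl k n) l' ∈
          (HWeyl.filtr k n).step (i + m l' - m l')
        rw [Pi.single_eq_same, add_sub_cancel_right, (HWeyl.symbolMap k n).mem_step, hQq]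
        exact weightedHomogeneousSubmodule_le_weightLE i hq
      · simp [h]
    refine Submodule.mem_iSup_of_mem (i + m l) ⟨⟨_, hQ1⟩, ?_, ?_⟩
    · intro l' _
      by_cases h : l' = l
      · subst h
        change (Pi.single l' Q : Fin r → HWeyl k n) l' ∈ HWeyl.grading k n (j - m l')
        rw [Pi.single_eq_same, HWeyl.mem_grading_iff, hQq]
        exact hq'
      · simp [h]
    · rw [SymbolMap.symb_eq_sum (HWeyl.symbolMap k n), Finset.sum_eq_single l]
      · rw [SymbolMap.leading_apply, Subtype.coe_mk, Pi.single_eq_same, hQq, add_sub_cancel_right,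
          weightedHomogeneousComponent_eq_self hq]
        rfl
      · intro l' _ h
        rw [SymbolMap.leading_apply, Subtype.coe_mk, Pi.single_eq_of_ne h, map_zero, map_zero, zero_smul]
      · exact fun h => absurd (Finset.mem_univ l) h

theorem HWeyl.inducedGrading_free_eq_iSup {r : ℕ} (m : Fin r → ℤ) (j : ℤ) :
    Gr.inducedGrading ((HWeyl.filtr k n).free m) (freeGrading (HWeyl.grading k n) m) j =
      ⨆ l, (polyGrading k (Option (Fin n ⊕ Fin n)) (j - m l)).map
        ((LinearMap.toSpanSingleton (Sh k n) (Gr ((HWeyl.filtr k n).free m))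
          ((HWeyl.symbolMap k n).grBasis m l)).restrictScalars k) := by
  rw [iSup_map_toSpanSingleton_eq]
  ext z
  rw [HWeyl.mem_inducedGrading_free_iff, Submodule.mem_comap, ← SymbolMap.grBasis_equivFun]
  rfl

theorem HWeyl.iSupIndep_inducedGrading_free {r : ℕ} (m : Fin r → ℤ) :
    iSupIndep (Gr.inducedGrading ((HWeyl.filtr k n).free m)
      (freeGrading (HWeyl.grading k n) m)) := by
  have h := iSupIndep_comap_of_injective (freeGrading_iSupIndep iSupIndep_polyGrading m)
    (((HWeyl.symbolMap k n).grFree m).restrictScalars k) ((HWeyl.symbolMap k n).grFree_injective m)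
  refine (congrArg iSupIndep (funext fun j => ?_)).mp h
  ext z
  exact (HWeyl.mem_inducedGrading_free_iff m j z).symm

theorem HWeyl.iSup_inducedGrading_free {r : ℕ} (m : Fin r → ℤ) :
    ⨆ j, Gr.inducedGrading ((HWeyl.filtr k n).free m) (freeGrading (HWeyl.grading k n) m) j =
      ⊤ := by
  rw [eq_top_iff]
  intro z _
  rw [← ((HWeyl.symbolMap k n).grBasis m).sum_repr z]
  refine Submodule.sum_mem _ fun l _ => ?_
  generalize ((HWeyl.symbolMap k n).grBasis m).repr z l = p
  obtain ⟨g, hg, rfl⟩ := (Submodule.mem_iSup_iff_exists_finsupp _ p).1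
    ((iSup_polyGrading (k := k)) ▸ Submodule.mem_top)
  rw [Finsupp.sum, Finset.sum_smul]
  refine Submodule.sum_mem _ fun d _ => Submodule.mem_iSup_of_mem (d + m l) ?_
  rw [HWeyl.inducedGrading_free_eq_iSup]
  exact Submodule.mem_iSup_of_mem l ⟨g d, by simpa using hg d, rfl⟩

variable (k n) in
/-- `k[h,x,∂] = k[x,∂][h]`, as modules over `k[x,∂]`. -/
noncomputable def shEquivPolynomial : Sh k n ≃ₗ[S k n] Polynomial (S k n) where
  __ := (optionEquivLeft k (Fin n ⊕ Fin n)).toRingEquiv.toAddEquiv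
  map_smul' p q := by
    have h : ∀ p : S k n, optionEquivLeft k (Fin n ⊕ Fin n) (rename some p) = Polynomial.C p := by
      intro p
      induction p using MvPolynomial.induction_on with
      | C c => rw [rename_C, optionEquivLeft_C]
      | add p q hp hq => rw [map_add, map_add, hp, hq, map_add]
      | mul_X p a hp => rw [map_mul, map_mul, hp, rename_X, optionEquivLeft_X_some, map_mul]
    change optionEquivLeft k (Fin n ⊕ Fin n) (rename some p * q) = _
    rw [map_mul, h, ← Polynomial.smul_eq_C_mul]
    rfl

instance : Module.Free (S k n) (Sh k n) := Module.Free.of_equiv (shEquivPolynomial k n).symm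

end HomogenizedGradings

/-- Two surjections with the same kernel have isomorphic targets. -/
theorem exists_equiv_of_ker_eq {R P N N' : Type*} [Ring R] [AddCommGroup P] [Module R P]
    [AddCommGroup N] [Module R N] [AddCommGroup N'] [Module R N'] (f : P →ₗ[R] N) (g : P →ₗ[R] N')
    (hf : Function.Surjective f) (hg : Function.Surjective g)
    (h : LinearMap.ker f = LinearMap.ker g) : ∃ θ : N ≃ₗ[R] N', ∀ z, θ (f z) = g z := by
  refine ⟨(f.quotKerEquivOfSurjective hf).symm ≪≫ₗ Submodule.quotEquivOfEq _ _ h ≪≫ₗ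
    g.quotKerEquivOfSurjective hg, fun z => ?_⟩
  have : (f.quotKerEquivOfSurjective hf).symm (f z) = Submodule.Quotient.mk z := by
    rw [LinearEquiv.symm_apply_eq]
    rfl
  rw [LinearEquiv.trans_apply, LinearEquiv.trans_apply, this]
  rfl

section GrHomogenization

variable {k : Type u} [Field k] {n : ℕ} {M : Type u} [AddCommGroup M] [Module k M]
  [Module (Weyl k n) M] [IsScalarTower k (Weyl k n) M]

namespace FilteredFreeResolution

variable (F : FilteredFreeResolution k n M)

theorem grBasis_eq_e (i : ℕ) (l : Fin (F.r i)) :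
    (Weyl.symbolMap k n).grBasis (F.m i) l = F.e i l :=
  SymbolMap.grBasis_apply _ _ _ _

theorem grBasis_eq_eh (i : ℕ) (l : Fin (F.r i)) :
    (HWeyl.symbolMap k n).grBasis (F.m i) l = F.eh i l :=
  SymbolMap.grBasis_apply _ _ _ _

/-- The isomorphism `S[h] ⊗ gr D^r ≅ gr (D^(h))^r` that matches the standard bases. -/
noncomputable def grEquiv (i : ℕ) :
    Sh k n ⊗[S k n] Gr (F.freeFiltr i) ≃ₗ[Sh k n] Gr (F.freeFiltrh i) :=
  (((Weyl.symbolMap k n).grBasis (F.m i)).baseChange (Sh k n)).equiv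
    ((HWeyl.symbolMap k n).grBasis (F.m i)) (Equiv.refl _)

theorem grEquiv_e (i : ℕ) (l : Fin (F.r i)) : F.grEquiv i (1 ⊗ₜ F.e i l) = F.eh i l := by
  rw [← grBasis_eq_e, ← grBasis_eq_eh, ← Module.Basis.baseChange_apply, grEquiv,
    Module.Basis.equiv_apply]
  rfl

namespace IsHomogenization

variable {F} {ψ : ∀ i, (Fin (F.r (i + 1)) → HWeyl k n) →ₗ[HWeyl k n] (Fin (F.r i) → HWeyl k n)}
  (hψ : F.IsHomogenization ψ)

/-- The differentials of the complex `gr F^(h)`. -/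
noncomputable abbrev grψ (i : ℕ) : Gr (F.freeFiltrh (i + 1)) →ₗ[Sh k n] Gr (F.freeFiltrh i) :=
  Gr.map (F.freeFiltrh (i + 1)) (F.freeFiltrh i) (ψ i) (hψ.map_mem_step i)

theorem dehomPi_single (i : ℕ) (a : Fin (F.r i)) :
    dehomPi k n _ (Pi.single a 1) = (Pi.single a 1 : Fin (F.r i) → Weyl k n) := by
  funext l
  rw [dehomPi_apply]
  by_cases h : l = a
  · subst h
    rw [Pi.single_eq_same, Pi.single_eq_same, map_one]
  · rw [Pi.single_eq_of_ne h, Pi.single_eq_of_ne h, map_zero]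

/-- The matrix of `gr F^(h)` is that of `gr F`. -/
theorem grψ_eh (i : ℕ) (a : Fin (F.r (i + 1))) :
    hψ.grψ i (F.eh (i + 1) a) = ∑ b, algebraMap (S k n) (Sh k n)
      ((Weyl.symbolMap k n).leading (F.m i) (F.m (i + 1) a) (F.φ i (Pi.single a 1)) b) •
        F.eh i b := by
  have hmem : Pi.single a 1 ∈ F.freeGradingh (i + 1) (F.m (i + 1) a) := by
    intro l _
    by_cases h : l = a
    · subst h
      simpa using HWeyl.one_mem_grading
    · simp [h]
  rw [eh, Gr.map_symb, SymbolMap.symb_eq_sum (HWeyl.symbolMap k n)]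
  refine Finset.sum_congr rfl fun b _ => ?_
  rw [hψ.leading_map i _ _ hmem, dehomPi_single, grBasis_eq_eh]

theorem grEquiv_grφ (i : ℕ) (z : Sh k n ⊗[S k n] Gr (F.freeFiltr (i + 1))) :
    F.grEquiv i ((F.grφ i).baseChange (Sh k n) z) = hψ.grψ i (F.grEquiv (i + 1) z) := by
  suffices h : (F.grEquiv i).toLinearMap ∘ₗ (F.grφ i).baseChange (Sh k n) =
      hψ.grψ i ∘ₗ (F.grEquiv (i + 1)).toLinearMap from LinearMap.congr_fun h z
  refine (((Weyl.symbolMap k n).grBasis (F.m (i + 1))).baseChange (Sh k n)).ext fun a => ?_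
  rw [Module.Basis.baseChange_apply, grBasis_eq_e, LinearMap.comp_apply, LinearMap.comp_apply,
    LinearMap.baseChange_tmul, LinearEquiv.coe_coe, LinearEquiv.coe_coe, grEquiv_e, hψ.grψ_eh,
    e, Gr.map_symb, SymbolMap.symb_eq_sum (Weyl.symbolMap k n), TensorProduct.tmul_sum, map_sum]
  refine Finset.sum_congr rfl fun b _ => ?_
  rw [TensorProduct.tmul_smul, ← algebraMap_smul (Sh k n), map_smul, grBasis_eq_e, grEquiv_e]

/-- Exactness is inherited from `gr F` by flatness of `S[h]` over `S`. -/
theorem ker_grψ (i : ℕ) : LinearMap.ker (hψ.grψ i) = LinearMap.range (hψ.grψ (i + 1)) := by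
  have hex : Function.Exact ((F.grφ (i + 1)).baseChange (Sh k n))
      ((F.grφ i).baseChange (Sh k n)) :=
    Module.Flat.lTensor_exact (Sh k n)
      (LinearMap.exact_iff.2 (F.gr_minimal.exact_succ i))
  ext y
  obtain ⟨z, rfl⟩ := (F.grEquiv (i + 1)).surjective y
  rw [LinearMap.mem_ker, ← hψ.grEquiv_grφ, LinearEquiv.map_eq_zero_iff, hex z]
  constructor
  · rintro ⟨w, rfl⟩
    exact ⟨F.grEquiv (i + 2) w, (hψ.grEquiv_grφ (i + 1) w).symm⟩
  · rintro ⟨w, hw⟩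
    obtain ⟨w, rfl⟩ := (F.grEquiv (i + 2)).surjective w
    rw [← hψ.grEquiv_grφ] at hw
    exact ⟨w, (F.grEquiv (i + 1)).injective hw⟩

/-- The exactness of the associated graded complex one step further makes `ψ 0` strict. -/
theorem ker_grεh : LinearMap.ker (F.grεh ψ) = LinearMap.range (hψ.grψ 0) := by
  refine Gr.ker_map_eq_range_map _ _ _ _ _ _ _ ?_ (fun j v _ h => h) fun j v hv hv0 => ?_
  · exact LinearMap.range_le_ker_iff.1 (Submodule.ker_mkQ _).ge
  · rw [← LinearMap.mem_ker, Submodule.ker_mkQ] at hv0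
    obtain ⟨u, rfl⟩ := hv0
    obtain ⟨i, hi⟩ := (HWeyl.symbolMap k n).exists_mem_free_step (F.m 1) u
    exact Gr.exists_strict_of_exact (hψ.ker_grψ 0).le (hψ.comp_eq_zero 0) (le_max_right i j) u
      ((F.freeFiltrh 1).mono (le_max_left i j) hi) hv

theorem grεh_surjective : Function.Surjective (F.grεh ψ) :=
  Gr.map_surjective _ _ _ _ fun _ _ h => h

include hψ in
/-- The isomorphism of augmented complexes `S[h] ⊗ gr F ≅ gr F^(h)`, at the augmentation. -/
theorem exists_grM_equiv : ∃ θM : Sh k n ⊗[S k n] Gr F.filtrM ≃ₗ[Sh k n] Gr (F.filtrMh ψ),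
    ∀ z, θM (F.grε.baseChange (Sh k n) z) = F.grεh ψ (F.grEquiv 0 z) := by
  have hex : Function.Exact ((F.grφ 0).baseChange (Sh k n)) (F.grε.baseChange (Sh k n)) :=
    Module.Flat.lTensor_exact (Sh k n) (LinearMap.exact_iff.2 F.gr_minimal.exact_zero)
  refine exists_equiv_of_ker_eq (F.grε.baseChange (Sh k n))
    (F.grεh ψ ∘ₗ (F.grEquiv 0).toLinearMap) ?_ ?_ ?_
  · exact LinearMap.lTensor_surjective (Sh k n) F.gr_minimal.surjective
  · exact grεh_surjective.comp (F.grEquiv 0).surjective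
  · ext z
    rw [LinearMap.mem_ker, hex z, LinearMap.mem_ker, LinearMap.comp_apply, LinearEquiv.coe_coe,
      ← LinearMap.mem_ker, hψ.ker_grεh]
    constructor
    · rintro ⟨w, rfl⟩
      exact ⟨F.grEquiv 1 w, (hψ.grEquiv_grφ 0 w).symm⟩
    · rintro ⟨w, hw⟩
      obtain ⟨w, rfl⟩ := (F.grEquiv 1).surjective w
      rw [← hψ.grEquiv_grφ] at hw
      exact ⟨w, (F.grEquiv 0).injective hw⟩

theorem grψ_minimal (i : ℕ) : LinearMap.range (hψ.grψ i) ≤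
    irrelevant (polyGrading k (Option (Fin n ⊕ Fin n))) • ⊤ := by
  rw [LinearMap.range_eq_map, ← ((HWeyl.symbolMap k n).grBasis (F.m (i + 1))).span_eq,
    Submodule.map_span, Submodule.span_le]
  rintro _ ⟨_, ⟨a, rfl⟩, rfl⟩
  rw [grBasis_eq_eh, hψ.grψ_eh]
  refine Submodule.sum_mem _ fun b _ => Submodule.smul_mem_smul ?_ Submodule.mem_top
  have h1 := Weyl.leading_mem (F.m i) (F.m (i + 1) a) (F.φ i (Pi.single a 1)) b
  have h2 := constantCoeff_leading_φ F i a b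
  exact mem_irrelevant_of_mem_polyGrading (rename_mem_polyGrading some h1)
    ((constantCoeff_rename _ _).trans h2)

/-- The associated graded complex of the homogenization is a graded minimal free resolution. -/
theorem isMinimalGradedFreeResolution_gr :
    IsMinimalGradedFreeResolution (polyGrading k (Option (Fin n ⊕ Fin n)))
      (F.gradingGrMh ψ) F.gradingGrFreeh F.r F.m (F.grεh ψ) hψ.grψ where
  free i := ⟨_, HWeyl.inducedGrading_free_eq_iSup (F.m i)⟩
  ε_homogeneous := Gr.map_mem_inducedGrading _ _ _ _ fun _ P hP => ⟨P, hP, rfl⟩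
  d_homogeneous i := Gr.map_mem_inducedGrading _ _ _ _ (hψ.map_mem_freeGradingh i)
  surjective := grεh_surjective
  exact_zero := hψ.ker_grεh
  exact_succ := hψ.ker_grψ
  minimal := hψ.grψ_minimal

end IsHomogenization

end FilteredFreeResolution

end GrHomogenization

end GradedBetti

/-! ### The gradings of the homogenized module and of its associated graded module -/

namespace GradedBetti

namespace FilteredFreeResolution.IsHomogenization

variable {k : Type u} [Field k] {n : ℕ} {M : Type u} [AddCommGroup M] [Module k M]
  [Module (Weyl k n) M] [IsScalarTower k (Weyl k n) M] {F : FilteredFreeResolution k n M}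
  {ψ : ∀ i, (Fin (F.r (i + 1)) → HWeyl k n) →ₗ[HWeyl k n] (Fin (F.r i) → HWeyl k n)}
  (hψ : F.IsHomogenization ψ)

include hψ

theorem iSupIndep_gradingMh : iSupIndep (F.gradingMh ψ) := by
  refine iSupIndep_map_of_ker_le (freeGrading_iSupIndep HWeyl.iSupIndep_grading (F.m 0))
    ((F.εh ψ).restrictScalars k) ?_
  have hker : LinearMap.ker ((F.εh ψ).restrictScalars k) =
      LinearMap.range ((ψ 0).restrictScalars k) :=
    congrArg (Submodule.restrictScalars k) (Submodule.ker_mkQ (LinearMap.range (ψ 0)))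
  rw [hker]
  exact range_le_iSup_inf (iSup_freeGrading HWeyl.iSup_grading (F.m 1)) _
    (hψ.map_mem_freeGradingh 0)

/-- The total degree on `gr M^(h)` is the one of a quotient of `gr (D^(h))^{r₀}`. -/
theorem gradingGrMh_eq_map (j : ℤ) : F.gradingGrMh ψ j =
    (F.gradingGrFreeh 0 j).map ((F.grεh ψ).restrictScalars k) := by
  apply le_antisymm
  · refine iSup_le fun i => ?_
    rintro _ ⟨⟨_, v, hv, rfl⟩, hw, rfl⟩
    -- A homogeneous class with a representative in the `i`-th step has a representative that is
    -- both homogeneous and in the `i`-th step.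
    obtain ⟨v', ⟨hv'j, hv'i⟩, e⟩ := exists_homogeneous_lift hψ.iSupIndep_gradingMh
      (pi_le_iSup_freeGrading (F.m 0) _ fun l => HWeyl.stepL_le_iSup (i - F.m 0 l))
      ((F.εh ψ).restrictScalars k) (fun _ P hP => ⟨P, hP, rfl⟩) hv hw
    replace hv'i : v' ∈ (F.freeFiltrh 0).step i := hv'i
    refine ⟨Gr.symb _ i ⟨v', hv'i⟩, Submodule.mem_iSup_of_mem i ⟨_, hv'j, rfl⟩, ?_⟩
    exact (Gr.map_symb (F.freeFiltrh 0) (F.filtrMh ψ) (F.εh ψ)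
        (fun _ P hP => ⟨P, hP, rfl⟩) i ⟨v', hv'i⟩).trans
      (Gr.symb_congr (F.filtrMh ψ) rfl _ _ e)
  · rintro _ ⟨z, hz, rfl⟩
    exact hψ.isMinimalGradedFreeResolution_gr.ε_homogeneous j z hz

theorem iSupIndep_gradingGrMh : iSupIndep (F.gradingGrMh ψ) := by
  rw [funext hψ.gradingGrMh_eq_map]
  refine iSupIndep_map_of_ker_le (HWeyl.iSupIndep_inducedGrading_free (F.m 0))
    ((F.grεh ψ).restrictScalars k) ?_
  have hker : LinearMap.ker ((F.grεh ψ).restrictScalars k) =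
      LinearMap.range ((hψ.grψ 0).restrictScalars k) :=
    congrArg (Submodule.restrictScalars k) hψ.ker_grεh
  rw [hker]
  exact range_le_iSup_inf (HWeyl.iSup_inducedGrading_free (F.m 1)) _
    (hψ.isMinimalGradedFreeResolution_gr.d_homogeneous 0)

end FilteredFreeResolution.IsHomogenization

end GradedBetti

open GradedBetti TensorProduct in
theorem proposition5p1 {k : Type u} [Field k] [CharZero k] (n : ℕ) (M : Type u) [AddCommGroup M]
    [Module k M] [Module (Weyl k n) M] [IsScalarTower k (Weyl k n) M]
    [Module.Finite (Weyl k n) M] :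
    Nonempty (FilteredFreeResolution k n M) ∧
    ∀ F : FilteredFreeResolution k n M,
      (∃! ψ, F.IsHomogenization ψ) ∧
      ∀ ψ, F.IsHomogenization ψ →
        -- the dehomogenization of `M^(h)` is `M`
        (∃ π : F.Mh ψ →ₛₗ[(dehom k n : HWeyl k n →+* Weyl k n)] M,
          Function.Surjective π ∧ (∀ P, π (F.εh ψ P) = F.ε fun l => dehom k n (P l)) ∧
          ∀ z, π z = 0 ↔ ∃ y, z = (HWeyl.gen k n none - 1) • y) ∧
        -- `F^(h)` is a graded minimal free resolution of `M^(h)`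
        IsMinimalGradedFreeResolution (HWeyl.grading k n) (F.gradingMh ψ) F.freeGradingh
          F.r F.m (F.εh ψ) ψ ∧
        -- `gr F^(h)` is a graded minimal free resolution of `gr M^(h)`, isomorphic to
        -- `S[h] ⊗ gr F = k[h] ⊗ gr F`
        (∃ hψ : ∀ i j, ∀ P ∈ (F.freeFiltrh (i + 1)).step j, ψ i P ∈ (F.freeFiltrh i).step j,
          IsMinimalGradedFreeResolution (polyGrading k (Option (Fin n ⊕ Fin n)))
            (F.gradingGrMh ψ) F.gradingGrFreeh F.r F.m (F.grεh ψ)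
            (fun i => Gr.map (F.freeFiltrh (i + 1)) (F.freeFiltrh i) (ψ i) (hψ i)) ∧
          ∃ (θ : ∀ i, Sh k n ⊗[S k n] Gr (F.freeFiltr i) ≃ₗ[Sh k n] Gr (F.freeFiltrh i))
            (θM : Sh k n ⊗[S k n] Gr F.filtrM ≃ₗ[Sh k n] Gr (F.filtrMh ψ)),
            (∀ i l, θ i (1 ⊗ₜ F.e i l) = F.eh i l) ∧
            (∀ i z, θ i ((F.grφ i).baseChange (Sh k n) z) =
              Gr.map (F.freeFiltrh (i + 1)) (F.freeFiltrh i) (ψ i) (hψ i) (θ (i + 1) z)) ∧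
            ∀ z, θM (F.grε.baseChange (Sh k n) z) = F.grεh ψ (θ 0 z)) ∧
        -- the graded Betti numbers coincide
        (∃ β : ℕ → ℤ → ℕ,
          HasGradedBettiNumbers (HWeyl.grading k n) (F.gradingMh ψ) β ∧
          HasGradedBettiNumbers (polyGrading k (Fin n ⊕ Fin n)) (Gr.grading F.filtrM) β ∧
          HasGradedBettiNumbers (polyGrading k (Option (Fin n ⊕ Fin n))) (F.gradingGrMh ψ) β) ∧
        -- the projective dimensions coincide
        CategoryTheory.projectiveDimension (ModuleCat.of (HWeyl k n) (F.Mh ψ)) =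
          CategoryTheory.projectiveDimension (ModuleCat.of (S k n) (Gr F.filtrM)) ∧
        CategoryTheory.projectiveDimension (ModuleCat.of (HWeyl k n) (F.Mh ψ)) =
          CategoryTheory.projectiveDimension (ModuleCat.of (Sh k n) (Gr (F.filtrMh ψ))) := by
  refine ⟨nonempty_filteredFreeResolution, fun F => ⟨F.existsUnique_isHomogenization,
    fun ψ hψ => ?_⟩⟩
  have H := hψ.isMinimalGradedFreeResolution
  have Hgr := hψ.isMinimalGradedFreeResolution_gr
  refine ⟨hψ.exists_dehom_equiv, H, ⟨hψ.map_mem_step, Hgr, F.grEquiv, ?_⟩, ?_, ?_, ?_⟩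
  · obtain ⟨θM, hθM⟩ := hψ.exists_grM_equiv
    exact ⟨θM, F.grEquiv_e, hψ.grEquiv_grφ, hθM⟩
  · refine ⟨countTable F.r F.m, ?_, ?_, ?_⟩
    · exact hasGradedBettiNumbers_of_resolution HWeyl.iSupIndep_grading HWeyl.iSup_grading
        HWeyl.one_mem_grading HWeyl.mul_mem_grading (aug := (HWeyl.aug k n : HWeyl k n →+* k))
        HWeyl.aug_eq_zero hψ.iSupIndep_gradingMh H
    · exact hasGradedBettiNumbers_of_resolution iSupIndep_polyGrading iSup_polyGrading
        one_mem_polyGrading mul_mem_polyGrading constantCoeff_eq_zero_of_mem_polyGrading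
        (Gr.iSupIndep_grading _) F.gr_minimal
    · exact hasGradedBettiNumbers_of_resolution iSupIndep_polyGrading iSup_polyGrading
        one_mem_polyGrading mul_mem_polyGrading constantCoeff_eq_zero_of_mem_polyGrading
        hψ.iSupIndep_gradingGrMh Hgr
  · refine projectiveDimension_eq_of_iff fun i => ?_
    rw [H.hasProjectiveDimensionLT_iff (aug := (HWeyl.aug k n : HWeyl k n →+* k))
        HWeyl.aug_eq_zero,
      F.gr_minimal.hasProjectiveDimensionLT_iff constantCoeff_eq_zero_of_mem_polyGrading]
  · refine projectiveDimension_eq_of_iff fun i => ?_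
    rw [H.hasProjectiveDimensionLT_iff (aug := (HWeyl.aug k n : HWeyl k n →+* k))
        HWeyl.aug_eq_zero,
      Hgr.hasProjectiveDimensionLT_iff constantCoeff_eq_zero_of_mem_polyGrading]
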